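/- Let $K\ge 1$, $M\ge 0$, $\eta>2$, $\sigma^2\ge 0$, $\theta\ge 0$. A user at the origin of $\mathbb R^2$ is served jointly by $K$ transmitters at distances $0<d_1<\dots<d_K$ (the cluster geometry). The $i$-th of them transmits with unit power and with probability $p_{\mathrm{tr},i}=1-q_{\mathrm{tr},i}$, where $0<q_{\mathrm{tr},i}\le 1$ may depend on $i$. The remaining (out-of-cluster) nodes of the transmitter tier form a homogeneous Poisson point process (PPP) of intensity $\lambda>0$ outside the disc of radius $d_K$ around the user; they transmit with unit power and with probability $p_{\mathrm{tr},o}\in[0,1]$. Moreover, for $m=1,\dots,M$ the nodes of tier $m$ form a homogeneous PPP on $\mathbb R^2$ of intensity $\lambda_m>0$ and transmit with power $P_m>0$ and with probability $p_{\mathrm{tr}}^{(m)}\in[0,1]$. All fading powers are exponentially distributed with mean $1$; the tiers, the fading powers and the Bernoulli transmission indicators are all independent. Let $$\gamma=\frac{\sum_{i=1}^K \mathbb 1_i H_i d_i^{-\eta}}{I+\sigma^2},$$ where $I=I_0+\sum_{m=1}^M I_m$ is the aggregate interference power: $I_0$ is the sum of $\mathbb 1\,H\,r^{-\eta}$ over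 the out-of-cluster nodes of the transmitter tier and $I_m$ is the sum of $\mathbb 1\,P_m H\,r^{-\eta}$ over the nodes of tier $m$, with $\mathbb 1$, $H$, $r$ the transmission indicator, the fading power and the distance of the node ($a/0=\infty$ for $a>0$ and $0/0=0$). Put $\omega_i=d_i/d_K$, $\Omega=\{\omega_1^\eta,\dots,\omega_K^\eta\}$, $\hat\Omega=\{\omega_1^\eta/q_{\mathrm{tr},1},\dots,\omega_K^\eta/q_{\mathrm{tr},K}\}$, $G=\prod_{i=1}^K q_{\mathrm{tr},i}$; for a multiset $X$ of $K$ numbers let $\alpha_i(X)=(-1)^i e_{K-i}(X)$, with $e_k$ the $k$-th elementary symmetric polynomial; and let $\mathcal F(t_1,t_2)=\frac{2t_1}{t_2-2}\,{}_2F_1\!\left(1,1-\tfrac2{t_2};2-\tfrac2{t_2};-t_1\right)$, with ${}_2F_1$ the (analytically continued) Gauss hypergeometric function. Then $$\Pr[\gamma>\theta]=G\sum_{j=1}^K\left(\frac{\sum_{i=0}^{K-1}\bigl(\alpha_i(\hat\Omega)-\alpha_i(\Omega)\bigr)(\omega_j^\eta)^i}{\omega_j^\eta\prod_{l\ne j}(\omega_l^\eta-\omega_j^\eta)}\right)C_j(\theta),$$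 $$C_j(\theta)=e^{-d_j^\eta\theta\sigma^2}\,e^{-\pi p_{\mathrm{tr},o}\lambda d_K^2\mathcal F(\omega_j^\eta\theta,\eta)}\prod_{m=1}^M e^{-\pi p_{\mathrm{tr}}^{(m)}\lambda_m d_j^2(\theta P_m)^{2/\eta}\Gamma(1+2/\eta)\Gamma(1-2/\eta)}.$$ Likewise, if the whole transmitter tier is a homogeneous PPP of intensity $\lambda$ on $\mathbb R^2$, the cluster consists of its $K$ points closest to the user, and $d_1\le\dots\le d_K$ are their (random) distances, with all other assumptions unchanged, then almost surely $0<d_1<\dots<d_K$, and the conditional probability $\Pr[\gamma>\theta\mid d_1,\dots,d_K]$ is almost surely given by the same formula. -/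

import Mathlib

open MeasureTheory ProbabilityTheory
open scoped ENNReal

noncomputable section

/-! ### The Gauss hypergeometric function on the real half-line `x < 1` -/

/-- The Gauss hypergeometric function `₂F₁(a, b; c; x)` for real `0 < b < c` and `x < 1`.
On the unit disc it is the sum of the hypergeometric series (Mathlib's `ordinaryHypergeometric`,
which is junk outside the disc); for `x ≤ -1` it is the analytic continuation of the series to
`ℂ \ [1, ∞)`, given by Euler's integral
`Γ(c) / (Γ(b) Γ(c - b)) ∫₀¹ t^(b-1) (1-t)^(c-b-1) (1 - x t)^(-a) dt`. -/
def gaussHyp (a b c x : ℝ) : ℝ :=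
  if |x| < 1 then ordinaryHypergeometric a b c x
  else Real.Gamma c / (Real.Gamma b * Real.Gamma (c - b)) *
    ∫ t in (0 : ℝ)..1, t ^ (b - 1) * (1 - t) ^ (c - b - 1) * (1 - x * t) ^ (-a)

/-- `𝓕(t₁, t₂) = 2 t₁ / (t₂ - 2) · ₂F₁(1, 1 - 2/t₂; 2 - 2/t₂; -t₁)`. -/
def pathF (t₁ t₂ : ℝ) : ℝ :=
  2 * t₁ / (t₂ - 2) * gaussHyp 1 (1 - 2 / t₂) (2 - 2 / t₂) (-t₁)

/-! ### Poisson point processes -/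

/-- The plane in which the nodes are located (the user is at the origin). -/
abbrev Plane : Type := EuclideanSpace ℝ (Fin 2)

/-- The number (possibly `∞`) of points of the configuration `x₀, x₁, …` in the set `A`. -/
def pointCount (x : ℕ → Plane) (A : Set Plane) : ℝ≥0∞ :=
  ∑' i, A.indicator 1 (x i)

/-- The random points `X 0, X 1, …` form (an enumeration of) a Poisson point process with intensity
measure `Λ`: the number of points in a measurable set `A` of finite `Λ`-measure is Poisson with
mean `Λ A`, and the numbers of points in disjoint measurable sets are independent. -/
structure IsPPP {Ω : Type*} [MeasurableSpace Ω] (μ : Measure Ω) (X : ℕ → Ω → Plane)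
    (Λ : Measure Plane) : Prop where
  measurable : ∀ i, Measurable (X i)
  poisson : ∀ A : Set Plane, MeasurableSet A → Λ A ≠ ∞ → ∀ n : ℕ,
    μ {ω | pointCount (fun i => X i ω) A = n} = poissonMeasure (Λ A).toNNReal {n}
  indep : ∀ (n : ℕ) (A : Fin n → Set Plane), (∀ k, MeasurableSet (A k)) →
    Pairwise (fun k l => Disjoint (A k) (A l)) →
      iIndepFun (fun k ω => pointCount (fun i => X i ω) (A k)) μ

/-! ### The network -/

/-- The numerical parameters of a network with cluster size `K` and `M` extrinsic tiers. -/
structure NetParams (K M : ℕ) where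
  /-- path-loss exponent `η` -/
  η : ℝ
  /-- noise power `σ²` -/
  noise : ℝ
  /-- intensities `λ₀ = λ, λ₁, …, λ_M` of the tiers -/
  lam : Fin (M + 1) → ℝ
  /-- (normalized) transmit powers `P₁, …, P_M` of the extrinsic tiers -/
  power : Fin M → ℝ
  /-- transmission probabilities of the `K` in-cluster transmitters -/
  pIn : Fin K → ℝ
  /-- transmission probability of the out-of-cluster transmitters of tier `0` -/
  pOut : ℝ
  /-- transmission probabilities of the nodes of the extrinsic tiers -/
  pExt : Fin M → ℝ
  two_lt_η : 2 < η
  noise_nonneg : 0 ≤ noise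
  lam_pos : ∀ m, 0 < lam m
  power_pos : ∀ m, 0 < power m
  /-- `pIn i < 1`: the quotients `ω_i ^ η / q_i` have non-zero denominators -/
  pIn_mem : ∀ i, pIn i ∈ Set.Ico (0 : ℝ) 1
  pOut_mem : pOut ∈ Set.Icc (0 : ℝ) 1
  pExt_mem : ∀ m, pExt m ∈ Set.Icc (0 : ℝ) 1

/-- The random data of a network on a sample space `Ω`: for the `i`-th node of tier `m` (tier `0`
being the transmitter tier) its position, its fading power and whether it transmits. The nodes
`0, …, K - 1` of tier `0` are the in-cluster transmitters. -/
structure Network (M : ℕ) (Ω : Type*) where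
  pos : Fin (M + 1) → ℕ → Ω → Plane
  fade : Fin (M + 1) → ℕ → Ω → ℝ
  act : Fin (M + 1) → ℕ → Ω → Bool

namespace NetParams

variable {K M : ℕ} (p : NetParams K M)

/-- The transmission probability of the `i`-th node of tier `m`. -/
def txProb (m : Fin (M + 1)) (i : ℕ) : ℝ :=
  Fin.cases (if h : i < K then p.pIn ⟨i, h⟩ else p.pOut) (fun m' => p.pExt m') m

/-- The transmit power of tier `m`, normalized so that tier `0` has power `1`. -/
def txPower (m : Fin (M + 1)) : ℝ :=
  Fin.cases 1 (fun m' => p.power m') m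

/-- The intensity measure `λ_m` times the area. -/
def intensity (m : Fin (M + 1)) : Measure Plane := ENNReal.ofReal (p.lam m) • volume

end NetParams

namespace Network

variable {K M : ℕ} {Ω : Type*} [MeasurableSpace Ω]

/-- The assumptions common to a random and to a given cluster geometry: unit-mean exponential
fading powers, Bernoulli transmission indicators, homogeneous Poisson extrinsic tiers, and
independence. Only the law of the positions in tier `0` is left open. -/
structure IsModel (N : Network M Ω) (p : NetParams K M) (μ : Measure Ω) : Prop where
  pos_meas : ∀ m i, Measurable (N.pos m i)
  fade_meas : ∀ m i, Measurable (N.fade m i)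
  act_meas : ∀ m i, Measurable (N.act m i)
  fade_law : ∀ m i, μ.map (N.fade m i) = expMeasure 1
  act_law : ∀ m i, μ.real {ω | N.act m i ω = true} = p.txProb m i
  ext_ppp : ∀ m : Fin M, IsPPP μ (N.pos m.succ) (p.intensity m.succ)
  /-- the tiers are independent of each other -/
  pos_indep : iIndepFun (fun m ω i => N.pos m i ω) μ
  /-- the fading powers are independent of each other -/
  fade_indep : iIndepFun (fun (k : Fin (M + 1) × ℕ) ω => N.fade k.1 k.2 ω) μ
  /-- the transmission indicators are independent of each other -/
  act_indep : iIndepFun (fun (k : Fin (M + 1) × ℕ) ω => N.act k.1 k.2 ω) μ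
  /-- positions, fading powers and transmission indicators are independent of each other -/
  fade_act_indep : IndepFun (fun ω m i => N.fade m i ω) (fun ω m i => N.act m i ω) μ
  pos_mark_indep : IndepFun (fun ω m i => N.pos m i ω)
    (fun ω => ((fun m i => N.fade m i ω), (fun m i => N.act m i ω))) μ

/-- Tier `0` is a homogeneous Poisson point process of intensity `λ` whose points are enumerated by
increasing distance to the user, so that the cluster consists of the `K` closest ones. -/
structure RandomCluster (N : Network M Ω) (p : NetParams K M) (μ : Measure Ω) : Prop where
  ppp : IsPPP μ (N.pos 0) (p.intensity 0)
  ordered : ∀ᵐ ω ∂μ, Monotone fun i => ‖N.pos 0 i ω‖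

/-- The in-cluster transmitters are at the given distances `d₁, …, d_K` from the user, and
the other nodes of tier `0` form a homogeneous Poisson point process of intensity `λ` outside the
disc of radius `r` around the user. -/
structure GivenCluster (N : Network M Ω) (p : NetParams K M) (μ : Measure Ω) (d : Fin K → ℝ)
    (r : ℝ) : Prop where
  dist : ∀ i : Fin K, ∀ᵐ ω ∂μ, ‖N.pos 0 i ω‖ = d i
  ppp : IsPPP μ (fun i => N.pos 0 (K + i)) ((p.intensity 0).restrict {x | r < ‖x‖})

/-- The power received from the `i`-th node of tier `m`. -/
def rxPower (N : Network M Ω) (p : NetParams K M) (m : Fin (M + 1)) (i : ℕ) (ω : Ω) : ℝ≥0∞ :=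
  if N.act m i ω then
    ENNReal.ofReal (p.txPower m) * ENNReal.ofReal ‖N.pos m i ω‖ ^ (-p.η) *
      ENNReal.ofReal (N.fade m i ω)
  else 0

/-- The useful power: the sum over the in-cluster transmitters. -/
def signal (N : Network M Ω) (p : NetParams K M) (ω : Ω) : ℝ≥0∞ :=
  ∑ i : Fin K, N.rxPower p 0 i ω

/-- The aggregate interference power: intrinsic (tier `0` outside the cluster) plus extrinsic. -/
def interference (N : Network M Ω) (p : NetParams K M) (ω : Ω) : ℝ≥0∞ :=
  (∑' i : ℕ, N.rxPower p 0 (K + i) ω) + ∑ m : Fin M, ∑' i : ℕ, N.rxPower p m.succ i ω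

/-- The signal-to-interference-plus-noise ratio at the user. -/
def sinr (N : Network M Ω) (p : NetParams K M) (ω : Ω) : ℝ≥0∞ :=
  N.signal p ω / (N.interference p ω + ENNReal.ofReal p.noise)

end Network

/-! ### The closed form -/

/-- `α_i(Ω) = (-1)^i` times the sum of all products of the elements of the multiset
`Ω = {x₁, …, x_K}` taken `K - i` at a time. -/
def alphaCoeff {K : ℕ} (x : Fin K → ℝ) (i : ℕ) : ℝ :=
  (-1) ^ i * ∑ s ∈ (Finset.univ : Finset (Fin K)).powersetCard (K - i), ∏ l ∈ s, x l

/-- The index of the farthest in-cluster transmitter. -/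
def lastIdx (K : ℕ) [NeZero K] : Fin K := ⟨K - 1, Nat.sub_lt (NeZero.pos K) one_pos⟩

namespace NetParams

variable {K M : ℕ} [NeZero K] (p : NetParams K M) (d : Fin K → ℝ) (θ : ℝ)

/-- `q_i = 1 - p_i` for the in-cluster transmitters. -/
def qIn (i : Fin K) : ℝ := 1 - p.pIn i

/-- The normalized distances `ω_i = d_i / d_K`, raised to the power `η`. -/
def omegaPow (i : Fin K) : ℝ := (d i / d (lastIdx K)) ^ p.η

/-- `G = ∏ q_i`. -/
def G : ℝ := ∏ i, p.qIn i

/-- The partial-fraction coefficient of index `j`. -/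
def coeff (j : Fin K) : ℝ :=
  (∑ i ∈ Finset.range K,
      (alphaCoeff (fun l => p.omegaPow d l / p.qIn l) i - alphaCoeff (p.omegaPow d) i) *
        p.omegaPow d j ^ i) /
    (p.omegaPow d j * ∏ l ∈ Finset.univ.erase j, (p.omegaPow d l - p.omegaPow d j))

/-- `D_j(M)`, the contribution of the extrinsic tiers. -/
def Dterm (j : Fin K) : ℝ :=
  ∏ m : Fin M, Real.exp (-Real.pi * p.pExt m * p.lam m.succ * d j ^ 2 *
    (θ * p.power m) ^ (2 / p.η) * Real.Gamma (1 + 2 / p.η) * Real.Gamma (1 - 2 / p.η))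

/-- `C_j(θ)`. -/
def Cterm (j : Fin K) : ℝ :=
  Real.exp (-(d j ^ p.η) * θ * p.noise) *
    Real.exp (-Real.pi * p.pOut * p.lam 0 * d (lastIdx K) ^ 2 *
      pathF (p.omegaPow d j * θ) p.η) *
    p.Dterm d θ j

/-- The closed-form expression for the CCDF of the SINR at `θ`. -/
def ccdf : ℝ := p.G * ∑ j : Fin K, p.coeff d j * p.Cterm d θ j

end NetParams

end

/-! Given the distances, put `x i = d i ^ η`. The useful power is then a sum of independent
variables, the `i`-th of which is exponential of rate `x i` with probability `p i` and zero
otherwise. Its Laplace transform `∏ (x i + q i s) / (x i + s)` has simple poles because the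
distances are distinct, so for `t ≥ 0` its tail is a combination `∑ a j exp (-x j t)` with
partial-fraction coefficients (`one_sub_mul_sum_tailCoeff`, `measureReal_lt_sum_eq_sum_tailCoeff`).
`G_mul_coeff` identifies the `a j` with the coefficients of the closed form.

The useful power depends on marks that are independent of the interference. Setting `t = θ (I + σ²)`
and averaging turns each exponential into the Laplace transform of `I + σ²` at `θ d j ^ η`. To
compute that of `I`, the marks of the interferers are integrated out first: every node then
contributes a factor depending on its position only, written as `negExp` of `markFun`. What is left
is the Laplace functional `exp (-∫ (1 - e^{-g}) dΛ)` of a Poisson process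
(`setLIntegral_negExp_tsum`), whose exponent is explicit: a product of Gamma values over the whole
plane and `pathF` outside a disc (`lintegral_markFun`, `lintegral_markFun_beyond`).

The two geometries differ only in the conditional law of the tier-`0` interferers given the cluster
distances, and the property `TierLaplace` isolates what is needed of it. For a given cluster it is
the Laplace functional itself. For the closest points of a Poisson process it is a strong Markov
property at the `K`-th point, `lintegral_mul_negExp_beyond`. There the squared distances are
discretized dyadically, so that the levels of the first `K` points become an event about counts in
finitely many annuli; these counts are independent of what lies farther out, and the mesh is then
sent to zero.

Almost all integrals are taken in `[0, ∞]`, which avoids integrability questions. Since the `a j`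
may be negative, identities carry the negative terms on the other side until
`condExp_indicator_lt_sinr`, which proves the conditional formula for both geometries. A given
cluster is the case where the conditioning variable is almost surely constant. -/

noncomputable section

open Filter Topology
open scoped NNReal

/-! ### The negative exponential on `[0, ∞]` -/

/-- `exp (-x)` for `x ∈ [0, ∞]`. -/
def negExp (x : ℝ≥0∞) : ℝ≥0∞ := EReal.exp (-(x : EReal))

lemma negExp_zero : negExp 0 = 1 := by simp [negExp]

lemma negExp_top : negExp ∞ = 0 := by simp [negExp]

lemma negExp_add (x y : ℝ≥0∞) : negExp (x + y) = negExp x * negExp y := by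
  rw [negExp, negExp, negExp, ← EReal.exp_add, EReal.coe_ennreal_add, EReal.neg_add]
  · rfl
  · exact Or.inl (by simp)
  · exact Or.inr (by simp)

lemma continuous_negExp : Continuous negExp :=
  ENNReal.continuous_exp.comp (continuous_neg.comp continuous_coe_ennreal_ereal)

lemma measurable_negExp : Measurable negExp := continuous_negExp.measurable

lemma negExp_antitone : Antitone negExp := fun x y h =>
  EReal.exp_monotone (EReal.neg_le_neg_iff.2 (by exact_mod_cast h))

lemma negExp_le_one (x : ℝ≥0∞) : negExp x ≤ 1 := by
  rw [← negExp_zero]; exact negExp_antitone zero_le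

lemma negExp_ne_top (x : ℝ≥0∞) : negExp x ≠ ∞ :=
  ((negExp_le_one x).trans_lt ENNReal.one_lt_top).ne

lemma negExp_ofReal {a : ℝ} (ha : 0 ≤ a) :
    negExp (ENNReal.ofReal a) = ENNReal.ofReal (Real.exp (-a)) := by
  rw [negExp, EReal.coe_ennreal_ofReal, max_eq_left ha, ← EReal.coe_neg, EReal.exp_coe]

lemma negExp_sum {ι : Type*} (s : Finset ι) (f : ι → ℝ≥0∞) :
    negExp (∑ i ∈ s, f i) = ∏ i ∈ s, negExp (f i) := by
  classical
  induction s using Finset.induction_on with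
  | empty => simp [negExp_zero]
  | insert a s ha ih => rw [Finset.sum_insert ha, Finset.prod_insert ha, negExp_add, ih]

lemma negExp_mul_nat (a : ℝ≥0∞) (n : ℕ) : negExp (a * n) = negExp a ^ n := by
  have := negExp_sum (Finset.range n) (fun _ => a)
  simpa [mul_comm] using this

/-- `-log y`, inverse to `negExp`. -/
def negLog (y : ℝ≥0∞) : ℝ≥0∞ := (-(ENNReal.log y)).toENNReal

lemma measurable_negLog : Measurable negLog :=
  measurable_ereal_toENNReal.comp
    ((continuous_neg.measurable).comp ENNReal.measurable_log)

/-- The bound is needed because `negLog` truncates `-log y` at zero. -/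
lemma negExp_negLog {y : ℝ≥0∞} (hy : y ≤ 1) : negExp (negLog y) = y := by
  have h : 0 ≤ -(ENNReal.log y) := by
    rw [EReal.le_neg, neg_zero]
    exact ENNReal.log_le_zero_iff.2 hy
  rw [negExp, negLog, EReal.coe_toENNReal h, neg_neg, ENNReal.exp_log]

lemma negLog_antitone : Antitone negLog := fun _ _ h =>
  EReal.toENNReal_le_toENNReal (EReal.neg_le_neg_iff.2 (ENNReal.log_monotone h))

lemma continuous_negLog : Continuous negLog :=
  EReal.continuous_toENNReal.comp (continuous_neg.comp ENNReal.continuous_log)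

/-! ### Counting points -/

lemma measurable_pointCount {Ω : Type*} [MeasurableSpace Ω] {X : ℕ → Ω → Plane}
    (hX : ∀ i, Measurable (X i)) {A : Set Plane} (hA : MeasurableSet A) :
    Measurable fun ω => pointCount (fun i => X i ω) A :=
  Measurable.tsum fun i => (measurable_one.indicator hA).comp (hX i)

namespace IsPPP

variable {Ω : Type*} [MeasurableSpace Ω] {μ : Measure Ω} [IsProbabilityMeasure μ]
  {X : ℕ → Ω → Plane} {Λ : Measure Plane}

/-- The definition prescribes only the masses at natural numbers, while a count takes values in `[0,
∞]`. The Poisson masses already sum to one, so nothing is left for other values: the Poisson law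
lies below the law of the count, and both are probability measures. -/
lemma map_pointCount (h : IsPPP μ X Λ) {A : Set Plane} (hA : MeasurableSet A) (hΛ : Λ A ≠ ∞) :
    μ.map (fun ω => pointCount (fun i => X i ω) A) =
      (poissonMeasure (Λ A).toNNReal).map (Nat.cast : ℕ → ℝ≥0∞) := by
  have hm := measurable_pointCount h.measurable hA
  have : IsProbabilityMeasure (μ.map (fun ω => pointCount (fun i => X i ω) A)) :=
    Measure.isProbabilityMeasure_map hm.aemeasurable
  have : IsProbabilityMeasure ((poissonMeasure (Λ A).toNNReal).map (Nat.cast : ℕ → ℝ≥0∞)) :=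
    Measure.isProbabilityMeasure_map .of_discrete
  symm
  apply Measure.eq_of_le_of_isProbabilityMeasure
  refine Measure.le_iff.2 fun S hS => ?_
  rw [Measure.map_apply .of_discrete hS, Measure.map_apply hm hS]
  have hU : (Nat.cast : ℕ → ℝ≥0∞) ⁻¹' S = ⋃ n : ((Nat.cast : ℕ → ℝ≥0∞) ⁻¹' S), {(n : ℕ)} := by
    ext n; simp
  rw [hU, measure_iUnion]
  · simp_rw [← h.poisson A hA hΛ]
    rw [← measure_iUnion]
    · apply measure_mono
      intro ω hω
      obtain ⟨n, hn⟩ := Set.mem_iUnion.1 hω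
      have : pointCount (fun i => X i ω) A = (n : ℕ) := hn
      change pointCount (fun i => X i ω) A ∈ S
      rw [this]; exact n.2
    · intro m n hmn
      refine Set.disjoint_left.2 fun ω h1 h2 => hmn ?_
      have h3 : ((m : ℕ) : ℝ≥0∞) = (n : ℕ) := by
        rw [← show pointCount (fun i => X i ω) A = (m : ℕ) from h1]; exact h2
      exact Subtype.ext (by exact_mod_cast h3)
    · intro n
      exact hm (measurableSet_singleton _)
  · intro m n hmn
    simpa using fun h => hmn (Subtype.ext h)
  · intro n; exact .of_discrete

/-- This is the Poisson generating function `E y ^ N = exp (-r (1 - y))` at `y = e^{-a}`. The value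
`a = ∞` is included, with `y = 0` and `0 ^ 0 = 1`. -/
lemma lintegral_negExp_mul_pointCount (h : IsPPP μ X Λ) {A : Set Plane} (hA : MeasurableSet A)
    (hΛ : Λ A ≠ ∞) (a : ℝ≥0∞) :
    ∫⁻ ω, negExp (a * pointCount (fun i => X i ω) A) ∂μ = negExp (Λ A * (1 - negExp a)) := by
  have hm := measurable_pointCount h.measurable hA
  have hF : Measurable fun x : ℝ≥0∞ => negExp (a * x) :=
    measurable_negExp.comp (measurable_const_mul a)
  rw [← lintegral_map (μ := μ) hF hm, h.map_pointCount hA hΛ, lintegral_map hF .of_discrete]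
  set r := (Λ A).toNNReal with hr
  obtain ⟨y, hy0, hy1, hy⟩ : ∃ y : ℝ, 0 ≤ y ∧ y ≤ 1 ∧ negExp a = ENNReal.ofReal y :=
    ⟨(negExp a).toReal, ENNReal.toReal_nonneg,
      ENNReal.toReal_le_of_le_ofReal zero_le_one (by simpa using negExp_le_one a),
      (ENNReal.ofReal_toReal (negExp_ne_top a)).symm⟩
  rw [lintegral_countable']
  have hterm : ∀ n : ℕ, negExp (a * n) * poissonMeasure r {n} =
      ENNReal.ofReal (Real.exp (-r) * ((r * y) ^ n / n.factorial)) := by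
    intro n
    rw [negExp_mul_nat, hy, poissonMeasure_singleton, ← ENNReal.ofReal_pow hy0,
      ← ENNReal.ofReal_mul (by positivity)]
    congr 1
    rw [mul_pow]; ring
  simp_rw [hterm]
  have hs := (NormedSpace.expSeries_div_hasSum_exp ((r : ℝ) * y)).mul_left (Real.exp (-r))
  rw [← ENNReal.ofReal_tsum_of_nonneg (fun n => by positivity) hs.summable, hs.tsum_eq,
    ← Real.exp_eq_exp_ℝ, ← Real.exp_add]
  have : Λ A * (1 - negExp a) = ENNReal.ofReal (r * (1 - y)) := by
    rw [ENNReal.ofReal_mul r.coe_nonneg, ENNReal.ofReal_sub _ hy0, hy, ENNReal.ofReal_one]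
    congr 1
    simp [hr, ENNReal.coe_toNNReal hΛ]
  rw [this, negExp_ofReal (mul_nonneg r.coe_nonneg (by linarith))]
  congr 2; ring

end IsPPP

/-! ### The Laplace functional of a Poisson point process -/

/-- The value zero is left out of the sum because its fibre may have infinite measure, where nothing
is known about the count. -/
lemma MeasureTheory.SimpleFunc.apply_eq_sum_range_ne_zero {α : Type*} [MeasurableSpace α]
    (φ : SimpleFunc α ℝ≥0∞) {F : ℝ≥0∞ → ℝ≥0∞} (hF : F 0 = 0) (x : α) :
    F (φ x) = ∑ y ∈ φ.range.filter (· ≠ 0), F y * (φ ⁻¹' {y}).indicator 1 x := by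
  classical
  by_cases h : φ x = 0
  · rw [h, hF, Finset.sum_eq_zero]
    intro y hy
    have : x ∉ φ ⁻¹' {y} := fun hx => (Finset.mem_filter.1 hy).2 ((show φ x = y from hx).symm.trans h)
    simp [this]
  · rw [Finset.sum_eq_single (φ x)]
    · simp
    · intro y _ hy
      have : x ∉ φ ⁻¹' {y} := fun hx => hy (by rw [Set.mem_preimage, Set.mem_singleton_iff] at hx; exact hx.symm)
      simp [this]
    · intro hn
      exact absurd (Finset.mem_filter.2 ⟨SimpleFunc.mem_range_self φ x, h⟩) hn

/-- A series is an integral against counting measure, so monotone convergence applies inside the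
continuous `negExp`. -/
lemma tendsto_negExp_tsum {f : ℕ → ℕ → ℝ≥0∞} {F : ℕ → ℝ≥0∞} (hmono : ∀ i, Monotone fun n => f n i)
    (htend : ∀ i, Tendsto (fun n => f n i) atTop (𝓝 (F i))) :
    Tendsto (fun n => negExp (∑' i, f n i)) atTop (𝓝 (negExp (∑' i, F i))) := by
  refine (continuous_negExp.tendsto _).comp ?_
  have := lintegral_tendsto_of_tendsto_of_monotone (μ := Measure.count)
    (f := f) (F := F) (fun n => .of_discrete)
    (Eventually.of_forall hmono) (Eventually.of_forall htend)
  simpa [lintegral_count] using this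

lemma tendsto_negExp_lintegral {α : Type*} [MeasurableSpace α] {Λ : Measure α}
    {f : ℕ → α → ℝ≥0∞} {F : α → ℝ≥0∞} (hf : ∀ n, Measurable (f n))
    (hmono : ∀ x, Monotone fun n => f n x)
    (htend : ∀ x, Tendsto (fun n => f n x) atTop (𝓝 (F x))) :
    Tendsto (fun n => negExp (∫⁻ x, (1 - negExp (f n x)) ∂Λ)) atTop
      (𝓝 (negExp (∫⁻ x, (1 - negExp (F x)) ∂Λ))) := by
  refine (continuous_negExp.tendsto _).comp ?_
  refine lintegral_tendsto_of_tendsto_of_monotone (fun n => ?_) ?_ ?_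
  · exact ((measurable_negExp.comp (hf n)).const_sub _).aemeasurable
  · exact Eventually.of_forall fun x m n hmn =>
      tsub_le_tsub_left (negExp_antitone (hmono x hmn)) _
  · exact Eventually.of_forall fun x => ENNReal.Tendsto.sub tendsto_const_nhds
      ((continuous_negExp.tendsto _).comp (htend x)) (Or.inl ENNReal.one_ne_top)

namespace IsPPP

variable {Ω : Type*} [MeasurableSpace Ω] {μ : Measure Ω}
  {X : ℕ → Ω → Plane} {Λ : Measure Plane}

lemma iIndepFun_pointCount (h : IsPPP μ X Λ) {ι : Type*} [Fintype ι] {A : ι → Set Plane}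
    (hA : ∀ k, MeasurableSet (A k)) (hd : Pairwise fun k l => Disjoint (A k) (A l)) :
    iIndepFun (fun k ω => pointCount (fun i => X i ω) (A k)) μ := by
  let e := Fintype.equivFin ι
  have := (h.indep _ (fun k => A (e.symm k)) (fun k => hA _)
    (fun k l hkl => hd (fun hh => hkl (e.symm.injective hh)))).precomp e.injective
  simpa using this

lemma lintegral_negExp_sum_pointCount [IsProbabilityMeasure μ] (h : IsPPP μ X Λ) {ι : Type*} [Fintype ι]
    {C : ι → Set Plane} (hC : ∀ k, MeasurableSet (C k))
    (hd : Pairwise fun k l => Disjoint (C k) (C l)) (hΛ : ∀ k, Λ (C k) ≠ ∞) (a : ι → ℝ≥0∞) :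
    ∫⁻ ω, negExp (∑ k, a k * pointCount (fun i => X i ω) (C k)) ∂μ =
      negExp (∑ k, Λ (C k) * (1 - negExp (a k))) := by
  simp_rw [negExp_sum]
  have hind : iIndepFun (fun k ω => negExp (a k * pointCount (fun i => X i ω) (C k))) μ :=
    (h.iIndepFun_pointCount hC hd).comp (fun k x => negExp (a k * x))
      (fun k => measurable_negExp.comp (measurable_const_mul _))
  have := lintegral_prod_eq_prod_lintegral_of_indepFun Finset.univ
    (fun k ω => negExp (a k * pointCount (fun i => X i ω) (C k))) hind
    (fun k => measurable_negExp.comp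
      ((measurable_const_mul _).comp (measurable_pointCount h.measurable (hC k))))
  rw [this]
  exact Finset.prod_congr rfl fun k _ => h.lintegral_negExp_mul_pointCount (hC k) (hΛ k) (a k)

/-- Both families together form one disjoint family indexed by `ι ⊕ κ`; mutual independence of its
counts lets the two blocks be separated. -/
lemma indepFun_pointCount (h : IsPPP μ X Λ) {ι κ : Type*} [Fintype ι] [Fintype κ]
    {C : ι → Set Plane} {A : κ → Set Plane} (hC : ∀ k, MeasurableSet (C k))
    (hA : ∀ k, MeasurableSet (A k)) (hdC : Pairwise fun k l => Disjoint (C k) (C l))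
    (hdA : Pairwise fun k l => Disjoint (A k) (A l)) (hCA : ∀ k l, Disjoint (C k) (A l)) :
    IndepFun (fun ω k => pointCount (fun i => X i ω) (C k))
      (fun ω k => pointCount (fun i => X i ω) (A k)) μ := by
  classical
  have hm : ∀ k, MeasurableSet (Sum.elim C A k) := by rintro (k | k) <;> simp [hC, hA]
  have hi := h.iIndepFun_pointCount (A := Sum.elim C A) hm (by
    rintro (k | k) (l | l) hkl
    · exact hdC (fun e => hkl (by rw [e]))
    · exact hCA k l
    · exact (hCA l k).symm
    · exact hdA (fun e => hkl (by rw [e])))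
  have := hi.indepFun_finset (Finset.univ.map Function.Embedding.inl)
    (Finset.univ.map Function.Embedding.inr) (by
      rw [Finset.disjoint_left]; simp)
    (fun k => measurable_pointCount h.measurable (hm k))
  exact this.comp
    (φ := fun f k => f ⟨Sum.inl k, by simp⟩) (ψ := fun f k => f ⟨Sum.inr k, by simp⟩)
    (measurable_pi_lambda _ fun _ => measurable_pi_apply _)
    (measurable_pi_lambda _ fun _ => measurable_pi_apply _)

/-- For a simple function the sum over the points is a finite combination of counts in the nonzero
fibres. These fibres are disjoint from the sets `A k`, so the event factors out, and each count
contributes its generating function. -/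
lemma setLIntegral_negExp_simpleFunc [IsProbabilityMeasure μ] (h : IsPPP μ X Λ) {κ : Type*} [Fintype κ]
    {A : κ → Set Plane} (hA : ∀ k, MeasurableSet (A k))
    (hdA : Pairwise fun k l => Disjoint (A k) (A l)) {T : Set (κ → ℝ≥0∞)} (hT : MeasurableSet T)
    (φ : SimpleFunc Plane ℝ≥0∞) (hφA : ∀ k, ∀ x ∈ A k, φ x = 0)
    (hΛ : ∀ y ≠ 0, Λ (φ ⁻¹' {y}) ≠ ∞) :
    ∫⁻ ω in {ω | (fun k => pointCount (fun i => X i ω) (A k)) ∈ T},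
        negExp (∑' i, φ (X i ω)) ∂μ =
      μ {ω | (fun k => pointCount (fun i => X i ω) (A k)) ∈ T} *
        negExp (∫⁻ x, (1 - negExp (φ x)) ∂Λ) := by
  classical
  set R := φ.range.filter (· ≠ 0)
  have hC : ∀ y : R, MeasurableSet (φ ⁻¹' {(y : ℝ≥0∞)}) := fun y => φ.measurableSet_fiber _
  have hdC : Pairwise fun k l : R => Disjoint (φ ⁻¹' {(k : ℝ≥0∞)}) (φ ⁻¹' {(l : ℝ≥0∞)}) := by
    intro k l hkl
    refine Set.disjoint_left.2 fun x h1 h2 => hkl (Subtype.ext ?_)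
    exact h1.symm.trans h2
  have hCA : ∀ (k : R) l, Disjoint (φ ⁻¹' {(k : ℝ≥0∞)}) (A l) := by
    intro k l
    refine Set.disjoint_left.2 fun x h1 h2 => (Finset.mem_filter.1 k.2).2 ?_
    rw [← hφA l x h2]; exact h1.symm
  have hsum : ∀ ω, ∑' i, φ (X i ω) =
      ∑ y : R, (y : ℝ≥0∞) * pointCount (fun i => X i ω) (φ ⁻¹' {(y : ℝ≥0∞)}) := by
    intro ω
    rw [tsum_congr fun i => φ.apply_eq_sum_range_ne_zero (F := fun y => y) rfl (X i ω), Summable.tsum_finsetSum (fun _ _ => ENNReal.summable), ← Finset.sum_coe_sort]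
    simp_rw [ENNReal.tsum_mul_left]
    rfl
  have hint : ∫⁻ x, (1 - negExp (φ x)) ∂Λ =
      ∑ y : R, Λ (φ ⁻¹' {(y : ℝ≥0∞)}) * (1 - negExp y) := by
    simp_rw [φ.apply_eq_sum_range_ne_zero (F := fun y => 1 - negExp y) (by simp [negExp_zero])]
    rw [lintegral_finsetSum _ (fun y _ => (measurable_one.indicator
      (φ.measurableSet_fiber _)).const_mul _), ← Finset.sum_coe_sort]
    refine Finset.sum_congr rfl fun y _ => ?_
    rw [lintegral_const_mul _ (measurable_one.indicator (φ.measurableSet_fiber _)),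
      lintegral_indicator_one (φ.measurableSet_fiber _), mul_comm]
  have hvec : Measurable fun ω k => pointCount (fun i => X i ω) (A k) :=
    measurable_pi_lambda _ fun k => measurable_pointCount h.measurable (hA k)
  have hE : MeasurableSet {ω | (fun k => pointCount (fun i => X i ω) (A k)) ∈ T} := hvec hT
  have hF : Measurable fun v : R → ℝ≥0∞ => negExp (∑ y : R, (y : ℝ≥0∞) * v y) :=
    measurable_negExp.comp (Finset.measurable_sum _ fun y _ =>
      (measurable_pi_apply y).const_mul _)
  have hG : Measurable (T.indicator (1 : (κ → ℝ≥0∞) → ℝ≥0∞)) := measurable_one.indicator hT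
  have hind := (h.indepFun_pointCount hC hA hdC hdA hCA).symm.comp hG hF
  rw [← lintegral_indicator hE, hint, ← h.lintegral_negExp_sum_pointCount hC hdC
    (fun k => hΛ k (Finset.mem_filter.1 k.2).2), ← lintegral_indicator_one hE]
  have key := lintegral_mul_eq_lintegral_mul_lintegral_of_indepFun (hG.comp hvec) (hF.comp
    (measurable_pi_lambda _ fun k => measurable_pointCount h.measurable (hC k))) hind
  refine Eq.trans ?_ (key.trans ?_)
  · refine lintegral_congr fun ω => ?_
    simp only [hsum]
    by_cases hω : (fun k => pointCount (fun i => X i ω) (A k)) ∈ T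
    · rw [Set.indicator_of_mem (by exact hω)]
      simp [hω]
    · rw [Set.indicator_of_notMem (by exact hω)]
      simp [hω]
  · rfl

/-- The Laplace functional of a Poisson point process, restricted to an event which depends only
on the numbers of points in sets where the functional vanishes. -/
theorem setLIntegral_negExp_tsum [IsProbabilityMeasure μ] (h : IsPPP μ X Λ) (hb : ∀ n : ℕ, Λ (Metric.ball 0 n) ≠ ∞)
    {κ : Type*} [Fintype κ] {A : κ → Set Plane} (hA : ∀ k, MeasurableSet (A k))
    (hdA : Pairwise fun k l => Disjoint (A k) (A l)) {T : Set (κ → ℝ≥0∞)} (hT : MeasurableSet T)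
    {g : Plane → ℝ≥0∞} (hg : Measurable g) (hgA : ∀ k, ∀ x ∈ A k, g x = 0) :
    ∫⁻ ω in {ω | (fun k => pointCount (fun i => X i ω) (A k)) ∈ T},
        negExp (∑' i, g (X i ω)) ∂μ =
      μ {ω | (fun k => pointCount (fun i => X i ω) (A k)) ∈ T} *
        negExp (∫⁻ x, (1 - negExp (g x)) ∂Λ) := by
  classical
  -- Cutting off at the ball of radius `n` makes the nonzero fibres have finite measure while
  -- keeping the approximation increasing.
  set φ : ℕ → SimpleFunc Plane ℝ≥0∞ := fun n =>
    (SimpleFunc.eapprox g n).restrict (Metric.ball 0 n) with hφ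
  have hval : ∀ n x, φ n x = (Metric.ball 0 (n : ℝ)).indicator (SimpleFunc.eapprox g n) x :=
    fun n x => SimpleFunc.restrict_apply _ Metric.isOpen_ball.measurableSet x
  have hmono : ∀ x, Monotone fun n => φ n x := by
    intro x m n hmn
    simp only [hval]
    refine Set.indicator_le_indicator_of_subset
      (Metric.ball_subset_ball (Nat.cast_le.2 hmn)) (fun _ => zero_le) x |>.trans ?_
    exact Set.indicator_le_indicator (SimpleFunc.monotone_eapprox g hmn x)
  have htend : ∀ x, Tendsto (fun n => φ n x) atTop (𝓝 (g x)) := by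
    intro x
    refine (SimpleFunc.tendsto_eapprox hg x).congr' ?_
    obtain ⟨N, hN⟩ := exists_nat_gt ‖x‖
    filter_upwards [eventually_ge_atTop N] with n hn
    rw [hval, Set.indicator_of_mem]
    simpa using hN.trans_le (by exact_mod_cast hn)
  have hle : ∀ n x, φ n x ≤ g x := fun n x => (hmono x).ge_of_tendsto (htend x) n
  have hn : ∀ n, _ := fun n => h.setLIntegral_negExp_simpleFunc hA hdA hT (φ n)
    (fun k x hx => le_antisymm ((hle n x).trans (hgA k x hx).le) zero_le) (by
      intro y hy
      refine ne_top_of_le_ne_top (hb n) (measure_mono fun x hx => ?_)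
      by_contra hx'
      apply hy
      rw [← show φ n x = y from hx, hval, Set.indicator_of_notMem hx'])
  refine tendsto_nhds_unique (f := fun n => ∫⁻ ω in {ω | (fun k => pointCount (fun i => X i ω)
    (A k)) ∈ T}, negExp (∑' i, φ n (X i ω)) ∂μ) (l := atTop) ?_ ?_
  · refine tendsto_lintegral_of_dominated_convergence 1 (fun n => ?_) (fun n => ?_) (by simp) ?_
    · exact measurable_negExp.comp (Measurable.tsum fun i =>
        (φ n).measurable.comp (h.measurable i))
    · exact Eventually.of_forall fun ω => negExp_le_one _
    · exact Eventually.of_forall fun ω => tendsto_negExp_tsum (fun i => hmono _) (fun i => htend _)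
  · simp_rw [hn]
    exact ENNReal.Tendsto.const_mul (tendsto_negExp_lintegral (fun n => (φ n).measurable) hmono
      htend) (Or.inr (measure_ne_top _ _))

theorem lintegral_negExp_tsum [IsProbabilityMeasure μ] (h : IsPPP μ X Λ) (hb : ∀ n : ℕ, Λ (Metric.ball 0 n) ≠ ∞)
    {g : Plane → ℝ≥0∞} (hg : Measurable g) :
    ∫⁻ ω, negExp (∑' i, g (X i ω)) ∂μ = negExp (∫⁻ x, (1 - negExp (g x)) ∂Λ) := by
  have := h.setLIntegral_negExp_tsum hb (κ := Fin 0) (A := Fin.elim0) (fun k => k.elim0)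
    (fun k => k.elim0) MeasurableSet.univ hg (fun k => k.elim0)
  simpa using this

end IsPPP

/-! ### Squared distances in the plane -/

lemma measurable_normSq : Measurable fun x : Plane => ‖x‖ ^ 2 := by fun_prop

lemma volume_closedBall_sqrt {b : ℝ} (hb : 0 ≤ b) :
    volume (Metric.closedBall (0 : Plane) (Real.sqrt b)) = ENNReal.ofReal Real.pi * ENNReal.ofReal b := by
  rw [EuclideanSpace.volume_closedBall_fin_two, ← ENNReal.ofReal_pow (Real.sqrt_nonneg _),
    Real.sq_sqrt hb, mul_comm]

/-- The disc `‖x‖² ≤ b` has area `π b`, linear in `b`. The squared distance is therefore spread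
uniformly with density `π`, which is checked on half-open intervals. -/
lemma map_normSq_volume : (volume : Measure Plane).map (fun x => ‖x‖ ^ 2) =
    ENNReal.ofReal Real.pi • (volume : Measure ℝ).restrict (Set.Ioi 0) := by
  symm
  have : IsLocallyFiniteMeasure
      (ENNReal.ofReal Real.pi • (volume : Measure ℝ).restrict (Set.Ioi 0)) :=
    ⟨fun x => ⟨Metric.ball x 1, Metric.ball_mem_nhds x one_pos, by
      rw [Measure.smul_apply, smul_eq_mul]
      exact ENNReal.mul_lt_top ENNReal.ofReal_lt_top
        ((Measure.restrict_apply_le _ _).trans_lt measure_ball_lt_top)⟩⟩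
  refine Measure.ext_of_Ioc _ _ fun a b hab => ?_
  rw [Measure.map_apply measurable_normSq measurableSet_Ioc, Measure.smul_apply,
    Measure.restrict_apply measurableSet_Ioc, smul_eq_mul]
  rcases lt_or_ge b 0 with hb | hb
  · have h1 : Set.Ioc a b ∩ Set.Ioi 0 = ∅ := by
      ext x; simp only [Set.mem_inter_iff, Set.mem_Ioc, Set.mem_Ioi, Set.mem_empty_iff_false]
      rw [iff_false]; intro h; linarith [h.1.2, h.2]
    have h2 : (fun x : Plane => ‖x‖ ^ 2) ⁻¹' Set.Ioc a b = ∅ := by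
      ext x; simp only [Set.mem_preimage, Set.mem_Ioc, Set.mem_empty_iff_false, iff_false]
      intro h; linarith [h.2, sq_nonneg ‖x‖]
    rw [h1, h2]; simp
  · have hmem : ∀ c : ℝ, 0 ≤ c → ∀ x : Plane,
        x ∈ Metric.closedBall (0 : Plane) (Real.sqrt c) ↔ ‖x‖ ^ 2 ≤ c := by
      intro c hc x
      rw [mem_closedBall_zero_iff, Real.le_sqrt (norm_nonneg _) hc]
    rcases lt_or_ge a 0 with ha | ha
    · have h1 : Set.Ioc a b ∩ Set.Ioi 0 = Set.Ioc 0 b := by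
        ext x; simp only [Set.mem_inter_iff, Set.mem_Ioc, Set.mem_Ioi]
        constructor
        · exact fun h => ⟨h.2, h.1.2⟩
        · exact fun h => ⟨⟨ha.trans h.1, h.2⟩, h.1⟩
      have h2 : (fun x : Plane => ‖x‖ ^ 2) ⁻¹' Set.Ioc a b = Metric.closedBall 0 (Real.sqrt b) := by
        ext x
        rw [hmem b hb, Set.mem_preimage, Set.mem_Ioc]
        exact ⟨fun h => h.2, fun h => ⟨ha.trans_le (sq_nonneg _), h⟩⟩
      rw [h1, h2, volume_closedBall_sqrt hb, Real.volume_Ioc, sub_zero]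
    · have h1 : Set.Ioc a b ∩ Set.Ioi 0 = Set.Ioc a b :=
        Set.inter_eq_left.2 fun x hx => ha.trans_lt hx.1
      have h2 : (fun x : Plane => ‖x‖ ^ 2) ⁻¹' Set.Ioc a b =
          Metric.closedBall 0 (Real.sqrt b) \ Metric.closedBall 0 (Real.sqrt a) := by
        ext x
        rw [Set.mem_sdiff, hmem b hb, hmem a ha, Set.mem_preimage, Set.mem_Ioc, not_le, and_comm]
      rw [h1, h2, measure_sdiff (Metric.closedBall_subset_closedBall (Real.sqrt_le_sqrt hab.le))
        Metric.isClosed_closedBall.measurableSet.nullMeasurableSet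
        measure_closedBall_lt_top.ne, volume_closedBall_sqrt hb, volume_closedBall_sqrt ha,
        Real.volume_Ioc, ENNReal.ofReal_sub _ ha, ENNReal.mul_sub]
      intro _ _; exact ENNReal.ofReal_ne_top

lemma lintegral_normSq {F : ℝ → ℝ≥0∞} (hF : Measurable F) :
    ∫⁻ x : Plane, F (‖x‖ ^ 2) = ENNReal.ofReal Real.pi * ∫⁻ u in Set.Ioi (0 : ℝ), F u := by
  rw [← lintegral_map hF measurable_normSq, map_normSq_volume, lintegral_smul_measure, smul_eq_mul]

/-! ### Dyadic discretization of the squared distance -/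

/-- The squared norm in units of `2⁻ⁿ`, rounded up. -/
def sqLevel (n : ℕ) (x : Plane) : ℕ := ⌈2 ^ n * ‖x‖ ^ 2⌉₊

lemma measurable_sqLevel (n : ℕ) : Measurable (sqLevel n) :=
  Nat.measurable_ceil.comp (measurable_normSq.const_mul _)

lemma sqLevel_mono {n : ℕ} {x y : Plane} (h : ‖x‖ ≤ ‖y‖) : sqLevel n x ≤ sqLevel n y :=
  Nat.ceil_mono (by gcongr)

/-- In terms of the squared norm a level set lies in an interval of length `2⁻ⁿ`, so the bound on
its area is the same for every `k`. -/
lemma volume_sqLevel_fiber_le (n k : ℕ) :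
    volume (sqLevel n ⁻¹' {k}) ≤ ENNReal.ofReal Real.pi * ENNReal.ofReal (1 / 2 ^ n) := by
  have hsub : sqLevel n ⁻¹' {k} ⊆
      (fun x : Plane => ‖x‖ ^ 2) ⁻¹' Set.Ioc (((k : ℝ) - 1) / 2 ^ n) (k / 2 ^ n) := by
    intro x hx
    have hx : ⌈2 ^ n * ‖x‖ ^ 2⌉₊ = k := hx
    have h0 : (0 : ℝ) ≤ 2 ^ n * ‖x‖ ^ 2 := by positivity
    have h1 := Nat.le_ceil (2 ^ n * ‖x‖ ^ 2)
    have h2 := Nat.ceil_lt_add_one h0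
    rw [hx] at h1 h2
    simp only [Set.mem_preimage, Set.mem_Ioc]
    rw [div_lt_iff₀ (by positivity), le_div_iff₀ (by positivity)]
    constructor <;> linarith
  refine (measure_mono hsub).trans ?_
  rw [← Measure.map_apply measurable_normSq measurableSet_Ioc, map_normSq_volume,
    Measure.smul_apply, smul_eq_mul]
  gcongr
  refine (Measure.restrict_apply_le _ _).trans ?_
  rw [Real.volume_Ioc]
  apply le_of_eq
  congr 1; ring

namespace IsPPP

variable {Ω : Type*} [MeasurableSpace Ω] {μ : Measure Ω}
  {X : ℕ → Ω → Plane} {Λ : Measure Plane}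

/-- `1 - e^{-r} (1 + r) ≤ r²`, by `e^{-r} ≥ 1 - r`. The quadratic order is what excludes ties
between distances. -/
lemma measure_two_le_pointCount (h : IsPPP μ X Λ) [IsProbabilityMeasure μ] {A : Set Plane}
    (hA : MeasurableSet A) (hΛ : Λ A ≠ ∞) :
    μ {ω | 2 ≤ pointCount (fun i => X i ω) A} ≤ Λ A ^ 2 := by
  have hm := measurable_pointCount h.measurable hA
  set r := (Λ A).toNNReal with hr
  have hpre : {ω | 2 ≤ pointCount (fun i => X i ω) A} =
      (fun ω => pointCount (fun i => X i ω) A) ⁻¹' Set.Ici 2 := rfl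
  rw [hpre, ← Measure.map_apply hm measurableSet_Ici, h.map_pointCount hA hΛ,
    Measure.map_apply .of_discrete measurableSet_Ici]
  have hc : (Nat.cast : ℕ → ℝ≥0∞) ⁻¹' Set.Ici 2 = (({0, 1} : Finset ℕ) : Set ℕ)ᶜ := by
    ext n
    simp only [Set.mem_preimage, Set.mem_Ici, Set.mem_compl_iff, Finset.coe_insert,
      Finset.coe_singleton, Set.mem_insert_iff, Set.mem_singleton_iff]
    rw [show (2 : ℝ≥0∞) = ((2 : ℕ) : ℝ≥0∞) by simp, Nat.cast_le]; omega
  have h01 : poissonMeasure r (({0, 1} : Finset ℕ) : Set ℕ) =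
      ENNReal.ofReal (Real.exp (-r) * (1 + r)) := by
    rw [← sum_measure_singleton]
    simp only [Finset.sum_pair zero_ne_one, poissonMeasure_singleton]
    rw [← ENNReal.ofReal_add (by positivity) (by positivity)]
    congr 1; simp; ring
  rw [hc, measure_compl (by measurability) (measure_ne_top _ _), measure_univ, h01,
    ← ENNReal.coe_toNNReal hΛ, ← hr, ← ENNReal.ofReal_one, ← ENNReal.ofReal_sub _ (by positivity),
    ← ENNReal.ofReal_coe_nnreal, ← ENNReal.ofReal_pow r.coe_nonneg]
  apply ENNReal.ofReal_le_ofReal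
  have h1 := Real.add_one_le_exp (-(r : ℝ))
  nlinarith [r.coe_nonneg, mul_le_mul_of_nonneg_right h1 (add_nonneg zero_le_one r.coe_nonneg)]

lemma ae_ne_zero (h : IsPPP μ X Λ) (h0 : Λ {0} = 0) [IsProbabilityMeasure μ] :
    ∀ᵐ ω ∂μ, ∀ i, X i ω ≠ 0 := by
  have hp := h.poisson {0} (measurableSet_singleton _) (by simp [h0]) 0
  rw [poissonMeasure_singleton] at hp
  simp only [h0, Nat.cast_zero, ENNReal.toNNReal_zero] at hp
  simp only [NNReal.coe_zero, neg_zero, Real.exp_zero, pow_zero, Nat.factorial_zero, Nat.cast_one,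
    mul_one, div_one, ENNReal.ofReal_one] at hp
  have hm := measurable_pointCount h.measurable (measurableSet_singleton (0 : Plane))
  have : ∀ᵐ ω ∂μ, pointCount (fun i => X i ω) {0} = 0 :=
    (prob_compl_eq_zero_iff (hm (measurableSet_singleton 0))).2 hp
  filter_upwards [this] with ω hω i hi
  have := ENNReal.tsum_eq_zero.1 hω i
  simp [hi] at this

/-- Almost surely, no two points are at the same distance from the origin. -/
lemma ae_injective_norm (h : IsPPP μ X Λ) [IsProbabilityMeasure μ] {c : ℝ≥0∞} (hc : c ≠ ∞)
    (hΛ : ∀ n k, Λ (sqLevel n ⁻¹' {k}) ≤ c * ENNReal.ofReal (1 / 2 ^ n)) :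
    ∀ᵐ ω ∂μ, Function.Injective fun i => ‖X i ω‖ := by
  -- Two points at equal distance share a level at every mesh. Up to squared distance `L` there are
  -- about `2 ^ n L` levels, each containing two points with probability at most `(c 2⁻ⁿ)²`, so the
  -- total is of order `2⁻ⁿ`.
  have hN : ∀ L : ℕ, μ {ω | ∃ i j, i ≠ j ∧ ‖X i ω‖ = ‖X j ω‖ ∧ ‖X i ω‖ ^ 2 ≤ L} = 0 := by
    intro L
    have hbound : ∀ n : ℕ, μ {ω | ∃ i j, i ≠ j ∧ ‖X i ω‖ = ‖X j ω‖ ∧ ‖X i ω‖ ^ 2 ≤ L} ≤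
        c ^ 2 * ((L + 1 : ℕ) : ℝ≥0∞) * ENNReal.ofReal ((1 / 2) ^ n) := by
      intro n
      have hsub : {ω | ∃ i j, i ≠ j ∧ ‖X i ω‖ = ‖X j ω‖ ∧ ‖X i ω‖ ^ 2 ≤ L} ⊆
          ⋃ k ∈ Finset.range (2 ^ n * L + 1),
            {ω | 2 ≤ pointCount (fun i => X i ω) (sqLevel n ⁻¹' {k})} := by
        rintro ω ⟨i, j, hij, he, hL⟩
        simp only [Set.mem_iUnion, Finset.mem_range]
        refine ⟨sqLevel n (X i ω), ?_, ?_⟩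
        · refine Nat.lt_succ_of_le (Nat.ceil_le.2 ?_)
          push_cast
          gcongr
        · have := ENNReal.sum_le_tsum (f := fun l =>
            (sqLevel n ⁻¹' {sqLevel n (X i ω)}).indicator (1 : Plane → ℝ≥0∞) (X l ω)) {i, j}
          rw [Finset.sum_pair hij] at this
          have h1 : X i ω ∈ sqLevel n ⁻¹' {sqLevel n (X i ω)} := rfl
          have h2 : X j ω ∈ sqLevel n ⁻¹' {sqLevel n (X i ω)} := by
            simp [sqLevel, he]
          rw [Set.indicator_of_mem h1, Set.indicator_of_mem h2] at this
          simpa [one_add_one_eq_two, pointCount] using this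
      refine (measure_mono hsub).trans ((measure_biUnion_finset_le _ _).trans ?_)
      have hk : ∀ k, μ {ω | 2 ≤ pointCount (fun i => X i ω) (sqLevel n ⁻¹' {k})} ≤
          (c * ENNReal.ofReal (1 / 2 ^ n)) ^ 2 := fun k =>
        (h.measure_two_le_pointCount (measurable_sqLevel n (measurableSet_singleton k))
          (ne_top_of_le_ne_top (ENNReal.mul_ne_top hc ENNReal.ofReal_ne_top) (hΛ n k))).trans
          (pow_le_pow_left' (hΛ n k) 2)
      refine (Finset.sum_le_sum fun k _ => hk k).trans ?_
      rw [Finset.sum_const, Finset.card_range, nsmul_eq_mul, mul_pow, mul_left_comm, mul_assoc]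
      gcongr c ^ 2 * ?_
      rw [← ENNReal.ofReal_natCast, ← ENNReal.ofReal_natCast, ← ENNReal.ofReal_pow (by positivity),
        ← ENNReal.ofReal_mul (by positivity), ← ENNReal.ofReal_mul (by positivity)]
      apply ENNReal.ofReal_le_ofReal
      have h2 : (1 : ℝ) ≤ 2 ^ n := one_le_pow₀ (by norm_num)
      have h3 : ((2 ^ n * L + 1 : ℕ) : ℝ) ≤ 2 ^ n * (L + 1 : ℕ) := by push_cast; linarith
      calc ((2 ^ n * L + 1 : ℕ) : ℝ) * (1 / 2 ^ n) ^ 2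
          ≤ (2 ^ n * (L + 1 : ℕ)) * (1 / 2 ^ n) ^ 2 := by gcongr
        _ = _ := by field_simp; rw [← mul_pow]; norm_num
    refine le_antisymm (ge_of_tendsto' (x := atTop) ?_ hbound) zero_le
    have : Tendsto (fun n : ℕ => ENNReal.ofReal ((1 / 2 : ℝ) ^ n)) atTop (𝓝 0) := by
      rw [← ENNReal.ofReal_zero]
      exact ENNReal.tendsto_ofReal
        (tendsto_pow_atTop_nhds_zero_of_lt_one (by norm_num) (by norm_num))
    simpa using ENNReal.Tendsto.const_mul (a := c ^ 2 * ((L + 1 : ℕ) : ℝ≥0∞)) this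
      (Or.inr (ENNReal.mul_ne_top (ENNReal.pow_ne_top hc) (ENNReal.natCast_ne_top _)))
  have hall := ae_all_iff.2 fun L => (measure_eq_zero_iff_ae_notMem.1 (hN L))
  filter_upwards [hall] with ω hω i j hij
  by_contra hne
  obtain ⟨L, hL⟩ := exists_nat_ge (‖X i ω‖ ^ 2)
  exact hω L ⟨i, j, hne, hij, hL⟩

end IsPPP

/-! ### Dyadic approximation of nonnegative reals -/

/-- A dyadic approximation of `a` from below. -/
def dyadicBelow (n : ℕ) (a : ℝ) : ℝ := ((⌈2 ^ n * a⌉₊ - 1 : ℕ) : ℝ) / 2 ^ n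

lemma dyadicBelow_nonneg (n : ℕ) (a : ℝ) : 0 ≤ dyadicBelow n a := by
  unfold dyadicBelow; positivity

lemma dyadicBelow_le {a : ℝ} (ha : 0 ≤ a) (n : ℕ) : dyadicBelow n a ≤ a := by
  unfold dyadicBelow
  rw [div_le_iff₀ (by positivity), mul_comm a]
  rcases Nat.eq_zero_or_pos ⌈2 ^ n * a⌉₊ with h | h
  · rw [h]; simp; positivity
  · exact (Nat.lt_ceil.1 (Nat.sub_lt h one_pos)).le

lemma le_dyadicBelow_add (a : ℝ) (n : ℕ) : a - (1 / 2) ^ n ≤ dyadicBelow n a := by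
  unfold dyadicBelow
  rw [le_div_iff₀ (by positivity), sub_mul, ← mul_pow]
  have h1 := Nat.le_ceil (2 ^ n * a)
  have h2 : (⌈2 ^ n * a⌉₊ : ℝ) ≤ ((⌈2 ^ n * a⌉₊ - 1 : ℕ) : ℝ) + 1 := by
    exact_mod_cast (by omega : ⌈2 ^ n * a⌉₊ ≤ ⌈2 ^ n * a⌉₊ - 1 + 1)
  norm_num
  linarith

/-- For `a > 0` the approximation is the largest multiple of `2⁻ⁿ` strictly below `a`, and the
dyadic grids are nested. Being increasing in `n` and a function of the level alone, it can serve as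
a parameter fixed by the discretized data and still allow monotone convergence. -/
lemma dyadicBelow_monotone (a : ℝ) : Monotone fun n => dyadicBelow n a := by
  refine monotone_nat_of_le_succ fun n => ?_
  unfold dyadicBelow
  rw [div_le_div_iff₀ (by positivity) (by positivity), pow_succ, ← mul_assoc, mul_right_comm]
  refine mul_le_mul_of_nonneg_right ?_ (by positivity)
  rcases Nat.eq_zero_or_pos ⌈2 ^ n * a⌉₊ with h | h
  · rw [h]; simp
  · have h1 := Nat.lt_ceil.1 (Nat.sub_lt h one_pos)
    have h2 : (⌈2 ^ n * a⌉₊ - 1) * 2 < ⌈2 ^ (n + 1) * a⌉₊ := by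
      rw [Nat.lt_ceil]; push_cast at h1 ⊢; rw [pow_succ]; linarith
    rw [mul_right_comm] at *
    have h3 : ⌈2 ^ (n + 1) * a⌉₊ = ⌈2 ^ n * a * 2⌉₊ := by congr 1; ring
    rw [h3] at h2
    exact_mod_cast Nat.le_sub_one_of_lt h2

lemma tendsto_dyadicBelow {a : ℝ} (ha : 0 ≤ a) :
    Tendsto (fun n => dyadicBelow n a) atTop (𝓝 a) := by
  refine tendsto_of_tendsto_of_tendsto_of_le_of_le ?_ tendsto_const_nhds
    (fun n => le_dyadicBelow_add a n) (dyadicBelow_le ha)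
  simpa using (tendsto_const_nhds (x := a)).sub
    (tendsto_pow_atTop_nhds_zero_of_lt_one (by norm_num : (0 : ℝ) ≤ 1 / 2) (by norm_num))

lemma tendsto_ceil_dyadic {a : ℝ} (ha : 0 ≤ a) :
    Tendsto (fun n : ℕ => (⌈2 ^ n * a⌉₊ : ℝ) / 2 ^ n) atTop (𝓝 a) := by
  have := (tendsto_nat_ceil_mul_div_atTop ha).comp
    (tendsto_pow_atTop_atTop_of_one_lt (by norm_num : (1 : ℝ) < 2))
  simpa [Function.comp_def, mul_comm] using this

/-- The levels of `y` and `x` differ in this direction exactly when a multiple of `2⁻ⁿ` lies in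
`[‖y‖², ‖x‖²)`, and such a point remains on every finer grid. -/
lemma sqLevel_lt_succ {n : ℕ} {x y : Plane} (h : sqLevel n y < sqLevel n x) :
    sqLevel (n + 1) y < sqLevel (n + 1) x := by
  have h1 : (sqLevel n y : ℝ) < 2 ^ n * ‖x‖ ^ 2 := Nat.lt_ceil.1 h
  have h2 : sqLevel (n + 1) y ≤ 2 * sqLevel n y := by
    refine Nat.ceil_le.2 ?_
    have := Nat.le_ceil (2 ^ n * ‖y‖ ^ 2)
    push_cast
    rw [pow_succ, mul_right_comm, mul_comm]
    exact mul_le_mul_of_nonneg_left this (by norm_num)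
  refine h2.trans_lt (Nat.lt_ceil.2 ?_)
  push_cast
  rw [pow_succ]; linarith

lemma sqLevel_lt_mono {m n : ℕ} (hmn : m ≤ n) {x y : Plane} (h : sqLevel m y < sqLevel m x) :
    sqLevel n y < sqLevel n x := by
  induction n, hmn using Nat.le_induction with
  | base => exact h
  | succ n _ ih => exact sqLevel_lt_succ ih

lemma eventually_sqLevel_lt {x y : Plane} (h : ‖y‖ ^ 2 < ‖x‖ ^ 2) :
    ∀ᶠ n in atTop, sqLevel n y < sqLevel n x := by
  have ht := (tendsto_pow_atTop_atTop_of_one_lt (by norm_num : (1 : ℝ) < 2)).atTop_mul_const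
    (sub_pos.2 h)
  filter_upwards [ht.eventually_gt_atTop 1] with n hn
  have h1 : (sqLevel n y : ℝ) < 2 ^ n * ‖y‖ ^ 2 + 1 := Nat.ceil_lt_add_one (by positivity)
  exact Nat.lt_ceil.2 (by linarith)

/-! ### Ordered configurations -/

/-- In an ordered configuration the point of index `i` is at level at most `m` exactly when at least
`i + 1` points are. This is how levels of individual points are read off from counts. -/
lemma succ_le_tsum_iff {J : ℕ → ℕ} (hJ : Monotone J) (i m : ℕ) :
    (((i + 1 : ℕ) : ℝ≥0∞) ≤ ∑' l, if J l ≤ m then 1 else 0) ↔ J i ≤ m := by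
  constructor
  · intro h
    by_contra hi
    rw [tsum_eq_sum (s := Finset.range i) (fun l hl => by
      rw [if_neg]
      rw [Finset.mem_range, not_lt] at hl
      exact fun hh => hi ((hJ hl).trans hh))] at h
    have h2 : ∑ l ∈ Finset.range i, (if J l ≤ m then (1 : ℝ≥0∞) else 0) ≤ (i : ℕ) := by
      refine (Finset.sum_le_sum (g := fun _ => 1) fun l _ => ?_).trans (by simp)
      split_ifs <;> simp
    have := h.trans h2
    rw [Nat.cast_le] at this
    omega
  · intro h
    refine le_trans ?_ (ENNReal.sum_le_tsum (Finset.range (i + 1)))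
    rw [Finset.sum_congr rfl (g := fun _ => (1 : ℝ≥0∞)) fun l hl => if_pos
      ((hJ (Nat.lt_succ_iff.1 (Finset.mem_range.1 hl))).trans h)]
    simp

lemma sum_pointCount_sqLevel (x : ℕ → Plane) (n : ℕ) {L m : ℕ} (hm : m ≤ L) :
    ∑ k : Fin (L + 1), (if (k : ℕ) ≤ m then pointCount x (sqLevel n ⁻¹' {(k : ℕ)}) else 0) =
      ∑' l, if sqLevel n (x l) ≤ m then 1 else 0 := by
  have h1 : ∀ k : Fin (L + 1), (if (k : ℕ) ≤ m then pointCount x (sqLevel n ⁻¹' {(k : ℕ)}) else 0) =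
      ∑' l, if (k : ℕ) ≤ m then (sqLevel n ⁻¹' {(k : ℕ)}).indicator 1 (x l) else 0 := by
    intro k; split_ifs <;> simp [pointCount]
  rw [Finset.sum_congr rfl fun k _ => h1 k,
    ← Summable.tsum_finsetSum (fun _ _ => ENNReal.summable)]
  refine tsum_congr fun l => ?_
  rw [Fin.sum_univ_eq_sum_range (fun k => if k ≤ m then
    (sqLevel n ⁻¹' {k}).indicator (1 : Plane → ℝ≥0∞) (x l) else 0) (L + 1)]
  split_ifs with h
  · rw [Finset.sum_eq_single (sqLevel n (x l))]
    · simp [h]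
    · intro k _ hk
      have : x l ∉ sqLevel n ⁻¹' {k} := fun hh => hk hh.symm
      simp [this]
    · intro hh
      exact absurd (Finset.mem_range.2 (Nat.lt_succ_of_le (h.trans hm))) hh
  · refine Finset.sum_eq_zero fun k _ => ?_
    split_ifs with hk
    · have : x l ∉ sqLevel n ⁻¹' {k} := fun hh => h (by
        rw [show sqLevel n (x l) = k from hh]; exact hk)
      simp [this]
    · rfl

/-- The counts of the level sets `0, …, v last` for which the first `K` points of an ordered
configuration are at the levels `v`. -/
def levelEvent {K : ℕ} (v : Fin K → ℕ) (L : ℕ) : Set (Fin (L + 1) → ℝ≥0∞) :=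
  ⋂ i : Fin K, ⋂ m : Fin (L + 1), {c | (((i : ℕ) + 1 : ℕ) : ℝ≥0∞) ≤
    ∑ k : Fin (L + 1), (if (k : ℕ) ≤ m then c k else 0) ↔ v i ≤ m}

lemma measurableSet_levelEvent {K : ℕ} (v : Fin K → ℕ) (L : ℕ) :
    MeasurableSet (levelEvent v L) := by
  refine MeasurableSet.iInter fun i => MeasurableSet.iInter fun m => ?_
  refine MeasurableSet.iff (measurableSet_le measurable_const ?_) (.const _)
  refine Finset.measurable_sum _ fun k _ => ?_
  split_ifs
  · exact measurable_pi_apply k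
  · exact measurable_const

lemma mem_levelEvent_iff {K : ℕ} {v : Fin K → ℕ} {L : ℕ} (hv : ∀ i, v i ≤ L) {x : ℕ → Plane}
    (hx : Monotone fun i => ‖x i‖) (n : ℕ) :
    (fun k : Fin (L + 1) => pointCount x (sqLevel n ⁻¹' {(k : ℕ)})) ∈ levelEvent v L ↔
      ∀ i : Fin K, sqLevel n (x i) = v i := by
  have hJ : Monotone fun i => sqLevel n (x i) := fun i j hij => sqLevel_mono (hx hij)
  simp only [levelEvent, Set.mem_iInter, Set.mem_ofPred_eq]
  have key : ∀ (i : Fin K) (m : Fin (L + 1)), (((((i : ℕ) + 1 : ℕ) : ℝ≥0∞) ≤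
    ∑ k : Fin (L + 1), (if (k : ℕ) ≤ m then pointCount x (sqLevel n ⁻¹' {(k : ℕ)}) else 0) ↔
      v i ≤ m) ↔ (sqLevel n (x i) ≤ m ↔ v i ≤ m)) := by
    intro i m
    rw [sum_pointCount_sqLevel x n (Nat.lt_succ_iff.1 m.2), succ_le_tsum_iff hJ]
  simp only [key]
  constructor
  · intro h i
    -- Thresholds are only available up to `L`. The bound on `v` permits the threshold `v i`, which
    -- in turn shows that the actual level of the point is at most `L` and may itself be used as a
    -- threshold.
    have h1 := (h i ⟨v i, Nat.lt_succ_of_le (hv i)⟩).2 le_rfl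
    refine le_antisymm h1 ?_
    exact (h i ⟨sqLevel n (x i), Nat.lt_succ_of_le (h1.trans (hv i))⟩).1 le_rfl
  · intro h i m
    rw [h i]

/-! ### The Laplace functional beyond the `K`-th closest point -/

lemma lintegral_eq_tsum_fiber {Ω ι : Type*} [MeasurableSpace Ω] (μ : Measure Ω) [Countable ι]
    [MeasurableSpace ι] [MeasurableSingletonClass ι] {V : Ω → ι} (hV : Measurable V)
    (F : Ω → ℝ≥0∞) : ∫⁻ ω, F ω ∂μ = ∑' v, ∫⁻ ω in {ω | V ω = v}, F ω ∂μ := by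
  have hm : ∀ v, MeasurableSet {ω | V ω = v} := fun v => hV (measurableSet_singleton v)
  rw [← lintegral_iUnion hm, ← setLIntegral_univ]
  · congr 2
    ext ω; simp
  · intro v w hvw
    exact Set.disjoint_left.2 fun ω h1 h2 => hvw (h1.symm.trans h2)

namespace IsPPP

variable {Ω : Type*} [MeasurableSpace Ω] {μ : Measure Ω} [IsProbabilityMeasure μ]
  {X : ℕ → Ω → Plane} {Λ : Measure Plane} {K : ℕ} [NeZero K]

/-- For an ordered configuration, the event that the first `K` points have levels `v` only concerns
counts in the levels up to that of the last one. The function `g` vanishes there, so the localized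
Laplace functional applies. -/
lemma setLIntegral_negExp_sqLevel (h : IsPPP μ X Λ) (hb : ∀ n : ℕ, Λ (Metric.ball 0 n) ≠ ∞)
    (hX : ∀ᵐ ω ∂μ, Monotone fun i => ‖X i ω‖) (n : ℕ) (v : Fin K → ℕ)
    {g : Plane → ℝ≥0∞} (hg : Measurable g) (hgv : ∀ x, sqLevel n x ≤ v (lastIdx K) → g x = 0) :
    ∫⁻ ω in {ω | (fun i : Fin K => sqLevel n (X i ω)) = v}, negExp (∑' i, g (X i ω)) ∂μ =
      ∫⁻ _ in {ω | (fun i : Fin K => sqLevel n (X i ω)) = v},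
        negExp (∫⁻ x, (1 - negExp (g x)) ∂Λ) ∂μ := by
  rw [setLIntegral_const, mul_comm]
  by_cases hv : ∀ i, v i ≤ v (lastIdx K)
  · have hE : {ω | (fun i : Fin K => sqLevel n (X i ω)) = v} =ᵐ[μ]
        {ω | (fun k : Fin (v (lastIdx K) + 1) => pointCount (fun i => X i ω)
          (sqLevel n ⁻¹' {(k : ℕ)})) ∈ levelEvent v (v (lastIdx K))} := by
      filter_upwards [hX] with ω hω
      refine propext ?_
      exact (funext_iff.trans (mem_levelEvent_iff hv hω n).symm)
    rw [setLIntegral_congr hE, measure_congr hE]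
    refine h.setLIntegral_negExp_tsum hb
      (fun k => measurable_sqLevel n (measurableSet_singleton _)) ?_
      (measurableSet_levelEvent _ _) hg ?_
    · intro k l hkl
      refine Set.disjoint_left.2 fun x h1 h2 => hkl (Fin.ext ?_)
      exact h1.symm.trans h2
    · intro k x hx
      refine hgv x ?_
      rw [show sqLevel n x = k from hx]
      exact Nat.lt_succ_iff.1 k.2
  -- Levels exceeding that of the last point contradict the ordering, so this case is null.
  · have hE : μ {ω | (fun i : Fin K => sqLevel n (X i ω)) = v} = 0 := by
      rw [measure_eq_zero_iff_ae_notMem]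
      filter_upwards [hX] with ω hω hv'
      refine hv fun i => ?_
      rw [← show (fun i : Fin K => sqLevel n (X i ω)) = v from hv']
      exact sqLevel_mono (hω (Nat.le_sub_one_of_lt i.2))
    rw [hE, Measure.restrict_eq_zero.2 hE, lintegral_zero_measure, zero_mul]

end IsPPP

/-- The functional `g`, with parameter approximated from below, of the points whose level is
larger than `L`. -/
def levelFun (g : ℝ → Plane → ℝ≥0∞) (n m L : ℕ) (x : Plane) : ℝ≥0∞ :=
  if L < sqLevel n x then g (((m - 1 : ℕ) : ℝ) / 2 ^ n) x else 0

lemma measurable_levelFun {g : ℝ → Plane → ℝ≥0∞} (hg : Measurable (Function.uncurry g))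
    (n m L : ℕ) : Measurable (levelFun g n m L) := by
  refine Measurable.ite (measurable_sqLevel n measurableSet_Ioi) ?_ measurable_const
  exact hg.comp measurable_prodMk_left

/-- Refining the mesh admits more points beyond the cut, since separated levels stay separated, and
raises the parameter. The origin has level zero and is never beyond the cut, so monotonicity of `g`
is only needed elsewhere. -/
lemma levelFun_monotone {g : ℝ → Plane → ℝ≥0∞}
    (hmono : ∀ x ≠ 0, MonotoneOn (fun u => g u x) (Set.Ici 0)) (y z x : Plane) :
    Monotone fun n => levelFun g n (sqLevel n z) (sqLevel n y) x := by
  intro m n hmn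
  simp only [levelFun]
  split_ifs with h1 h2
  · have hx : x ≠ 0 := by rintro rfl; simp [sqLevel] at h1
    exact hmono x hx (dyadicBelow_nonneg m (‖z‖ ^ 2)) (dyadicBelow_nonneg n (‖z‖ ^ 2))
      (dyadicBelow_monotone (‖z‖ ^ 2) hmn)
  · exact absurd (sqLevel_lt_mono hmn h1) h2
  · exact zero_le
  · exact le_rfl

lemma tendsto_levelFun {g : ℝ → Plane → ℝ≥0∞}
    (hcont : ∀ x ≠ 0, ContinuousOn (fun u => g u x) (Set.Ici 0)) (y z x : Plane) :
    Tendsto (fun n => levelFun g n (sqLevel n z) (sqLevel n y) x) atTop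
      (𝓝 (if ‖y‖ < ‖x‖ then g (‖z‖ ^ 2) x else 0)) := by
  split_ifs with h
  · have hx : x ≠ 0 := by rintro rfl; simp at h; linarith [norm_nonneg y]
    have h2 : ‖y‖ ^ 2 < ‖x‖ ^ 2 := by gcongr
    have hc : Tendsto (fun n => g (dyadicBelow n (‖z‖ ^ 2)) x) atTop (𝓝 (g (‖z‖ ^ 2) x)) :=
      (hcont x hx (‖z‖ ^ 2) (sq_nonneg ‖z‖)).tendsto.comp (tendsto_nhdsWithin_iff.2
        ⟨tendsto_dyadicBelow (sq_nonneg _),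
          Eventually.of_forall fun n => dyadicBelow_nonneg n (‖z‖ ^ 2)⟩)
    refine hc.congr' ?_
    filter_upwards [eventually_sqLevel_lt h2] with n hn
    rw [levelFun, if_pos hn]
    rfl
  · refine tendsto_const_nhds.congr fun n => ?_
    rw [levelFun, if_neg (not_lt.2 (sqLevel_mono (not_lt.1 h)))]

namespace IsPPP

variable {Ω : Type*} [MeasurableSpace Ω] {μ : Measure Ω} [IsProbabilityMeasure μ]
  {X : ℕ → Ω → Plane} {Λ : Measure Plane} {K : ℕ} [NeZero K]

lemma lintegral_mul_negExp_levelFun (h : IsPPP μ X Λ) (hb : ∀ n : ℕ, Λ (Metric.ball 0 n) ≠ ∞)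
    (hX : ∀ᵐ ω ∂μ, Monotone fun i => ‖X i ω‖) {g : ℝ → Plane → ℝ≥0∞}
    (hg : Measurable (Function.uncurry g)) (j : Fin K) (n : ℕ) (φ : (Fin K → ℕ) → ℝ≥0∞) :
    ∫⁻ ω, φ (fun i : Fin K => sqLevel n (X i ω)) * negExp (∑' i,
        levelFun g n (sqLevel n (X j ω)) (sqLevel n (X (lastIdx K) ω)) (X i ω)) ∂μ =
      ∫⁻ ω, φ (fun i : Fin K => sqLevel n (X i ω)) * negExp (∫⁻ x, (1 - negExp
        (levelFun g n (sqLevel n (X j ω)) (sqLevel n (X (lastIdx K) ω)) x)) ∂Λ) ∂μ := by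
  have hJ : Measurable fun ω (i : Fin K) => sqLevel n (X i ω) :=
    measurable_pi_lambda _ fun i => (measurable_sqLevel n).comp (h.measurable i)
  -- The levels take countably many values. On each fibre the cut, the parameter and the weight are
  -- constants, and the deterministic statement can be used.
  rw [lintegral_eq_tsum_fiber μ hJ, lintegral_eq_tsum_fiber μ hJ]
  refine tsum_congr fun v => ?_
  have hm : MeasurableSet {ω | (fun i : Fin K => sqLevel n (X i ω)) = v} :=
    hJ (measurableSet_singleton v)
  have e₁ : Set.EqOn (fun ω => φ (fun i : Fin K => sqLevel n (X i ω)) * negExp (∑' i,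
        levelFun g n (sqLevel n (X j ω)) (sqLevel n (X (lastIdx K) ω)) (X i ω)))
      (fun ω => φ v * negExp (∑' i, levelFun g n (v j) (v (lastIdx K)) (X i ω)))
      {ω | (fun i : Fin K => sqLevel n (X i ω)) = v} := by
    rintro ω rfl; rfl
  have e₂ : Set.EqOn (fun ω => φ (fun i : Fin K => sqLevel n (X i ω)) * negExp (∫⁻ x, (1 - negExp
        (levelFun g n (sqLevel n (X j ω)) (sqLevel n (X (lastIdx K) ω)) x)) ∂Λ))
      (fun _ => φ v * negExp (∫⁻ x, (1 - negExp (levelFun g n (v j) (v (lastIdx K)) x)) ∂Λ))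
      {ω | (fun i : Fin K => sqLevel n (X i ω)) = v} := by
    rintro ω rfl; rfl
  have hmeas : Measurable fun ω => negExp (∑' i, levelFun g n (v j) (v (lastIdx K)) (X i ω)) :=
    measurable_negExp.comp (Measurable.tsum fun i =>
      (measurable_levelFun hg _ _ _).comp (h.measurable i))
  rw [setLIntegral_congr_fun hm e₁, setLIntegral_congr_fun hm e₂, lintegral_const_mul _ hmeas,
    lintegral_const_mul _ measurable_const,
    h.setLIntegral_negExp_sqLevel hb hX n v (measurable_levelFun hg _ _ _)
      (fun x hx => if_neg (not_lt.2 hx))]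

/-- Beyond the `K`-th closest point, the points of an ordered Poisson point process form, given
the distances of the `K` closest ones, a Poisson point process of the same intensity. -/
theorem lintegral_mul_negExp_beyond (h : IsPPP μ X Λ) [SFinite Λ]
    (hb : ∀ n : ℕ, Λ (Metric.ball 0 n) ≠ ∞)
    (hX : ∀ᵐ ω ∂μ, Monotone fun i => ‖X i ω‖) {g : ℝ → Plane → ℝ≥0∞}
    (hg : Measurable (Function.uncurry g))
    (hmono : ∀ x ≠ 0, MonotoneOn (fun u => g u x) (Set.Ici 0))
    (hcont : ∀ x ≠ 0, ContinuousOn (fun u => g u x) (Set.Ici 0)) (j : Fin K)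
    {ψ : (Fin K → ℝ) → ℝ≥0∞} (hψ : Measurable ψ) :
    ∫⁻ ω, ψ (fun i : Fin K => ‖X i ω‖ ^ 2) * negExp (∑' i,
        if ‖X (lastIdx K) ω‖ < ‖X i ω‖ then g (‖X j ω‖ ^ 2) (X i ω) else 0) ∂μ =
      ∫⁻ ω, ψ (fun i : Fin K => ‖X i ω‖ ^ 2) * negExp (∫⁻ x, (1 - negExp
        (if ‖X (lastIdx K) ω‖ < ‖x‖ then g (‖X j ω‖ ^ 2) x else 0)) ∂Λ) ∂μ := by
  have hXm := h.measurable
  have hQ : Measurable fun ω (i : Fin K) => ‖X i ω‖ ^ 2 :=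
    measurable_pi_lambda _ fun i => measurable_normSq.comp (hXm i)
  set F₁ : Ω → ℝ≥0∞ := fun ω => negExp (∑' i,
        if ‖X (lastIdx K) ω‖ < ‖X i ω‖ then g (‖X j ω‖ ^ 2) (X i ω) else 0) with hF₁
  set F₂ : Ω → ℝ≥0∞ := fun ω => negExp (∫⁻ x, (1 - negExp
        (if ‖X (lastIdx K) ω‖ < ‖x‖ then g (‖X j ω‖ ^ 2) x else 0)) ∂Λ) with hF₂
  have hF₁m : Measurable F₁ := by
    refine measurable_negExp.comp (Measurable.tsum fun i => ?_)
    refine Measurable.ite (measurableSet_lt (hXm _).norm (hXm _).norm) ?_ measurable_const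
    exact hg.comp ((measurable_normSq.comp (hXm _)).prodMk (hXm _))
  have hF₂m : Measurable F₂ := by
    refine measurable_negExp.comp (Measurable.lintegral_prod_right'
      (f := fun q : Ω × Plane => 1 - negExp (if ‖X (lastIdx K) q.1‖ < ‖q.2‖ then
        g (‖X j q.1‖ ^ 2) q.2 else 0)) ?_)
    refine (measurable_negExp.comp ?_).const_sub _
    refine Measurable.ite (measurableSet_lt ((hXm _).comp measurable_fst).norm
      measurable_snd.norm) ?_ measurable_const
    exact hg.comp ((measurable_normSq.comp ((hXm _).comp measurable_fst)).prodMk measurable_snd)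
  -- Each side is read as the integral of `ψ` against the law of the squared distances under the
  -- density `F₁` or `F₂`. Equality of these two finite measures can be tested on bounded continuous
  -- `φ`, which, unlike a merely measurable `ψ`, are compatible with discretizing the distances.
  have hfin : ∀ F : Ω → ℝ≥0∞, (∀ ω, F ω ≤ 1) → IsFiniteMeasure (μ.withDensity F) := fun F hF =>
    isFiniteMeasure_withDensity (ne_top_of_le_ne_top (measure_ne_top μ Set.univ)
      ((lintegral_mono hF).trans (by simp)))
  have : IsFiniteMeasure (μ.withDensity F₁) := hfin F₁ fun ω => negExp_le_one _
  have : IsFiniteMeasure (μ.withDensity F₂) := hfin F₂ fun ω => negExp_le_one _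
  have key : (μ.withDensity F₁).map (fun ω (i : Fin K) => ‖X i ω‖ ^ 2) =
      (μ.withDensity F₂).map (fun ω (i : Fin K) => ‖X i ω‖ ^ 2) := by
    refine ext_of_forall_lintegral_eq_of_IsFiniteMeasure fun φ => ?_
    have hφ : Measurable fun q => (φ q : ℝ≥0∞) :=
      measurable_coe_nnreal_ennreal.comp φ.continuous.measurable
    have hφQ : Measurable fun ω => (φ fun i : Fin K => ‖X i ω‖ ^ 2 : ℝ≥0∞) := hφ.comp hQ
    rw [lintegral_map hφ hQ, lintegral_map hφ hQ,
      lintegral_withDensity_eq_lintegral_mul _ hF₁m hφQ,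
      lintegral_withDensity_eq_lintegral_mul _ hF₂m hφQ]
    obtain ⟨C, hC⟩ : ∃ C : ℝ≥0, ∀ q, φ q ≤ C :=
      ⟨nndist φ 0, fun q => by simpa using φ.nndist_coe_le_nndist (g := 0) q⟩
    set J : ℕ → Ω → Fin K → ℕ := fun n ω i => sqLevel n (X i ω) with hJ
    have hJm : ∀ n, Measurable (J n) := fun n =>
      measurable_pi_lambda _ fun i => (measurable_sqLevel n).comp (hXm i)
    have hφlim : ∀ ω, Tendsto (fun n => (φ fun i => (J n ω i : ℝ) / 2 ^ n : ℝ≥0∞)) atTop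
        (𝓝 (φ fun i => ‖X i ω‖ ^ 2)) := by
      intro ω
      refine ENNReal.tendsto_coe.2 ((φ.continuous.tendsto _).comp (tendsto_pi_nhds.2 fun i => ?_))
      exact tendsto_ceil_dyadic (sq_nonneg _)
    -- Dominated convergence by the bound of `φ`, stated once and used for both sides.
    have hlim : ∀ (G : ℕ → Ω → ℝ≥0∞) (F : Ω → ℝ≥0∞), (∀ n, Measurable (G n)) →
        (∀ n ω, G n ω ≤ 1) → (∀ ω, Tendsto (fun n => G n ω) atTop (𝓝 (F ω))) →
        Tendsto (fun n => ∫⁻ ω, (φ fun i => (J n ω i : ℝ) / 2 ^ n : ℝ≥0∞) * G n ω ∂μ) atTop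
          (𝓝 (∫⁻ ω, (F * fun ω => (φ fun i : Fin K => ‖X i ω‖ ^ 2 : ℝ≥0∞)) ω ∂μ)) := by
      intro G F hGm hG1 hGF
      refine tendsto_lintegral_of_dominated_convergence (fun _ => (C : ℝ≥0∞)) (fun n => ?_)
        (fun n => ?_) (by simp) (Eventually.of_forall fun ω => ?_)
      · refine Measurable.mul ?_ (hGm n)
        exact Measurable.comp (g := fun v : Fin K → ℕ => (φ fun i => (v i : ℝ) / 2 ^ n : ℝ≥0∞))
          (measurable_of_countable _) (hJm n)
      · refine Eventually.of_forall fun ω => ?_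
        refine (mul_le_mul' (ENNReal.coe_le_coe.2 (hC _)) (hG1 n ω)).trans (by simp)
      · rw [Pi.mul_apply, mul_comm]
        have hF1 : F ω ≤ 1 := le_of_tendsto' (hGF ω) fun n => hG1 n ω
        exact ENNReal.Tendsto.mul (hφlim ω) (Or.inr (ne_top_of_le_ne_top ENNReal.one_ne_top hF1))
          (hGF ω) (Or.inr ENNReal.coe_ne_top)
    have hlevm : ∀ n, Measurable fun q : (Fin K → ℕ) × Plane =>
        levelFun g n (q.1 j) (q.1 (lastIdx K)) q.2 := fun n =>
      measurable_from_prod_countable_right fun v => measurable_levelFun hg _ _ _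
    have hmon : ∀ ω x, Monotone fun n => levelFun g n (J n ω j) (J n ω (lastIdx K)) x :=
      fun ω x => levelFun_monotone hmono (X (lastIdx K) ω) (X j ω) x
    have htend : ∀ ω x, Tendsto (fun n => levelFun g n (J n ω j) (J n ω (lastIdx K)) x) atTop
        (𝓝 (if ‖X (lastIdx K) ω‖ < ‖x‖ then g (‖X j ω‖ ^ 2) x else 0)) :=
      fun ω x => tendsto_levelFun hcont (X (lastIdx K) ω) (X j ω) x
    have h₁ := hlim (fun n ω => negExp (∑' i,
        levelFun g n (J n ω j) (J n ω (lastIdx K)) (X i ω))) F₁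
      (fun n => measurable_negExp.comp (Measurable.tsum fun i =>
        (hlevm n).comp ((hJm n).prodMk (hXm i))))
      (fun n ω => negExp_le_one _) (fun ω => tendsto_negExp_tsum (fun i => hmon ω _)
        (fun i => htend ω _))
    have h₂ := hlim (fun n ω => negExp (∫⁻ x, (1 - negExp
        (levelFun g n (J n ω j) (J n ω (lastIdx K)) x)) ∂Λ)) F₂
      (fun n => Measurable.comp (g := fun v : Fin K → ℕ => negExp (∫⁻ x, (1 - negExp
        (levelFun g n (v j) (v (lastIdx K)) x)) ∂Λ)) (measurable_of_countable _) (hJm n))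
      (fun n ω => negExp_le_one _) (fun ω => tendsto_negExp_lintegral
        (fun n => measurable_levelFun hg _ _ _) (hmon ω) (htend ω))
    refine tendsto_nhds_unique h₁ (h₂.congr fun n => ?_)
    exact (h.lintegral_mul_negExp_levelFun hb hX hg j n
      (fun v => (φ fun i => (v i : ℝ) / 2 ^ n : ℝ≥0∞))).symm
  have hψQ : Measurable fun ω => ψ fun i : Fin K => ‖X i ω‖ ^ 2 := hψ.comp hQ
  have := congrArg (fun ν => ∫⁻ q, ψ q ∂ν) key
  simp only [lintegral_map hψ hQ] at this
  rw [lintegral_withDensity_eq_lintegral_mul _ hF₁m hψQ,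
    lintegral_withDensity_eq_lintegral_mul _ hF₂m hψQ] at this
  simpa only [Pi.mul_apply, mul_comm] using this

end IsPPP

/-! ### Euler's integral for the hypergeometric function -/

lemma ascPochhammer_eval_add_one (b : ℝ) (n : ℕ) :
    b * (ascPochhammer ℝ n).eval (b + 1) = (ascPochhammer ℝ n).eval b * (b + n) := by
  rw [← ascPochhammer_succ_eval, ascPochhammer_succ_left]
  simp [Polynomial.eval_comp]

/-- The factor `(1)_n` cancels the factorial, and `(b)_n / (b + 1)_n` telescopes to `b / (b + n)`.
-/
lemma ordinaryHypergeometric_one_eq_tsum {b : ℝ} (hb : 0 < b) (x : ℝ) :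
    ordinaryHypergeometric 1 b (b + 1) x = ∑' n : ℕ, b / (b + n) * x ^ n := by
  rw [ordinaryHypergeometric_eq_tsum]
  refine tsum_congr fun n => ?_
  rw [smul_eq_mul, ascPochhammer_eval_one]
  congr 1
  have h1 := ascPochhammer_pos n (b + 1) (by linarith)
  have h2 : (n.factorial : ℝ) ≠ 0 := by positivity
  have h3 : b + n ≠ 0 := by positivity
  rw [inv_mul_cancel₀ h2, one_mul, ← div_eq_mul_inv, div_eq_div_iff h1.ne' h3,
    ← ascPochhammer_eval_add_one]

lemma intervalIntegrable_rpow_div {b t : ℝ} (hb : 0 < b) (ht : 0 ≤ t) :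
    IntervalIntegrable (fun y : ℝ => y ^ (b - 1) / (1 + t * y)) volume 0 1 := by
  refine (intervalIntegral.intervalIntegrable_rpow' (a := 0) (b := 1)
    (by linarith : -1 < b - 1)).mono_fun (Measurable.aestronglyMeasurable (by fun_prop)) ?_
  rw [Set.uIoc_of_le zero_le_one]
  filter_upwards [ae_restrict_mem measurableSet_Ioc] with y hy
  have h1 : 1 ≤ 1 + t * y := by have := mul_nonneg ht hy.1.le; linarith
  rw [Real.norm_of_nonneg (div_nonneg (Real.rpow_nonneg hy.1.le _) (by linarith)),
    Real.norm_of_nonneg (Real.rpow_nonneg hy.1.le _)]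
  exact div_le_self (Real.rpow_nonneg hy.1.le _) h1

/-- Both branches of the definition give the same integral. Outside the disc it is Euler's formula
with `c - b = 1`; inside, the geometric series of `1 / (1 + t y)` is integrated term by term. -/
lemma gaussHyp_one_eq_integral {b t : ℝ} (hb : 0 < b) (ht : 0 ≤ t) :
    gaussHyp 1 b (b + 1) (-t) = b * ∫ y in (0 : ℝ)..1, y ^ (b - 1) / (1 + t * y) := by
  rw [gaussHyp]
  split_ifs with h
  · rw [abs_neg, abs_of_nonneg ht] at h
    rw [ordinaryHypergeometric_one_eq_tsum hb]
    have hs : HasSum (fun n : ℕ => ∫ y in (0 : ℝ)..1, y ^ (b - 1) * (-(t * y)) ^ n)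
        (∫ y in (0 : ℝ)..1, y ^ (b - 1) / (1 + t * y)) := by
      -- Since `t < 1` in this branch, the majorants `t ^ n y ^ (b - 1)` form a geometric series
      -- with integrable sum.
      refine intervalIntegral.hasSum_integral_of_dominated_convergence
        (fun n y => t ^ n * y ^ (b - 1)) (fun n => by fun_prop) (fun n => ?_) ?_ ?_ ?_
      · refine Eventually.of_forall fun y hy => ?_
        rw [Set.uIoc_of_le zero_le_one] at hy
        rw [norm_mul, norm_pow, norm_neg, Real.norm_of_nonneg (Real.rpow_nonneg hy.1.le _),
          Real.norm_of_nonneg (mul_nonneg ht hy.1.le), mul_comm]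
        refine mul_le_mul_of_nonneg_right (pow_le_pow_left₀ (mul_nonneg ht hy.1.le) ?_ _)
          (Real.rpow_nonneg hy.1.le _)
        exact mul_le_of_le_one_right ht hy.2
      · exact Eventually.of_forall fun y _ => (summable_geometric_of_lt_one ht h).mul_right _
      · simp_rw [tsum_mul_right]
        exact (intervalIntegral.intervalIntegrable_rpow' (by linarith)).const_mul _
      · refine Eventually.of_forall fun y hy => ?_
        rw [Set.uIoc_of_le zero_le_one] at hy
        have hlt : ‖-(t * y)‖ < 1 := by
          rw [norm_neg, Real.norm_of_nonneg (mul_nonneg ht hy.1.le)]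
          exact (mul_le_of_le_one_right ht hy.2).trans_lt h
        have := (hasSum_geometric_of_norm_lt_one hlt).mul_left (y ^ (b - 1))
        rwa [sub_neg_eq_add, ← div_eq_mul_inv] at this
    rw [← hs.tsum_eq, ← tsum_mul_left]
    refine tsum_congr fun n => ?_
    have : ∫ y in (0 : ℝ)..1, y ^ (b - 1) * (-(t * y)) ^ n =
        ∫ y in (0 : ℝ)..1, (-t) ^ n * y ^ (b - 1 + n) := by
      refine intervalIntegral.integral_congr_ae (Eventually.of_forall fun y hy => ?_)
      rw [Set.uIoc_of_le zero_le_one] at hy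
      rw [Real.rpow_add_natCast hy.1.ne', ← neg_mul, mul_pow]; ring
    rw [this, intervalIntegral.integral_const_mul, integral_rpow (Or.inl (by
      have : (0 : ℝ) ≤ n := n.cast_nonneg
      linarith)), Real.one_rpow, Real.zero_rpow (by
        have : (0 : ℝ) ≤ n := n.cast_nonneg
        linarith)]
    have : b - 1 + n + 1 = b + n := by ring
    rw [this]; ring
  · have h1 : b + 1 - b = 1 := by ring
    rw [h1, Real.Gamma_one, mul_one, Real.Gamma_add_one hb.ne',
      mul_div_cancel_right₀ _ (Real.Gamma_pos_of_pos hb).ne']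
    congr 1
    refine intervalIntegral.integral_congr fun y _ => ?_
    simp only [sub_self, Real.rpow_zero, mul_one]
    rw [neg_mul, sub_neg_eq_add, Real.rpow_neg_one, div_eq_mul_inv]

lemma pathF_eq_integral {t η : ℝ} (hη : 2 < η) (ht : 0 ≤ t) :
    pathF t η = 2 * t / η * ∫ y in (0 : ℝ)..1, y ^ (-(2 / η)) / (1 + t * y) := by
  have h2 : 2 / η < 1 := by rw [div_lt_one (by linarith)]; exact hη
  have h := gaussHyp_one_eq_integral (b := 1 - 2 / η) (by linarith) ht
  rw [show 1 - 2 / η + 1 = 2 - 2 / η by ring, show 1 - 2 / η - 1 = -(2 / η) by ring] at h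
  have h3 : η - 2 ≠ 0 := by linarith
  have h4 : η ≠ 0 := by linarith
  rw [pathF, h, ← mul_assoc]
  congr 1
  field_simp

lemma pathF_nonneg {t η : ℝ} (hη : 2 < η) (ht : 0 ≤ t) : 0 ≤ pathF t η := by
  rw [pathF_eq_integral hη ht]
  refine mul_nonneg (div_nonneg (by linarith) (by linarith)) ?_
  refine intervalIntegral.integral_nonneg zero_le_one fun y hy => ?_
  exact div_nonneg (Real.rpow_nonneg hy.1 _) (by have := mul_nonneg ht hy.1; linarith)

/-- Discarding the denominator in the integral gives a linear bound. It shows that `pathF` vanishes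
as its argument tends to zero, which is used for the finiteness of the interference. -/
lemma pathF_le {t η : ℝ} (hη : 2 < η) (ht : 0 ≤ t) : pathF t η ≤ 2 * t / (η - 2) := by
  have h2 : 2 / η < 1 := by rw [div_lt_one (by linarith)]; exact hη
  have hint := intervalIntegrable_rpow_div (b := 1 - 2 / η) (by linarith) ht
  rw [show 1 - 2 / η - 1 = -(2 / η) by ring] at hint
  have : ∫ y in (0 : ℝ)..1, y ^ (-(2 / η)) / (1 + t * y) ≤ ∫ y in (0 : ℝ)..1, y ^ (-(2 / η)) := by
    refine intervalIntegral.integral_mono_on zero_le_one hint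
      (intervalIntegral.intervalIntegrable_rpow' (by linarith)) fun y hy => ?_
    exact div_le_self (Real.rpow_nonneg hy.1 _) (by have := mul_nonneg ht hy.1; linarith)
  rw [integral_rpow (Or.inl (by linarith)), Real.one_rpow, Real.zero_rpow (by linarith)] at this
  rw [pathF_eq_integral hη ht]
  refine (mul_le_mul_of_nonneg_left this (div_nonneg (by linarith) (by linarith))).trans_eq ?_
  have h3 : η - 2 ≠ 0 := by linarith
  have h4 : η ≠ 0 := by linarith
  have h5 : -(2 / η) + 1 ≠ 0 := by linarith
  rw [sub_zero, div_mul_div_comm, mul_one]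
  congr 1
  field_simp; ring

/-! ### The interference integrals -/

/-- A nonzero Bochner integral forces integrability, so known closed forms transfer to `[0, ∞]`
without a separate proof of it. -/
lemma setLIntegral_ofReal_of_integral_eq {s : Set ℝ} (hs : MeasurableSet s) {f : ℝ → ℝ} {c : ℝ}
    (h0 : ∀ x ∈ s, 0 ≤ f x) (h : ∫ x in s, f x = c) (hc : c ≠ 0) :
    ∫⁻ x in s, ENNReal.ofReal (f x) = ENNReal.ofReal c := by
  rw [← h, ofReal_integral_eq_lintegral_ofReal]
  · exact Integrable.of_integral_ne_zero (by rwa [h])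
  · filter_upwards [ae_restrict_mem hs] with x hx using h0 x hx

/-- Write `s / (u ^ p + s)` as the integral of `s e^{-st} e^{-t u ^ p}` over `t > 0` and exchange
the order. The integral over `u` is a multiple of `Γ(1/p) t ^ (-1/p)`, and the one over `t` then
produces `Γ(1 - 1/p)`. -/
lemma lintegral_Ioi_div_rpow_add {p s : ℝ} (hp : 1 < p) (hs : 0 ≤ s) :
    ∫⁻ u in Set.Ioi (0 : ℝ), ENNReal.ofReal (s / (u ^ p + s)) =
      ENNReal.ofReal (s ^ (1 / p) * Real.Gamma (1 + 1 / p) * Real.Gamma (1 - 1 / p)) := by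
  have hp0 : 0 < p := by linarith
  have hp1 : 1 / p < 1 := by rw [div_lt_one hp0]; exact hp
  have hp2 : 0 < 1 / p := by positivity
  rcases hs.eq_or_lt with rfl | hs
  · rw [Real.zero_rpow hp2.ne']; simp
  have hΓ1 := Real.Gamma_pos_of_pos hp2
  have hΓ2 := Real.Gamma_pos_of_pos (sub_pos.2 hp1)
  have h1 : ∀ u ∈ Set.Ioi (0 : ℝ), ENNReal.ofReal (s / (u ^ p + s)) =
      ∫⁻ t in Set.Ioi (0 : ℝ), ENNReal.ofReal (s * Real.exp (-(s * t)) * Real.exp (-t * u ^ p)) := by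
    intro u hu
    have hup : 0 < u ^ p := Real.rpow_pos_of_pos hu p
    rw [setLIntegral_ofReal_of_integral_eq (c := s / (u ^ p + s)) measurableSet_Ioi
      (fun t _ => by positivity) ?_ (by positivity)]
    have := Real.integral_rpow_mul_exp_neg_mul_Ioi one_pos (add_pos hup hs)
    simp only [sub_self, Real.rpow_zero, one_mul, Real.rpow_one, Real.Gamma_one, mul_one] at this
    rw [div_eq_mul_one_div, ← this, ← integral_const_mul]
    refine setIntegral_congr_fun measurableSet_Ioi fun t _ => ?_
    rw [mul_assoc, ← Real.exp_add]
    congr 2; ring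
  rw [setLIntegral_congr_fun measurableSet_Ioi h1, lintegral_lintegral_swap (by fun_prop)]
  have h2 : ∀ t ∈ Set.Ioi (0 : ℝ), ∫⁻ u in Set.Ioi (0 : ℝ),
      ENNReal.ofReal (s * Real.exp (-(s * t)) * Real.exp (-t * u ^ p)) =
        ENNReal.ofReal (s * (1 / p * Real.Gamma (1 / p)) *
          (t ^ ((1 - 1 / p) - 1) * Real.exp (-(s * t)))) := by
    intro t ht
    have ht : 0 < t := ht
    have := integral_rpow_mul_exp_neg_mul_rpow (p := p) (q := 0) hp0 (by norm_num) ht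
    simp only [Real.rpow_zero, one_mul, zero_add] at this
    refine setLIntegral_ofReal_of_integral_eq measurableSet_Ioi (fun u _ => by positivity) ?_
      (by positivity)
    rw [integral_const_mul, this, show (1 - 1 / p) - 1 = -1 / p by ring]
    ring
  rw [setLIntegral_congr_fun measurableSet_Ioi h2]
  have h3 := Real.integral_rpow_mul_exp_neg_mul_Ioi (sub_pos.2 hp1) hs
  refine setLIntegral_ofReal_of_integral_eq measurableSet_Ioi
    (fun t ht => ?_) ?_ ?_
  · have ht : 0 < t := ht
    positivity
  · rw [integral_const_mul, h3, add_comm 1, Real.Gamma_add_one hp2.ne', one_div s,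
      Real.inv_rpow hs.le, ← Real.rpow_neg hs.le]
    have : s ^ (1 / p) = s * s ^ (-(1 - 1 / p)) := by
      rw [← Real.rpow_one_add' hs.le (by ring_nf; positivity)]; congr 1; ring
    rw [this]; ring
  · rw [add_comm 1, Real.Gamma_add_one hp2.ne']; positivity

/-- The substitution `u = r² y ^ (-2/η)` carries `(0, 1)` onto `(r², ∞)` and turns the integrand
into the one of `pathF_eq_integral`, with `t = s r ^ (-η)`. -/
lemma lintegral_Ioi_sq_div_rpow_add {η r s : ℝ} (hη : 2 < η) (hr : 0 < r) (hs : 0 ≤ s) :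
    ∫⁻ u in Set.Ioi (r ^ 2), ENNReal.ofReal (s / (u ^ (η / 2) + s)) =
      ENNReal.ofReal (r ^ 2 * pathF (s * r ^ (-η)) η) := by
  have hη0 : 0 < η := by linarith
  have hη1 : 0 < 2 / η := by positivity
  have hη2 : 2 / η < 1 := by rw [div_lt_one hη0]; exact hη
  set t := s * r ^ (-η) with ht
  have ht0 : 0 ≤ t := mul_nonneg hs (Real.rpow_nonneg hr.le _)
  set f : ℝ → ℝ := fun y => r ^ 2 * y ^ (-(2 / η)) with hf
  set f' : ℝ → ℝ := fun y => r ^ 2 * (-(2 / η) * y ^ (-(2 / η) - 1)) with hf'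
  have himg : f '' Set.Ioo 0 1 = Set.Ioi (r ^ 2) := by
    ext u
    constructor
    · rintro ⟨y, hy, rfl⟩
      have := Real.one_lt_rpow_of_pos_of_lt_one_of_neg hy.1 hy.2 (neg_lt_zero.2 hη1)
      exact lt_mul_of_one_lt_right (by positivity) this
    · intro hu
      have hu : r ^ 2 < u := hu
      have hur : 1 < u / r ^ 2 := by rw [one_lt_div (by positivity)]; exact hu
      refine ⟨(u / r ^ 2) ^ (-(η / 2)), ⟨by positivity,
        Real.rpow_lt_one_of_one_lt_of_neg hur (by linarith)⟩, ?_⟩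
      simp only [hf]
      rw [← Real.rpow_mul (by positivity), show -(η / 2) * -(2 / η) = 1 by field_simp,
        Real.rpow_one]
      field_simp
  have hinj : Set.InjOn f (Set.Ioo 0 1) := by
    intro x hx y hy hxy
    have h1 : x ^ (-(2 / η)) = y ^ (-(2 / η)) := mul_left_cancel₀ (by positivity) hxy
    exact (Real.rpow_left_inj hx.1.le hy.1.le (by linarith)).1 h1
  have hder : ∀ y ∈ Set.Ioo (0 : ℝ) 1, HasDerivWithinAt f (f' y) (Set.Ioo 0 1) y := fun y hy =>
    ((Real.hasDerivAt_rpow_const (Or.inl hy.1.ne')).const_mul _).hasDerivWithinAt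
  rw [← himg, lintegral_image_eq_lintegral_abs_deriv_mul measurableSet_Ioo hder hinj]
  have hcongr : ∀ y ∈ Set.Ioo (0 : ℝ) 1, ENNReal.ofReal |f' y| *
      ENNReal.ofReal (s / (f y ^ (η / 2) + s)) =
      ENNReal.ofReal (r ^ 2 * (2 * t / η) * (y ^ (-(2 / η)) / (1 + t * y))) := by
    intro y hy
    have hy0 := hy.1
    rw [← ENNReal.ofReal_mul (abs_nonneg _)]
    congr 1
    have e1 : |f' y| = r ^ 2 * (2 / η * (y ^ (-(2 / η)) * y⁻¹)) := by
      simp only [hf']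
      rw [Real.rpow_sub_one hy0.ne', neg_mul, mul_neg, abs_neg, abs_of_nonneg (by positivity),
        div_eq_mul_inv (y ^ _)]
    have e2 : f y ^ (η / 2) = r ^ η * y⁻¹ := by
      simp only [hf]
      rw [Real.mul_rpow (by positivity) (by positivity), ← Real.rpow_mul hy0.le,
        ← Real.rpow_natCast r 2, ← Real.rpow_mul hr.le, ← Real.rpow_neg_one y]
      congr 2
      · push_cast; ring
      · field_simp
    have hrη : 0 < r ^ η := by positivity
    rw [e1, e2, ht, Real.rpow_neg hr.le]
    have h3 : 0 < r ^ η + s * y := by positivity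
    have h4 : 1 + s * (r ^ η)⁻¹ * y = (r ^ η + s * y) / r ^ η := by field_simp
    have h5 : r ^ η * y⁻¹ + s = (r ^ η + s * y) / y := by field_simp
    rw [h4, h5]
    field_simp
  rw [setLIntegral_congr_fun measurableSet_Ioo hcongr, pathF_eq_integral hη ht0]
  have hint := intervalIntegrable_rpow_div (b := 1 - 2 / η) (by linarith) ht0
  rw [show 1 - 2 / η - 1 = -(2 / η) by ring] at hint
  rw [← ofReal_integral_eq_lintegral_ofReal, integral_const_mul,
    intervalIntegral.integral_of_le zero_le_one, integral_Ioc_eq_integral_Ioo, mul_assoc]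
  · rw [intervalIntegrable_iff_integrableOn_Ioo_of_le zero_le_one] at hint
    exact hint.const_mul _
  · filter_upwards [ae_restrict_mem measurableSet_Ioo] with y hy
    have := hy.1
    simp only [Pi.zero_apply]
    positivity

/-! ### The functional of one node -/

/-- The Laplace transform at `s` of the power received over a Rayleigh-fading link of gain `c` from
a node that transmits with probability `p`. -/
def markLaplace (p : ℝ) (c : ℝ≥0∞) : ℝ≥0∞ :=
  ENNReal.ofReal (1 - p) + ENNReal.ofReal p * (1 + c)⁻¹

/-- The functional of the position of a node whose sum is minus the logarithm of the conditional
Laplace transform of the interference given the positions. -/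
def markFun (p η s : ℝ) (x : Plane) : ℝ≥0∞ :=
  negLog (markLaplace p (ENNReal.ofReal s * ENNReal.ofReal ‖x‖ ^ (-η)))

lemma markLaplace_le_one {p : ℝ} (hp : p ∈ Set.Icc (0 : ℝ) 1) (c : ℝ≥0∞) :
    markLaplace p c ≤ 1 := by
  have h1 : (1 + c)⁻¹ ≤ 1 := ENNReal.inv_le_one.2 le_self_add
  calc markLaplace p c ≤ ENNReal.ofReal (1 - p) + ENNReal.ofReal p * 1 := by
        unfold markLaplace; gcongr
    _ = 1 := by
        rw [mul_one, ← ENNReal.ofReal_add (by linarith [hp.2]) hp.1]; simp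

lemma markLaplace_antitone (p : ℝ) : Antitone (markLaplace p) := fun a b hab => by
  unfold markLaplace
  gcongr

lemma continuous_markLaplace (p : ℝ) : Continuous (markLaplace p) := by
  have h : Continuous fun c : ℝ≥0∞ => (1 + c)⁻¹ := by fun_prop
  exact continuous_const.add ((ENNReal.continuous_const_mul ENNReal.ofReal_ne_top).comp h)

lemma negExp_markFun {p : ℝ} (hp : p ∈ Set.Icc (0 : ℝ) 1) (η s : ℝ) (x : Plane) :
    negExp (markFun p η s x) =
      markLaplace p (ENNReal.ofReal s * ENNReal.ofReal ‖x‖ ^ (-η)) :=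
  negExp_negLog (markLaplace_le_one hp _)

lemma measurable_markFun (p η : ℝ) : Measurable fun q : ℝ × Plane => markFun p η q.1 q.2 := by
  refine measurable_negLog.comp ((continuous_markLaplace p).measurable.comp ?_)
  fun_prop

lemma markFun_mono (p η : ℝ) (x : Plane) : Monotone fun s => markFun p η s x := fun s t hst =>
  negLog_antitone (markLaplace_antitone p (by gcongr))

/-- Away from the origin the gain is finite. At the origin it is infinite, and multiplication by `∞`
is discontinuous at zero. -/
lemma continuous_markFun (p η : ℝ) {x : Plane} (hx : x ≠ 0) :
    Continuous fun s => markFun p η s x := by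
  refine continuous_negLog.comp ((continuous_markLaplace p).comp ?_)
  refine (ENNReal.continuous_mul_const ?_).comp ENNReal.continuous_ofReal
  have : 0 < ‖x‖ := norm_pos_iff.2 hx
  rw [ENNReal.ofReal_rpow_of_pos this]
  exact ENNReal.ofReal_ne_top

/-- With `c = s ‖x‖ ^ (-η)`, the complement of `(1 - p) + p / (1 + c)` is `p c / (1 + c)`. It is
written through `‖x‖²` so that `lintegral_normSq` applies. -/
lemma one_sub_negExp_markFun {p η s : ℝ} (hp : p ∈ Set.Icc (0 : ℝ) 1) (hs : 0 ≤ s) {x : Plane}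
    (hx : x ≠ 0) : 1 - negExp (markFun p η s x) =
      ENNReal.ofReal p * ENNReal.ofReal (s / ((‖x‖ ^ 2) ^ (η / 2) + s)) := by
  have hn : 0 < ‖x‖ := norm_pos_iff.2 hx
  have e : (‖x‖ ^ 2) ^ (η / 2) = ‖x‖ ^ η := by
    rw [← Real.rpow_natCast, ← Real.rpow_mul hn.le]; congr 1; push_cast; ring
  have hρ : 0 < ‖x‖ ^ η := by positivity
  rw [negExp_markFun hp, e, markLaplace, ENNReal.ofReal_rpow_of_pos hn, Real.rpow_neg hn.le,
    ← ENNReal.ofReal_mul hs, ← ENNReal.ofReal_one, ← ENNReal.ofReal_add zero_le_one (by positivity),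
    ← ENNReal.ofReal_inv_of_pos (by positivity), ← ENNReal.ofReal_mul hp.1,
    ← ENNReal.ofReal_add (by linarith [hp.2]) (mul_nonneg hp.1 (by positivity)),
    ← ENNReal.ofReal_sub _ (add_nonneg (by linarith [hp.2]) (mul_nonneg hp.1 (by positivity))),
    ← ENNReal.ofReal_mul hp.1]
  congr 1
  have : ‖x‖ ^ η + s ≠ 0 := by positivity
  have h1 : 1 + s * (‖x‖ ^ η)⁻¹ = (‖x‖ ^ η + s) / ‖x‖ ^ η := by field_simp
  rw [h1, inv_div]
  field_simp; ring

lemma lintegral_markFun {p η s l : ℝ} (hp : p ∈ Set.Icc (0 : ℝ) 1) (hη : 2 < η) (hs : 0 ≤ s)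
    (hl : 0 ≤ l) :
    ∫⁻ x, (1 - negExp (markFun p η s x)) ∂(ENNReal.ofReal l • (volume : Measure Plane)) =
      ENNReal.ofReal (Real.pi * p * l * s ^ (2 / η) * Real.Gamma (1 + 2 / η) *
        Real.Gamma (1 - 2 / η)) := by
  have h0 : ∀ᵐ x : Plane, x ≠ 0 := by
    rw [ae_iff]; simp
  rw [lintegral_smul_measure, lintegral_congr_ae (h0.mono fun x hx =>
    one_sub_negExp_markFun hp hs hx), lintegral_const_mul _ (by fun_prop),
    lintegral_normSq (F := fun u => ENNReal.ofReal (s / (u ^ (η / 2) + s))) (by fun_prop),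
    lintegral_Ioi_div_rpow_add (by linarith) hs, smul_eq_mul, one_div_div,
    ← ENNReal.ofReal_mul Real.pi_pos.le, ← ENNReal.ofReal_mul hp.1, ← ENNReal.ofReal_mul hl]
  congr 1; ring

lemma lintegral_markFun_beyond {p η s l r : ℝ} (hp : p ∈ Set.Icc (0 : ℝ) 1) (hη : 2 < η)
    (hs : 0 ≤ s) (hl : 0 ≤ l) (hr : 0 < r) :
    ∫⁻ x, (1 - negExp (if r < ‖x‖ then markFun p η s x else 0))
        ∂(ENNReal.ofReal l • (volume : Measure Plane)) =
      ENNReal.ofReal (Real.pi * p * l * r ^ 2 * pathF (s * r ^ (-η)) η) := by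
  have h0 : ∀ x : Plane, 1 - negExp (if r < ‖x‖ then markFun p η s x else 0) =
      ENNReal.ofReal p * (Set.Ioi (r ^ 2)).indicator
        (fun u => ENNReal.ofReal (s / (u ^ (η / 2) + s))) (‖x‖ ^ 2) := by
    intro x
    split_ifs with h
    · rw [Set.indicator_of_mem (by rw [Set.mem_Ioi]; gcongr), one_sub_negExp_markFun hp hs]
      rintro rfl
      rw [norm_zero] at h; linarith
    · rw [Set.indicator_of_notMem (by
        rw [Set.mem_Ioi, not_lt]; exact pow_le_pow_left₀ (norm_nonneg _) (not_lt.1 h) 2)]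
      simp [negExp_zero]
  have hm : Measurable fun u => ENNReal.ofReal (s / (u ^ (η / 2) + s)) := by fun_prop
  have hmn : Measurable fun x : Plane => (Set.Ioi (r ^ 2)).indicator
      (fun u => ENNReal.ofReal (s / (u ^ (η / 2) + s))) (‖x‖ ^ 2) :=
    (hm.indicator measurableSet_Ioi).comp measurable_normSq
  have hI : Set.Ioi (r ^ 2) ∩ Set.Ioi 0 = Set.Ioi (r ^ 2) :=
    Set.inter_eq_left.2 (Set.Ioi_subset_Ioi (sq_nonneg r))
  rw [lintegral_smul_measure, lintegral_congr h0, lintegral_const_mul _ hmn,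
    lintegral_normSq (hm.indicator measurableSet_Ioi), setLIntegral_indicator measurableSet_Ioi,
    hI, lintegral_Ioi_sq_div_rpow_add hη hr hs, smul_eq_mul,
    ← ENNReal.ofReal_mul Real.pi_pos.le, ← ENNReal.ofReal_mul hp.1, ← ENNReal.ofReal_mul hl]
  congr 1; ring

/-! ### Partial fractions -/

/-- The coefficient of `exp (-x j t)` in the tail of a sum of independent variables, the `i`-th of
which is exponential of rate `x i` with probability `p i`, and `0` otherwise. -/
def tailCoeff {ι : Type*} [DecidableEq ι] (x p : ι → ℝ) (T : Finset ι) (j : ι) : ℝ :=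
  p j * ∏ l ∈ T.erase j, (x l - (1 - p l) * x j) / (x l - x j)

section

variable {ι : Type*} [DecidableEq ι] {x p : ι → ℝ}

lemma tailCoeff_insert_of_mem {T : Finset ι} {k j : ι} (hk : k ∉ T) (hj : j ∈ T) :
    tailCoeff x p (insert k T) j =
      tailCoeff x p T j * ((x k - (1 - p k) * x j) / (x k - x j)) := by
  have hkj : k ≠ j := fun h => hk (h ▸ hj)
  rw [tailCoeff, tailCoeff, Finset.erase_insert_of_ne hkj, Finset.prod_insert (fun h =>
    hk (Finset.mem_of_mem_erase h))]
  ring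

lemma tailCoeff_insert_self {T : Finset ι} {k : ι} (hk : k ∉ T) :
    tailCoeff x p (insert k T) k =
      p k * ∏ l ∈ T, (x l - (1 - p l) * x k) / (x l - x k) := by
  rw [tailCoeff, Finset.erase_insert hk]

/-- Each factor on the right is the Laplace transform `q + p x / (x + s)` of one summand; the left
side is `1 - s` times the Laplace transform of the tail. The identity is purely algebraic and is
proved for all `s` away from the poles, because the induction evaluates it at negative arguments. -/
lemma one_sub_mul_sum_tailCoeff (hx : Function.Injective x) (T : Finset ι) :
    ∀ s : ℝ, (∀ i ∈ T, s + x i ≠ 0) → 1 - s * ∑ j ∈ T, tailCoeff x p T j / (s + x j) =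
      ∏ i ∈ T, (x i + (1 - p i) * s) / (x i + s) := by
  induction T using Finset.induction_on with
  | empty => simp
  | insert k T hk ih =>
    intro s hs
    -- The induction hypothesis at `s = -x k` supplies the coefficient of the new pole.
    have hk' : ∏ l ∈ T, (x l - (1 - p l) * x k) / (x l - x k) =
        1 + x k * ∑ j ∈ T, tailCoeff x p T j / (x j - x k) := by
      have hne : ∀ i ∈ T, -x k + x i ≠ 0 := fun i hi h =>
        hk (by have := hx (by linarith : x i = x k); exact this ▸ hi)
      have := ih (-x k) hne
      simp only [neg_mul, mul_neg, sub_neg_eq_add, ← sub_eq_add_neg] at this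
      rw [← this]
      congr 2
      exact Finset.sum_congr rfl fun j _ => by rw [neg_add_eq_sub]
    have hsT : ∀ i ∈ T, s + x i ≠ 0 := fun i hi => hs i (Finset.mem_insert_of_mem hi)
    have hsk : s + x k ≠ 0 := hs k (Finset.mem_insert_self _ _)
    rw [Finset.prod_insert hk, ← ih s hsT, Finset.sum_insert hk, tailCoeff_insert_self hk, hk']
    have hsum : ∑ j ∈ T, tailCoeff x p (insert k T) j / (s + x j) =
        (1 - p k) * (∑ j ∈ T, tailCoeff x p T j / (s + x j)) + p k * x k / (s + x k) *
          (∑ j ∈ T, tailCoeff x p T j / (s + x j) - ∑ j ∈ T, tailCoeff x p T j / (x j - x k)) := by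
      rw [← Finset.sum_sub_distrib, Finset.mul_sum, Finset.mul_sum, ← Finset.sum_add_distrib]
      refine Finset.sum_congr rfl fun j hj => ?_
      have h1 : s + x j ≠ 0 := hsT j hj
      have h2 : x k - x j ≠ 0 := fun h => hk (by
        have := hx (sub_eq_zero.1 h); exact this ▸ hj)
      have h3 : x j - x k ≠ 0 := fun h => h2 (by linarith)
      rw [tailCoeff_insert_of_mem hk hj]
      have e : x j - x k = -(x k - x j) := by ring
      rw [e]
      field_simp
      ring
    rw [hsum, add_comm (x k) s]
    field_simp
    ring

/-- The coefficient of the new exponential in the form in which convolution with the `k`-th summand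
produces it. -/
lemma tailCoeff_insert_self' (hx : Function.Injective x) {T : Finset ι} {k : ι} (hk : k ∉ T) :
    tailCoeff x p (insert k T) k = p k * (1 - x k * ∑ j ∈ T, tailCoeff x p T j / (x k - x j)) := by
  have hne : ∀ i ∈ T, -x k + x i ≠ 0 := fun i hi h =>
    hk (by have := hx (by linarith : x i = x k); exact this ▸ hi)
  have := one_sub_mul_sum_tailCoeff (p := p) hx T (-x k) hne
  simp only [mul_neg, ← sub_eq_add_neg] at this
  rw [tailCoeff_insert_self hk, ← this, neg_mul_comm, ← Finset.sum_neg_distrib]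
  congr 3
  exact Finset.sum_congr rfl fun j _ => by rw [← div_neg, neg_add', neg_neg]

end

lemma prod_sub_eq_sum_alphaCoeff {K : ℕ} (y : Fin K → ℝ) (z : ℝ) :
    ∏ l, (y l - z) = ∑ i ∈ Finset.range (K + 1), alphaCoeff y i * z ^ i := by
  simp_rw [sub_eq_add_neg]
  rw [Finset.prod_add, Finset.sum_powerset, Finset.card_univ, Fintype.card_fin,
    ← Finset.sum_flip]
  refine Finset.sum_congr rfl fun i hi => ?_
  have hi : i ≤ K := Nat.lt_succ_iff.1 (Finset.mem_range.1 hi)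
  rw [alphaCoeff, mul_assoc, mul_comm (Finset.sum _ _), ← mul_assoc, Finset.mul_sum]
  refine Finset.sum_congr rfl fun s hs => ?_
  rw [Finset.prod_const, Finset.card_sdiff_of_subset (Finset.subset_univ s),
    (Finset.mem_powersetCard.1 hs).2, Finset.card_univ, Fintype.card_fin, Nat.sub_sub_self hi,
    neg_pow]
  ring

namespace NetParams

variable {K M : ℕ} (p : NetParams K M)

lemma qIn_pos (i : Fin K) : 0 < p.qIn i := sub_pos.2 (p.pIn_mem i).2

variable [NeZero K]

/-- The coefficients of the closed form are those of the tail of the useful power. -/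
lemma G_mul_coeff {d : Fin K → ℝ} (hd : ∀ i, 0 < d i) (hinj : Function.Injective d) (j : Fin K) :
    p.G * p.coeff d j = tailCoeff (fun i => d i ^ p.η) p.pIn Finset.univ j := by
  have hη : 0 < p.η := by linarith [p.two_lt_η]
  have hD : 0 < d (lastIdx K) ^ p.η := Real.rpow_pos_of_pos (hd _) _
  have hw : ∀ i, p.omegaPow d i = d i ^ p.η / d (lastIdx K) ^ p.η := fun i =>
    Real.div_rpow (hd i).le (hd _).le _
  have hwpos : 0 < p.omegaPow d j := by
    rw [hw]; exact div_pos (Real.rpow_pos_of_pos (hd j) _) hD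
  have hne : ∀ l ∈ Finset.univ.erase j, d l ^ p.η - d j ^ p.η ≠ 0 := by
    intro l hl h
    refine (Finset.mem_erase.1 hl).1 (hinj ?_)
    exact (Real.rpow_left_inj (hd l).le (hd j).le hη.ne').1 (sub_eq_zero.1 h)
  -- The two coefficient families are those of `∏ (ω_l ^ η / q_l - z)` and `∏ (ω_l ^ η - z)`. The
  -- top coefficients agree, so stopping before degree `K` loses nothing, and the second polynomial
  -- vanishes at `z = ω_j ^ η`.
  have hnum : ∑ i ∈ Finset.range K, (alphaCoeff (fun l => p.omegaPow d l / p.qIn l) i -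
      alphaCoeff (p.omegaPow d) i) * p.omegaPow d j ^ i =
      ∏ l, (p.omegaPow d l / p.qIn l - p.omegaPow d j) := by
    have h1 := prod_sub_eq_sum_alphaCoeff (fun l => p.omegaPow d l / p.qIn l) (p.omegaPow d j)
    have h2 := prod_sub_eq_sum_alphaCoeff (p.omegaPow d) (p.omegaPow d j)
    rw [Finset.prod_eq_zero (Finset.mem_univ j) (sub_self _)] at h2
    have h3 : ∀ y : Fin K → ℝ, alphaCoeff y K = (-1) ^ K := by intro y; simp [alphaCoeff]
    rw [Finset.sum_range_succ, h3] at h1 h2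
    simp_rw [sub_mul]
    rw [Finset.sum_sub_distrib, h1]
    linarith
  have hG : p.G * ∏ l, (p.omegaPow d l / p.qIn l - p.omegaPow d j) =
      ∏ l, (p.omegaPow d l - p.qIn l * p.omegaPow d j) := by
    rw [G, ← Finset.prod_mul_distrib]
    refine Finset.prod_congr rfl fun l _ => ?_
    have := (p.qIn_pos l).ne'
    field_simp
  -- The factor `l = j` gives `(1 - q_j) ω_j ^ η / ω_j ^ η = p_j`; in the other factors the
  -- normalization by `d_K ^ η` cancels.
  rw [coeff, hnum, ← mul_div_assoc, hG, ← Finset.mul_prod_erase _ _ (Finset.mem_univ j),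
    mul_div_mul_comm, tailCoeff, ← Finset.prod_div_distrib]
  congr 1
  · rw [qIn]; field_simp; ring
  · refine Finset.prod_congr rfl fun l hl => ?_
    have := hne l hl
    rw [hw, hw, mul_div_assoc', div_sub_div_same, div_sub_div_same,
      div_div_div_cancel_right₀ hD.ne', qIn]

end NetParams

/-! ### Independence and exponential variables -/

lemma lintegral_expMeasure_one {f : ℝ → ℝ≥0∞} (hf : Measurable f) :
    ∫⁻ h, f h ∂(expMeasure 1) = ∫⁻ h in Set.Ioi 0, ENNReal.ofReal (Real.exp (-h)) * f h := by
  rw [expMeasure, gammaMeasure, lintegral_withDensity_eq_lintegral_mul _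
    (show Measurable (gammaPDF 1 1) from (measurable_gammaPDFReal 1 1).ennreal_ofReal) hf, ← lintegral_indicator measurableSet_Ioi]
  refine lintegral_congr_ae ?_
  have h0 : ∀ᵐ h : ℝ, h ≠ 0 := by rw [ae_iff]; simp
  filter_upwards [h0] with h hh
  rcases hh.lt_or_gt with h1 | h1
  · rw [Set.indicator_of_notMem (by simpa using h1.le), Pi.mul_apply, gammaPDF_of_neg h1, zero_mul]
  · rw [Set.indicator_of_mem (by simpa using h1), Pi.mul_apply, gammaPDF_of_nonneg h1.le]
    simp

namespace ProbabilityTheory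

variable {Ω : Type*} [MeasurableSpace Ω] {μ : Measure Ω} [IsProbabilityMeasure μ]

lemma IndepFun.lintegral_comp {α β : Type*} [MeasurableSpace α] [MeasurableSpace β] {A : Ω → α}
    {B : Ω → β} (h : IndepFun A B μ) (hA : Measurable A) (hB : Measurable B)
    {Φ : α → β → ℝ≥0∞} (hΦ : Measurable (Function.uncurry Φ)) :
    ∫⁻ ω, Φ (A ω) (B ω) ∂μ = ∫⁻ ω, ∫⁻ ω', Φ (A ω) (B ω') ∂μ ∂μ := by
  have e1 : ∫⁻ ω, Φ (A ω) (B ω) ∂μ =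
      ∫⁻ q, Function.uncurry Φ q ∂(μ.map fun ω => (A ω, B ω)) := by
    rw [lintegral_map hΦ (hA.prodMk hB)]; rfl
  have : IsProbabilityMeasure (μ.map B) := Measure.isProbabilityMeasure_map hB.aemeasurable
  rw [e1, (indepFun_iff_map_prod_eq_prod_map_map hA.aemeasurable hB.aemeasurable).1 h,
    lintegral_prod _ hΦ.aemeasurable, lintegral_map (hΦ.lintegral_prod_right') hA]
  refine lintegral_congr fun ω => ?_
  rw [lintegral_map (f := fun y => Function.uncurry Φ (A ω, y))
    (hΦ.comp measurable_prodMk_left) hB]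
  rfl

/-- Integration with respect to an exponential fading power and a transmission indicator. -/
lemma IndepFun.lintegral_fade_act {H : Ω → ℝ} {A : Ω → Bool} {p : ℝ} (h : IndepFun H A μ)
    (hH : Measurable H) (hA : Measurable A) (hlaw : μ.map H = expMeasure 1)
    (hp : μ.real {ω | A ω = true} = p) {Φ : ℝ → Bool → ℝ≥0∞} (hΦ : ∀ b, Measurable fun h => Φ h b) :
    ∫⁻ ω, Φ (H ω) (A ω) ∂μ =
      ENNReal.ofReal (1 - p) * (∫⁻ h, Φ h false ∂(expMeasure 1)) +
        ENNReal.ofReal p * (∫⁻ h, Φ h true ∂(expMeasure 1)) := by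
  have hΦm : Measurable (Function.uncurry fun (b : Bool) (h : ℝ) => Φ h b) :=
    measurable_from_prod_countable_right hΦ
  rw [h.symm.lintegral_comp hA hH (Φ := fun b h => Φ h b) hΦm]
  have e : ∀ ω, ∫⁻ ω', Φ (H ω') (A ω) ∂μ = ∫⁻ h, Φ h (A ω) ∂(expMeasure 1) := fun ω => by
    rw [← hlaw, lintegral_map (hΦ _) hH]
  simp_rw [e]
  have hm : MeasurableSet {ω | A ω = true} := hA (measurableSet_singleton true)
  rw [← lintegral_add_compl _ hm, add_comm]
  have e1 : ∫⁻ ω in {ω | A ω = true}, (∫⁻ h, Φ h (A ω) ∂(expMeasure 1)) ∂μ =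
      ENNReal.ofReal p * (∫⁻ h, Φ h true ∂(expMeasure 1)) := by
    rw [setLIntegral_congr_fun (g := fun _ => ∫⁻ h, Φ h true ∂(expMeasure 1)) hm
      (fun ω hω => by simp only [show A ω = true from hω]), setLIntegral_const, mul_comm, ← hp,
      measureReal_def, ENNReal.ofReal_toReal (measure_ne_top _ _)]
  have e2 : ∫⁻ ω in {ω | A ω = true}ᶜ, (∫⁻ h, Φ h (A ω) ∂(expMeasure 1)) ∂μ =
      ENNReal.ofReal (1 - p) * (∫⁻ h, Φ h false ∂(expMeasure 1)) := by
    rw [setLIntegral_congr_fun (g := fun _ => ∫⁻ h, Φ h false ∂(expMeasure 1)) hm.compl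
      (fun ω hω => by
        have : A ω = false := by simpa using hω
        simp only [this]), setLIntegral_const, mul_comm, ← hp, ← probReal_compl_eq_one_sub hm,
      measureReal_def, ENNReal.ofReal_toReal (measure_ne_top _ _)]
  rw [e1, e2]

end ProbabilityTheory

/-! ### The tail of the useful power -/

lemma ae_pos_of_map_eq_expMeasure {Ω : Type*} [MeasurableSpace Ω] {μ : Measure Ω} {H : Ω → ℝ} (hH : Measurable H)
    (hlaw : μ.map H = expMeasure 1) : ∀ᵐ ω ∂μ, 0 < H ω := by
  have : ∫⁻ h, (Set.Iic (0 : ℝ)).indicator 1 h ∂(expMeasure 1) = 0 := by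
    rw [lintegral_expMeasure_one (measurable_one.indicator measurableSet_Iic)]
    rw [setLIntegral_congr_fun (g := 0) measurableSet_Ioi]
    · simp
    · intro h hh
      simp [show ¬ h ≤ 0 from not_le.2 hh]
  rw [lintegral_indicator_one measurableSet_Iic, ← hlaw, Measure.map_apply hH measurableSet_Iic]
    at this
  filter_upwards [measure_eq_zero_iff_ae_notMem.1 this] with ω hω
  exact not_le.1 hω

section

variable {Ω : Type*} [MeasurableSpace Ω] {μ : Measure Ω} [IsProbabilityMeasure μ] {ι : Type*}
  [DecidableEq ι] {H : ι → Ω → ℝ} {A : ι → Ω → Bool} {x p : ι → ℝ}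

/-- The convolution of two exponentials. Distinct rates are what keep polynomial factors out of the
tail formula. -/
lemma integral_exp_mul_exp_sub {a b t : ℝ} (ha : 0 < a) (hab : a ≠ b) :
    ∫ h in (0 : ℝ)..(a * t), Real.exp (-h) * Real.exp (-b * (t - h / a)) =
      a / (a - b) * (Real.exp (-b * t) - Real.exp (-a * t)) := by
  have hne : a - b ≠ 0 := sub_ne_zero.2 hab
  have hder : ∀ h ∈ Set.uIcc 0 (a * t), HasDerivAt
      (fun h => -(a / (a - b)) * (Real.exp (-h) * Real.exp (-b * (t - h / a))))
      (Real.exp (-h) * Real.exp (-b * (t - h / a))) h := by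
    intro h _
    have h1 : HasDerivAt (fun h => Real.exp (-h)) (Real.exp (-h) * -1) h :=
      (hasDerivAt_neg h).exp
    have h2 : HasDerivAt (fun h => Real.exp (-b * (t - h / a)))
        (Real.exp (-b * (t - h / a)) * (-b * (0 - 1 / a))) h :=
      ((((hasDerivAt_const h t).sub ((hasDerivAt_id h).div_const a))).const_mul (-b)).exp
    refine ((h1.fun_mul h2).const_mul (-(a / (a - b)))).congr_deriv ?_
    field_simp
    ring
  rw [intervalIntegral.integral_eq_sub_of_hasDerivAt hder
    (Continuous.intervalIntegrable (by fun_prop) _ _)]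
  have : a * t / a = t := by field_simp
  rw [this]
  simp
  ring

/-- The tail of a finite sum of independent variables `1_i H_i / x_i`. -/
theorem measureReal_lt_sum_eq_sum_tailCoeff
    (hind : iIndepFun (fun i ω => (H i ω, A i ω)) μ) (hHA : ∀ i, IndepFun (H i) (A i) μ)
    (hH : ∀ i, Measurable (H i)) (hA : ∀ i, Measurable (A i))
    (hlaw : ∀ i, μ.map (H i) = expMeasure 1) (hp : ∀ i, μ.real {ω | A i ω = true} = p i)
    (hx : ∀ i, 0 < x i) (hinj : Function.Injective x) (T : Finset ι) :
    ∀ t : ℝ, 0 ≤ t → μ.real {ω | t < ∑ i ∈ T, if A i ω then H i ω / x i else 0} =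
      ∑ j ∈ T, tailCoeff x p T j * Real.exp (-x j * t) := by
  set Y : ι → Ω → ℝ := fun i ω => if A i ω then H i ω / x i else 0 with hY
  have hYm : ∀ i, Measurable (Y i) := fun i =>
    Measurable.ite (hA i (measurableSet_singleton true)) ((hH i).div_const _) measurable_const
  have hYind : iIndepFun Y μ := by
    refine hind.comp (fun i (q : ℝ × Bool) => if q.2 then q.1 / x i else 0) (fun i => ?_)
    exact Measurable.ite (measurable_snd (measurableSet_singleton true))
      (measurable_fst.div_const _) measurable_const
  have hY0 : ∀ i, ∀ᵐ ω ∂μ, 0 ≤ Y i ω := by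
    intro i
    filter_upwards [ae_pos_of_map_eq_expMeasure (hH i) (hlaw i)] with ω hω
    simp only [hY]
    split_ifs
    · exact (div_pos hω (hx i)).le
    · exact le_rfl
  induction T using Finset.induction_on with
  | empty => intro t ht; simp [not_lt.2 ht]
  | insert k T hk ih =>
    intro t ht
    set S : Ω → ℝ := fun ω => ∑ i ∈ T, Y i ω with hS
    have hSm : Measurable S := Finset.measurable_sum _ fun i _ => hYm i
    have hSY : IndepFun (Y k) S μ := by
      have := (hYind.indepFun_finsetSum_of_notMem hYm hk).symm
      convert this using 1
      ext ω; simp [hS]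
    set V : ℝ → ℝ≥0∞ := fun u => μ {ω | u < S ω} with hV
    have hVm : Measurable V := Antitone.measurable fun a b hab =>
      measure_mono fun ω (hω : b < S ω) => hab.trans_lt hω
    set G : ℝ → ℝ := fun u => ∑ j ∈ T, tailCoeff x p T j * Real.exp (-x j * u) with hG
    have hVG : ∀ u, 0 ≤ u → V u = ENNReal.ofReal (G u) := fun u hu => by
      simp only [hG, ← ih u hu]
      rw [measureReal_def, ENNReal.ofReal_toReal (measure_ne_top _ _)]
    have hG0 : ∀ u, 0 ≤ u → 0 ≤ G u := fun u hu => by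
      simp only [hG, ← ih u hu]; exact measureReal_nonneg
    have hV1 : ∀ u, u < 0 → V u = 1 := by
      intro u hu
      refine (prob_compl_eq_zero_iff (hSm measurableSet_Ioi)).1 ?_
      have : ∀ᵐ ω ∂μ, ∀ i ∈ T, 0 ≤ Y i ω := (ae_ball_iff T.countable_toSet).2 fun i _ => hY0 i
      rw [measure_eq_zero_iff_ae_notMem]
      filter_upwards [this] with ω hω hω'
      exact hω' (hu.trans_le (Finset.sum_nonneg hω))
    -- Condition on the new summand: with probability `1 - p k` it is zero, otherwise it is `h / x
    -- k` with `h` a unit exponential, leaving the threshold `t - h / x k` for the others.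
    have hstep : μ {ω | t < ∑ i ∈ insert k T, Y i ω} = ENNReal.ofReal (1 - p k) * V t +
        ENNReal.ofReal (p k) * ∫⁻ h in Set.Ioi 0, ENNReal.ofReal (Real.exp (-h)) * V (t - h / x k) := by
      have hset : MeasurableSet {ω | t < ∑ i ∈ insert k T, Y i ω} :=
        measurableSet_lt measurable_const (Finset.measurable_sum _ fun i _ => hYm i)
      have e1 := hSY.lintegral_comp (hYm k) hSm
        (Φ := fun y s => (Set.Ioi t).indicator 1 (y + s))
        ((measurable_one.indicator measurableSet_Ioi).comp measurable_add)
      have e2 : ∀ y, ∫⁻ ω, (Set.Ioi t).indicator 1 (y + S ω) ∂μ = V (t - y) := by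
        intro y
        have hm : MeasurableSet {ω | t - y < S ω} := hSm measurableSet_Ioi
        simp only [hV]
        rw [← lintegral_indicator_one hm]
        refine lintegral_congr fun ω => ?_
        simp [Set.indicator_apply, sub_lt_iff_lt_add']
      simp_rw [e2] at e1
      have e3 := (hHA k).lintegral_fade_act (hH k) (hA k) (hlaw k) (hp k)
        (Φ := fun h b => V (t - if b then h / x k else 0)) (fun b => hVm.comp (by
          cases b
          · simp
          · simp only [if_true]; fun_prop))
      have e4 : ∫⁻ ω, (Set.Ioi t).indicator 1 (Y k ω + S ω) ∂μ =
          μ {ω | t < ∑ i ∈ insert k T, Y i ω} := by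
        rw [← lintegral_indicator_one hset]
        refine lintegral_congr fun ω => ?_
        simp [Set.indicator_apply, Finset.sum_insert hk, hS]
      rw [← e4, e1]
      refine e3.trans ?_
      have hVk : Measurable fun h => V (t - h / x k) := hVm.comp (by fun_prop)
      simp only [Bool.false_eq_true, if_false, if_true, sub_zero, lintegral_const]
      rw [lintegral_expMeasure_one hVk]
      have : IsProbabilityMeasure (expMeasure 1) := isProbabilityMeasure_expMeasure one_pos
      simp
    have hxt : 0 ≤ x k * t := mul_nonneg (hx k).le ht
    have harg : ∀ h, h ≤ x k * t → 0 ≤ t - h / x k := fun h hh => by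
      rw [sub_nonneg, div_le_iff₀ (hx k), mul_comm]; exact hh
    have hint : ∫ h in (0 : ℝ)..(x k * t), Real.exp (-h) * G (t - h / x k) =
        ∑ j ∈ T, tailCoeff x p T j *
          (x k / (x k - x j) * (Real.exp (-x j * t) - Real.exp (-x k * t))) := by
      simp only [hG, Finset.mul_sum]
      rw [intervalIntegral.integral_finsetSum]
      · refine Finset.sum_congr rfl fun j hj => ?_
        rw [← integral_exp_mul_exp_sub (hx k) (fun h => hk (hinj h ▸ hj)),
          ← intervalIntegral.integral_const_mul]
        congr 1; ext h; ring
      · intro j _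
        exact Continuous.intervalIntegrable (by fun_prop) _ _
    have hnn : 0 ≤ ∑ j ∈ T, tailCoeff x p T j *
          (x k / (x k - x j) * (Real.exp (-x j * t) - Real.exp (-x k * t))) := by
      rw [← hint]
      exact intervalIntegral.integral_nonneg hxt fun h hh =>
        mul_nonneg (Real.exp_pos _).le (hG0 _ (harg h hh.2))
    -- For `h ≤ x k * t` the remaining threshold is nonnegative, so the induction hypothesis
    -- applies.
    have hmain : ∫⁻ h in Set.Ioc 0 (x k * t), ENNReal.ofReal (Real.exp (-h)) * V (t - h / x k) =
        ENNReal.ofReal (∑ j ∈ T, tailCoeff x p T j *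
          (x k / (x k - x j) * (Real.exp (-x j * t) - Real.exp (-x k * t)))) := by
      rw [setLIntegral_congr_fun (g := fun h => ENNReal.ofReal (Real.exp (-h) * G (t - h / x k)))
        measurableSet_Ioc (fun h hh => by
          simp only [hVG _ (harg h hh.2)]; rw [ENNReal.ofReal_mul (Real.exp_pos _).le])]
      rw [← ofReal_integral_eq_lintegral_ofReal, ← intervalIntegral.integral_of_le hxt, hint]
      · refine Continuous.integrableOn_Ioc ?_
        simp only [hG]; fun_prop
      · filter_upwards [ae_restrict_mem measurableSet_Ioc] with h hh
        exact mul_nonneg (Real.exp_pos _).le (hG0 _ (harg h hh.2))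
    -- For larger `h` the threshold is negative and is exceeded almost surely.
    have htail : ∫⁻ h in Set.Ioi (x k * t), ENNReal.ofReal (Real.exp (-h)) * V (t - h / x k) =
        ENNReal.ofReal (Real.exp (-x k * t)) := by
      rw [setLIntegral_congr_fun (g := fun h => ENNReal.ofReal (Real.exp (-h))) measurableSet_Ioi
        (fun h hh => by
          have : t - h / x k < 0 := by
            rw [sub_neg, lt_div_iff₀ (hx k), mul_comm]; exact hh
          simp only [hV1 _ this, mul_one])]
      refine setLIntegral_ofReal_of_integral_eq measurableSet_Ioi (fun h _ => (Real.exp_pos _).le)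
        ?_ (Real.exp_pos _).ne'
      rw [integral_exp_neg_Ioi, neg_mul]
    have hpk : 0 ≤ p k ∧ p k ≤ 1 := by rw [← hp k]; exact ⟨measureReal_nonneg, measureReal_le_one⟩
    rw [measureReal_def, hstep, ← Set.Ioc_union_Ioi_eq_Ioi hxt, lintegral_union measurableSet_Ioi
      (Set.Ioc_disjoint_Ioi le_rfl), hmain, htail, hVG t ht,
      ← ENNReal.ofReal_add hnn (Real.exp_pos _).le, ← ENNReal.ofReal_mul (by linarith),
      ← ENNReal.ofReal_mul hpk.1, ← ENNReal.ofReal_add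
        (mul_nonneg (by linarith) (hG0 t ht)) (mul_nonneg hpk.1 (add_nonneg hnn (Real.exp_pos _).le)),
      ENNReal.toReal_ofReal (add_nonneg (mul_nonneg (by linarith) (hG0 t ht))
        (mul_nonneg hpk.1 (add_nonneg hnn (Real.exp_pos _).le))), Finset.sum_insert hk,
      tailCoeff_insert_self' hinj hk]
    have hins : ∑ j ∈ T, tailCoeff x p (insert k T) j * Real.exp (-x j * t) =
        (1 - p k) * G t + p k * ∑ j ∈ T, tailCoeff x p T j *
          (x k / (x k - x j) * Real.exp (-x j * t)) := by
      simp only [hG]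
      rw [Finset.mul_sum, Finset.mul_sum, ← Finset.sum_add_distrib]
      refine Finset.sum_congr rfl fun j hj => ?_
      have h2 : x k - x j ≠ 0 := fun h => hk (by
        have := hinj (sub_eq_zero.1 h); exact this ▸ hj)
      rw [tailCoeff_insert_of_mem hk hj]
      field_simp
      ring
    have hsub : ∑ j ∈ T, tailCoeff x p T j *
        (x k / (x k - x j) * (Real.exp (-x j * t) - Real.exp (-x k * t))) =
        ∑ j ∈ T, tailCoeff x p T j * (x k / (x k - x j) * Real.exp (-x j * t)) -
          x k * (∑ j ∈ T, tailCoeff x p T j / (x k - x j)) * Real.exp (-x k * t) := by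
      rw [Finset.mul_sum, Finset.sum_mul, ← Finset.sum_sub_distrib]
      exact Finset.sum_congr rfl fun j _ => by ring
    rw [hins, hsub]
    ring

end

/-! ### Families of independent variables -/

namespace ProbabilityTheory

variable {Ω : Type*} [MeasurableSpace Ω] {μ : Measure Ω}

/-- If two independent families are each independent, then so is the family of pairs. -/
lemma iIndepFun.prodMk_of_indepFun {ι α β : Type*} [MeasurableSpace α] [MeasurableSpace β]
    {F : ι → Ω → α} {A : ι → Ω → β} (hF : iIndepFun F μ) (hA : iIndepFun A μ)
    (hFm : ∀ i, Measurable (F i)) (hAm : ∀ i, Measurable (A i))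
    (h : IndepFun (fun ω i => F i ω) (fun ω i => A i ω) μ) :
    iIndepFun (fun i ω => (F i ω, A i ω)) μ := by
  rw [iIndepFun_iff_iIndep]
  -- Independence of the pairs is tested on the π-system of preimages of rectangles, where an
  -- intersection splits into an event of the first family and one of the second.
  refine iIndepSets.iIndep (fun i => ((hFm i).prodMk (hAm i)).comap_le)
    (fun i => {s | ∃ t ∈ Set.image2 (fun (x1 : Set α) (x2 : Set β) => x1 ×ˢ x2)
      {s | MeasurableSet s} {t | MeasurableSet t}, (fun ω => (F i ω, A i ω)) ⁻¹' t = s})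
    (fun i => isPiSystem_prod.comap _) (fun i => ?_) ?_
  · rw [← generateFrom_prod, MeasurableSpace.comap_generateFrom]; rfl
  · rw [iIndepSets_iff]
    intro s f hf
    have hf' : ∀ i ∈ s, ∃ (B : Set α) (C : Set β), MeasurableSet B ∧ MeasurableSet C ∧
        f i = F i ⁻¹' B ∩ A i ⁻¹' C := by
      intro i hi
      obtain ⟨t, ⟨B, hB, C, hC, rfl⟩, ht⟩ := hf i hi
      exact ⟨B, C, hB, hC, ht.symm⟩
    choose! B C hB hC hBC using hf'
    have e1 : ⋂ i ∈ s, f i = (⋂ i ∈ s, F i ⁻¹' B i) ∩ ⋂ i ∈ s, A i ⁻¹' C i := by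
      rw [Set.iInter₂_congr hBC]
      simp only [Set.iInter_inter_distrib]
    have e2 : μ ((⋂ i ∈ s, F i ⁻¹' B i) ∩ ⋂ i ∈ s, A i ⁻¹' C i) =
        μ (⋂ i ∈ s, F i ⁻¹' B i) * μ (⋂ i ∈ s, A i ⁻¹' C i) := by
      have := h.measure_inter_preimage_eq_mul (⋂ i ∈ s, (fun v => v i) ⁻¹' B i)
        (⋂ i ∈ s, (fun v => v i) ⁻¹' C i)
        (Finset.measurableSet_biInter s fun i hi => measurable_pi_apply i (hB i hi))
        (Finset.measurableSet_biInter s fun i hi => measurable_pi_apply i (hC i hi))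
      simp only [Set.preimage_iInter] at this
      exact this
    rw [e1, e2, iIndepFun_iff_measure_inter_preimage_eq_mul.1 hF s hB,
      iIndepFun_iff_measure_inter_preimage_eq_mul.1 hA s hC, ← Finset.prod_mul_distrib]
    refine Finset.prod_congr rfl fun i hi => ?_
    rw [hBC i hi]
    have := h.measure_inter_preimage_eq_mul ((fun v => v i) ⁻¹' B i)
        ((fun v => v i) ⁻¹' C i) (measurable_pi_apply i (hB i hi)) (measurable_pi_apply i (hC i hi))
    exact this.symm

lemma comap_pi_le_iSup {Ω ι κ α : Type*} [MeasurableSpace α] (Z : ι → Ω → α) (w : κ → ι) :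
    MeasurableSpace.comap (fun ω a => Z (w a) ω) MeasurableSpace.pi ≤
      ⨆ i ∈ Set.range w, MeasurableSpace.comap (Z i) inferInstance := by
  rw [MeasurableSpace.pi, MeasurableSpace.comap_iSup]
  refine iSup_le fun a => ?_
  rw [MeasurableSpace.comap_comp]
  exact le_iSup₂ (f := fun i (_ : i ∈ Set.range w) =>
    MeasurableSpace.comap (Z i) inferInstance) (w a) ⟨a, rfl⟩

/-- Subfamilies of an independent family with disjoint index sets are independent. -/
lemma iIndepFun.indepFun_of_disjoint_range {ι κ κ' α : Type*} [MeasurableSpace α] {Z : ι → Ω → α}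
    (hZ : iIndepFun Z μ) (hZm : ∀ i, Measurable (Z i)) {u : κ → ι} {v : κ' → ι}
    (huv : ∀ a b, u a ≠ v b) :
    IndepFun (fun ω a => Z (u a) ω) (fun ω b => Z (v b) ω) μ := by
  have hd : Disjoint (Set.range u) (Set.range v) := by
    rw [Set.disjoint_left]
    rintro _ ⟨a, rfl⟩ ⟨b, hb⟩
    exact huv a b hb.symm
  have := indep_iSup_of_disjoint (fun i => (hZm i).comap_le) ((iIndepFun_iff_iIndep _ _ _).1 hZ) hd
  exact indep_of_indep_of_le_left (indep_of_indep_of_le_right this (comap_pi_le_iSup Z v))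
    (comap_pi_le_iSup Z u)

lemma iIndepFun.lintegral_prod_eq [IsProbabilityMeasure μ] {ι : Type*} (s : Finset ι)
    {Y : ι → Ω → ℝ≥0∞} (hY : iIndepFun Y μ) (hYm : ∀ i, Measurable (Y i)) :
    ∫⁻ ω, ∏ i ∈ s, Y i ω ∂μ = ∏ i ∈ s, ∫⁻ ω, Y i ω ∂μ :=
  lintegral_prod_eq_prod_lintegral_of_indepFun s Y hY hYm

/-- For finite sums this is multiplicativity. The bound `negExp ≤ 1` allows passage to the limit
even when the sum is infinite. -/
lemma iIndepFun.lintegral_negExp_tsum [IsProbabilityMeasure μ] {ι : Type*} [Countable ι]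
    {Y : ι → Ω → ℝ≥0∞} (hY : iIndepFun Y μ) (hYm : ∀ i, Measurable (Y i)) {a : ι → ℝ≥0∞}
    (ha : ∀ i, ∫⁻ ω, negExp (Y i ω) ∂μ = negExp (a i)) :
    ∫⁻ ω, negExp (∑' i, Y i ω) ∂μ = negExp (∑' i, a i) := by
  have hfin : ∀ s : Finset ι, ∫⁻ ω, negExp (∑ i ∈ s, Y i ω) ∂μ = negExp (∑ i ∈ s, a i) := by
    intro s
    simp_rw [negExp_sum]
    have := (hY.comp (fun _ => negExp) (fun _ => measurable_negExp)).lintegral_prod_eq s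
      (fun i => measurable_negExp.comp (hYm i))
    simp only [Function.comp_def] at this
    rw [this]
    exact Finset.prod_congr rfl fun i _ => ha i
  have hsum : ∀ f : ι → ℝ≥0∞, Tendsto (fun s : Finset ι => negExp (∑ i ∈ s, f i)) atTop
      (𝓝 (negExp (∑' i, f i))) := fun f =>
    (continuous_negExp.tendsto _).comp ENNReal.summable.hasSum
  refine tendsto_nhds_unique (f := fun s : Finset ι => ∫⁻ ω, negExp (∑ i ∈ s, Y i ω) ∂μ)
    (l := atTop) ?_ ?_
  · refine tendsto_lintegral_filter_of_dominated_convergence 1 ?_ ?_ (by simp) ?_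
    · exact Eventually.of_forall fun s =>
        measurable_negExp.comp (Finset.measurable_sum _ fun i _ => hYm i)
    · exact Eventually.of_forall fun s => Eventually.of_forall fun ω => negExp_le_one _
    · exact Eventually.of_forall fun ω => hsum _
  · simp_rw [hfin]
    exact hsum a

end ProbabilityTheory

/-- The Laplace transform of a unit exponential. The value `c = ∞`, the gain at the origin when the
argument is positive, is included: the exponential is almost surely positive, so both sides are
zero. -/
lemma lintegral_negExp_mul_expMeasure (c : ℝ≥0∞) :
    ∫⁻ h, negExp (c * ENNReal.ofReal h) ∂(expMeasure 1) = (1 + c)⁻¹ := by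
  have hm : Measurable fun h => negExp (c * ENNReal.ofReal h) :=
    measurable_negExp.comp (by fun_prop)
  rw [lintegral_expMeasure_one hm]
  induction c using ENNReal.recTopCoe with
  | top =>
    rw [setLIntegral_congr_fun (g := 0) measurableSet_Ioi]
    · simp
    · intro h hh
      have hh : (0 : ℝ) < h := hh
      simp only
      rw [ENNReal.top_mul (by simpa using hh), negExp_top, mul_zero]
      rfl
  | coe c =>
    have hc : (c : ℝ≥0∞) = ENNReal.ofReal (c : ℝ) := (ENNReal.ofReal_coe_nnreal).symm
    have h1 : (0 : ℝ) < 1 + c := by positivity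
    rw [hc, setLIntegral_congr_fun (g := fun h => ENNReal.ofReal (Real.exp (-((1 + c) * h))))
      measurableSet_Ioi]
    · have := Real.integral_rpow_mul_exp_neg_mul_Ioi one_pos h1
      simp only [sub_self, Real.rpow_zero, one_mul, Real.rpow_one, Real.Gamma_one, mul_one] at this
      rw [setLIntegral_ofReal_of_integral_eq measurableSet_Ioi (fun _ _ => (Real.exp_pos _).le)
        this (by positivity), one_div, ENNReal.ofReal_inv_of_pos h1,
        ENNReal.ofReal_add zero_le_one c.coe_nonneg, ENNReal.ofReal_one]
    · intro h hh
      have hh : (0 : ℝ) < h := hh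
      simp only
      rw [← ENNReal.ofReal_mul c.coe_nonneg, negExp_ofReal (by positivity),
        ← ENNReal.ofReal_mul (Real.exp_pos _).le, ← Real.exp_add]
      congr 2; ring

/-- The conditional Laplace transform of the power received from one node given its position. -/
lemma ProbabilityTheory.IndepFun.lintegral_negExp_rxPower {Ω : Type*} [MeasurableSpace Ω]
    {μ : Measure Ω} [IsProbabilityMeasure μ] {H : Ω → ℝ} {A : Ω → Bool} {p : ℝ}
    (h : IndepFun H A μ) (hH : Measurable H) (hA : Measurable A) (hlaw : μ.map H = expMeasure 1)
    (hp : μ.real {ω | A ω = true} = p) (s c : ℝ≥0∞) :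
    ∫⁻ ω, negExp (s * if A ω then c * ENNReal.ofReal (H ω) else 0) ∂μ = markLaplace p (s * c) := by
  have := h.lintegral_fade_act hH hA hlaw hp
    (Φ := fun h b => negExp (s * if b then c * ENNReal.ofReal h else 0)) (fun b => by
      refine measurable_negExp.comp (Measurable.const_mul ?_ _)
      cases b
      · simp
      · simp only [if_true]; fun_prop)
  refine this.trans ?_
  have : IsProbabilityMeasure (expMeasure 1) := isProbabilityMeasure_expMeasure one_pos
  simp only [Bool.false_eq_true, if_false, mul_zero, negExp_zero, if_true, ← mul_assoc,
    lintegral_negExp_mul_expMeasure]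
  simp [markLaplace]

/-! ### The network as a function of positions and marks -/

/-- The `i`-th interferer of each tier: in tier `0`, the first `K` nodes are skipped. -/
def interfererIdx (K : ℕ) {M : ℕ} (k : Fin (M + 1) × ℕ) : Fin (M + 1) × ℕ :=
  (k.1, if k.1 = 0 then K + k.2 else k.2)

lemma interfererIdx_injective (K : ℕ) {M : ℕ} :
    Function.Injective (interfererIdx K : Fin (M + 1) × ℕ → _) := by
  rintro ⟨m, i⟩ ⟨m', i'⟩ h
  simp only [interfererIdx, Prod.mk.injEq] at h
  obtain ⟨rfl, h⟩ := h
  split_ifs at h <;> simp_all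

namespace NetParams

variable {K M : ℕ} (p : NetParams K M)

instance (m : Fin (M + 1)) : SFinite (p.intensity m) := by
  unfold intensity; infer_instance

lemma intensity_ball_ne_top (m : Fin (M + 1)) (n : ℕ) :
    p.intensity m (Metric.ball 0 n) ≠ ∞ := by
  rw [intensity, Measure.smul_apply, smul_eq_mul]
  exact ENNReal.mul_ne_top ENNReal.ofReal_ne_top measure_ball_lt_top.ne

/-- The transmission probability of the interferers of tier `m`. -/
def interfererProb (m : Fin (M + 1)) : ℝ := Fin.cases p.pOut p.pExt m

lemma interfererProb_mem (m : Fin (M + 1)) : p.interfererProb m ∈ Set.Icc (0 : ℝ) 1 := by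
  cases m using Fin.cases with
  | zero => exact p.pOut_mem
  | succ m => exact p.pExt_mem m

lemma txProb_interfererIdx (k : Fin (M + 1) × ℕ) :
    p.txProb (interfererIdx K k).1 (interfererIdx K k).2 = p.interfererProb k.1 := by
  obtain ⟨m, i⟩ := k
  cases m using Fin.cases with
  | zero => simp [interfererIdx, txProb, interfererProb]
  | succ m => simp [interfererIdx, txProb, interfererProb]

/-- The interference power as a function of the positions and of the marks of the interferers. -/
def interferenceOf (x : Fin (M + 1) → ℕ → Plane) (z : Fin (M + 1) × ℕ → ℝ × Bool) : ℝ≥0∞ :=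
  ∑' k, if (z k).2 then (ENNReal.ofReal (p.txPower k.1) *
    ENNReal.ofReal ‖x (interfererIdx K k).1 (interfererIdx K k).2‖ ^ (-p.η)) *
      ENNReal.ofReal (z k).1 else 0

/-- The useful power as a function of the distances and of the marks of the transmitters. -/
def signalOf (r : Fin K → ℝ) (w : Fin K → ℝ × Bool) : ℝ≥0∞ :=
  ∑ i, if (w i).2 then ENNReal.ofReal (r i) ^ (-p.η) * ENNReal.ofReal (w i).1 else 0

lemma measurable_interferenceOf : Measurable (Function.uncurry p.interferenceOf) := by
  refine Measurable.tsum fun k => ?_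
  refine Measurable.ite ?_ ?_ measurable_const
  · exact (show Measurable fun q : (Fin (M + 1) → ℕ → Plane) × (Fin (M + 1) × ℕ → ℝ × Bool) =>
      (q.2 k).2 by fun_prop) (measurableSet_singleton true)
  · fun_prop

lemma measurable_signalOf : Measurable (Function.uncurry p.signalOf) := by
  show Measurable fun q : (Fin K → ℝ) × (Fin K → ℝ × Bool) => ∑ i,
    if (q.2 i).2 then ENNReal.ofReal (q.1 i) ^ (-p.η) * ENNReal.ofReal (q.2 i).1 else 0
  refine Finset.measurable_sum _ fun i _ => ?_
  refine Measurable.ite ?_ ?_ measurable_const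
  · exact (show Measurable fun q : (Fin K → ℝ) × (Fin K → ℝ × Bool) =>
      (q.2 i).2 by fun_prop) (measurableSet_singleton true)
  · fun_prop

/-- The Laplace transform at `t` of the interference of the extrinsic tier `m`. -/
def extLaplace (m : Fin M) (t : ℝ) : ℝ≥0∞ :=
  negExp (∫⁻ x, (1 - negExp (markFun (p.pExt m) p.η (t * p.power m) x)) ∂(p.intensity m.succ))

/-- The Laplace transform at `t` of the interference of the nodes of a homogeneous tier `0` that
are beyond the distance `r`. -/
def beyondLaplace (r t : ℝ) : ℝ≥0∞ :=
  negExp (∫⁻ x, (1 - negExp (if r < ‖x‖ then markFun p.pOut p.η t x else 0)) ∂(p.intensity 0))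

lemma measurable_extLaplace (m : Fin M) : Measurable (p.extLaplace m) := by
  refine measurable_negExp.comp (Measurable.lintegral_prod_right' (f := fun q : ℝ × Plane =>
    1 - negExp (markFun (p.pExt m) p.η (q.1 * p.power m) q.2)) ?_)
  exact (measurable_negExp.comp ((measurable_markFun _ _).comp (f := fun q : ℝ × Plane =>
    (q.1 * p.power m, q.2)) (by fun_prop))).const_sub _

lemma measurable_beyondLaplace : Measurable fun q : ℝ × ℝ => p.beyondLaplace q.1 q.2 := by
  refine measurable_negExp.comp (Measurable.lintegral_prod_right' (f := fun q : (ℝ × ℝ) × Plane =>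
    1 - negExp (if q.1.1 < ‖q.2‖ then markFun p.pOut p.η q.1.2 q.2 else 0)) ?_)
  refine (measurable_negExp.comp (Measurable.ite (measurableSet_lt (by fun_prop) (by fun_prop))
    ?_ measurable_const)).const_sub _
  exact (measurable_markFun _ _).comp (f := fun q : (ℝ × ℝ) × Plane => (q.1.2, q.2)) (by fun_prop)

lemma extLaplace_eq (m : Fin M) {t : ℝ} (ht : 0 ≤ t) :
    p.extLaplace m t = ENNReal.ofReal (Real.exp (-(Real.pi * p.pExt m * p.lam m.succ *
      (t * p.power m) ^ (2 / p.η) * Real.Gamma (1 + 2 / p.η) * Real.Gamma (1 - 2 / p.η)))) := by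
  have hη := p.two_lt_η
  have h1 : 2 / p.η < 1 := by rw [div_lt_one (by linarith)]; exact hη
  have h2 : 0 < 2 / p.η := div_pos two_pos (by linarith)
  have hs : 0 ≤ t * p.power m := mul_nonneg ht (p.power_pos m).le
  have := p.lam_pos m.succ
  have := (p.pExt_mem m).1
  have := Real.Gamma_pos_of_pos (by linarith : 0 < 1 + 2 / p.η)
  have := Real.Gamma_pos_of_pos (by linarith : 0 < 1 - 2 / p.η)
  rw [extLaplace, intensity, lintegral_markFun (p.pExt_mem m) hη hs (p.lam_pos _).le,
    negExp_ofReal (by positivity)]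

lemma beyondLaplace_eq {r t : ℝ} (hr : 0 < r) (ht : 0 ≤ t) :
    p.beyondLaplace r t = ENNReal.ofReal (Real.exp (-(Real.pi * p.pOut * p.lam 0 * r ^ 2 *
      pathF (t * r ^ (-p.η)) p.η))) := by
  have hη := p.two_lt_η
  have := p.lam_pos 0
  have := p.pOut_mem.1
  have := pathF_nonneg hη (mul_nonneg ht (Real.rpow_nonneg hr.le (-p.η)))
  rw [beyondLaplace, intensity, lintegral_markFun_beyond p.pOut_mem hη ht (p.lam_pos _).le hr,
    negExp_ofReal (by positivity)]

end NetParams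

namespace Network

variable {K M : ℕ} {Ω : Type*}

/-- The fading power and the transmission indicator of a node. -/
def mark (N : Network M Ω) (k : Fin (M + 1) × ℕ) (ω : Ω) : ℝ × Bool :=
  (N.fade k.1 k.2 ω, N.act k.1 k.2 ω)

/-- The distances of the in-cluster transmitters. -/
def clusterDist (N : Network M Ω) (K : ℕ) (ω : Ω) (i : Fin K) : ℝ := ‖N.pos 0 i ω‖

/-- The marks of the in-cluster transmitters. -/
def clusterMark (N : Network M Ω) (K : ℕ) (ω : Ω) (i : Fin K) : ℝ × Bool := N.mark (0, i) ω

/-- The marks of the interferers. -/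
def interfererMark (N : Network M Ω) (K : ℕ) (ω : Ω) (k : Fin (M + 1) × ℕ) : ℝ × Bool :=
  N.mark (interfererIdx K k) ω

lemma signal_eq (N : Network M Ω) (p : NetParams K M) (ω : Ω) :
    N.signal p ω = p.signalOf (N.clusterDist K ω) (N.clusterMark K ω) := by
  refine Finset.sum_congr rfl fun i _ => ?_
  simp [rxPower, NetParams.txPower, clusterDist, clusterMark, mark]

lemma interference_eq (N : Network M Ω) (p : NetParams K M) (ω : Ω) :
    N.interference p ω = p.interferenceOf (fun m i => N.pos m i ω) (N.interfererMark K ω) := by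
  rw [NetParams.interferenceOf, ENNReal.tsum_prod', tsum_fintype, Fin.sum_univ_succ]
  rfl

namespace IsModel

variable [MeasurableSpace Ω] {N : Network M Ω} {p : NetParams K M} {μ : Measure Ω}

lemma measurable_mark (h : N.IsModel p μ) (k : Fin (M + 1) × ℕ) : Measurable (N.mark k) :=
  (h.fade_meas _ _).prodMk (h.act_meas _ _)

lemma measurable_clusterDist (h : N.IsModel p μ) : Measurable (N.clusterDist K) :=
  measurable_pi_lambda _ fun i => (h.pos_meas 0 i).norm

lemma measurable_clusterMark (h : N.IsModel p μ) : Measurable (N.clusterMark K) :=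
  measurable_pi_lambda _ fun _ => h.measurable_mark _

lemma measurable_interfererMark (h : N.IsModel p μ) : Measurable (N.interfererMark K) :=
  measurable_pi_lambda _ fun _ => h.measurable_mark _

lemma measurable_pos (h : N.IsModel p μ) : Measurable fun ω m i => N.pos m i ω :=
  measurable_pi_lambda _ fun m => measurable_pi_lambda _ fun i => h.pos_meas m i

lemma indepFun_fade_act (h : N.IsModel p μ) (k : Fin (M + 1) × ℕ) :
    IndepFun (N.fade k.1 k.2) (N.act k.1 k.2) μ :=
  h.fade_act_indep.comp (φ := fun f : Fin (M + 1) → ℕ → ℝ => f k.1 k.2)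
    (ψ := fun f : Fin (M + 1) → ℕ → Bool => f k.1 k.2)
    (by fun_prop) (by fun_prop)

lemma iIndepFun_mark (h : N.IsModel p μ) : iIndepFun N.mark μ := by
  refine h.fade_indep.prodMk_of_indepFun h.act_indep (fun _ => h.fade_meas _ _)
    (fun _ => h.act_meas _ _) ?_
  exact h.fade_act_indep.comp (φ := fun (f : Fin (M + 1) → ℕ → ℝ) (k : Fin (M + 1) × ℕ) => f k.1 k.2)
    (ψ := fun (f : Fin (M + 1) → ℕ → Bool) (k : Fin (M + 1) × ℕ) => f k.1 k.2) (by fun_prop) (by fun_prop)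

lemma indepFun_clusterMark_interfererMark (h : N.IsModel p μ) :
    IndepFun (N.clusterMark K) (N.interfererMark K) μ := by
  refine h.iIndepFun_mark.indepFun_of_disjoint_range h.measurable_mark
    (u := fun i : Fin K => (0, (i : ℕ))) (v := interfererIdx K) ?_
  rintro i ⟨m, l⟩ hk
  simp only [interfererIdx, Prod.mk.injEq] at hk
  obtain ⟨rfl, hk⟩ := hk
  have := i.2
  simp at hk
  omega

lemma indepFun_pos_marks (h : N.IsModel p μ) : IndepFun (fun ω m i => N.pos m i ω)
    (fun ω => (N.clusterMark K ω, N.interfererMark K ω)) μ :=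
  h.pos_mark_indep.comp (φ := id) (ψ := fun q : (Fin (M + 1) → ℕ → ℝ) × (Fin (M + 1) → ℕ → Bool) =>
    ((fun i : Fin K => (q.1 0 i, q.2 0 i)),
      (fun k => (q.1 (interfererIdx K k).1 (interfererIdx K k).2,
        q.2 (interfererIdx K k).1 (interfererIdx K k).2)))) measurable_id (by fun_prop)

lemma indepFun_pos_interfererMark (h : N.IsModel p μ) : IndepFun (fun ω m i => N.pos m i ω)
    (N.interfererMark K) μ :=
  h.indepFun_pos_marks.comp measurable_id measurable_snd

/-- With the positions frozen, the received powers are independent over all nodes, and each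
contributes `markLaplace`, which is `negExp` of `markFun`. The transmit power is absorbed into the
argument. -/
lemma lintegral_negExp_interferenceOf (h : N.IsModel p μ) [IsProbabilityMeasure μ] {s : ℝ} (hs : 0 ≤ s)
    (x : Fin (M + 1) → ℕ → Plane) :
    ∫⁻ ω, negExp (ENNReal.ofReal s * p.interferenceOf x (N.interfererMark K ω)) ∂μ =
      negExp (∑' i, markFun p.pOut p.η s (x 0 (K + i)) +
        ∑ m : Fin M, ∑' i, markFun (p.pExt m) p.η (s * p.power m) (x m.succ i)) := by
  have hind : iIndepFun (fun k ω => ENNReal.ofReal s * if (N.interfererMark K ω k).2 then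
      (ENNReal.ofReal (p.txPower k.1) *
        ENNReal.ofReal ‖x (interfererIdx K k).1 (interfererIdx K k).2‖ ^ (-p.η)) *
        ENNReal.ofReal (N.interfererMark K ω k).1 else 0) μ := by
    refine (h.iIndepFun_mark.precomp (interfererIdx_injective K)).comp
      (fun k (q : ℝ × Bool) => ENNReal.ofReal s * if q.2 then (ENNReal.ofReal (p.txPower k.1) *
        ENNReal.ofReal ‖x (interfererIdx K k).1 (interfererIdx K k).2‖ ^ (-p.η)) *
        ENNReal.ofReal q.1 else 0) (fun k => ?_)
    refine Measurable.const_mul (Measurable.ite (measurable_snd (measurableSet_singleton true)) ?_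
      measurable_const) _
    fun_prop
  have hm : ∀ k, Measurable fun ω => ENNReal.ofReal s * if (N.interfererMark K ω k).2 then
      (ENNReal.ofReal (p.txPower k.1) *
        ENNReal.ofReal ‖x (interfererIdx K k).1 (interfererIdx K k).2‖ ^ (-p.η)) *
        ENNReal.ofReal (N.interfererMark K ω k).1 else 0 := by
    intro k
    have hk : Measurable fun ω => N.interfererMark K ω k := h.measurable_mark _
    refine Measurable.const_mul (Measurable.ite (hk.snd (measurableSet_singleton true)) ?_
      measurable_const) _
    exact hk.fst.ennreal_ofReal.const_mul _
  simp_rw [NetParams.interferenceOf, ← ENNReal.tsum_mul_left]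
  rw [hind.lintegral_negExp_tsum hm (a := fun k => markFun (p.interfererProb k.1) p.η
    (s * p.txPower k.1) (x (interfererIdx K k).1 (interfererIdx K k).2)), ENNReal.tsum_prod',
    tsum_fintype, Fin.sum_univ_succ]
  · congr 2
    simp [interfererIdx, NetParams.interfererProb, NetParams.txPower]
  · intro k
    rw [negExp_markFun (p.interfererProb_mem _), ENNReal.ofReal_mul hs, mul_assoc,
      ← p.txProb_interfererIdx]
    exact (h.indepFun_fade_act _).lintegral_negExp_rxPower (h.fade_meas _ _) (h.act_meas _ _)
      (h.fade_law _ _) (h.act_law _ _) _ _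

end IsModel

end Network

/-! ### The conditional Laplace transform of the interference -/

namespace NetParams

variable {K M : ℕ} [NeZero K] (p : NetParams K M)

/-- The conditional Laplace transform of the interference at `θ r_j ^ η`, given the distances `r`
of the in-cluster transmitters. -/
def laplaceOf (θ : ℝ) (j : Fin K) (r : Fin K → ℝ) : ℝ≥0∞ :=
  p.beyondLaplace (r (lastIdx K)) (θ * r j ^ p.η) * ∏ m, p.extLaplace m (θ * r j ^ p.η)

lemma measurable_laplaceOf (θ : ℝ) (j : Fin K) : Measurable (p.laplaceOf θ j) := by
  have hm : Measurable fun r : Fin K → ℝ => θ * r j ^ p.η := by fun_prop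
  refine Measurable.mul (p.measurable_beyondLaplace.comp
    (f := fun r : Fin K → ℝ => (r (lastIdx K), θ * r j ^ p.η)) (by fun_prop)) ?_
  exact Finset.measurable_fun_prod _ fun m _ => (p.measurable_extLaplace m).comp hm

/-- The choice `s = θ r_j ^ η` yields the scaling of the closed form: `s r_K ^ (-η) = ω_j ^ η θ` for
`pathF`, and `(s P) ^ (2/η) = r_j² (θ P) ^ (2/η)` for the extrinsic tiers. -/
lemma laplaceOf_mul_negExp_noise {θ : ℝ} (hθ : 0 ≤ θ) (j : Fin K) {r : Fin K → ℝ}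
    (hr : ∀ i, 0 < r i) :
    p.laplaceOf θ j r * negExp (ENNReal.ofReal (θ * r j ^ p.η) * ENNReal.ofReal p.noise) =
      ENNReal.ofReal (p.Cterm r θ j) := by
  have ht : 0 ≤ θ * r j ^ p.η := mul_nonneg hθ (Real.rpow_nonneg (hr j).le _)
  have hη : 0 < p.η := by linarith [p.two_lt_η]
  have e1 : θ * r j ^ p.η * r (lastIdx K) ^ (-p.η) = p.omegaPow r j * θ := by
    rw [omegaPow, Real.div_rpow (hr _).le (hr _).le, Real.rpow_neg (hr _).le]; ring
  have e2 : ∀ m, (θ * r j ^ p.η * p.power m) ^ (2 / p.η) =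
      r j ^ 2 * (θ * p.power m) ^ (2 / p.η) := by
    intro m
    rw [mul_right_comm, Real.mul_rpow (mul_nonneg hθ (p.power_pos m).le)
      (Real.rpow_nonneg (hr j).le _), ← Real.rpow_mul (hr j).le, mul_div_cancel₀ _ hη.ne',
      mul_comm]
    norm_cast
  rw [laplaceOf, p.beyondLaplace_eq (hr _) ht, e1]
  simp_rw [fun m => p.extLaplace_eq m ht, e2]
  rw [← ENNReal.ofReal_prod_of_nonneg (fun _ _ => (Real.exp_pos _).le), ← ENNReal.ofReal_mul ht,
    negExp_ofReal (mul_nonneg ht p.noise_nonneg), ← ENNReal.ofReal_mul (Real.exp_pos _).le,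
    ← ENNReal.ofReal_mul (by positivity), Cterm, Dterm]
  congr 1
  rw [mul_comm, ← mul_assoc]
  congr 1
  · congr 2 <;> ring
  · refine Finset.prod_congr rfl fun m _ => ?_
    congr 1; ring

lemma tendsto_laplaceOf_zero (j : Fin K) {r : Fin K → ℝ} (hr : ∀ i, 0 < r i) {u : ℕ → ℝ}
    (hu0 : ∀ n, 0 ≤ u n) (hu : Tendsto u atTop (𝓝 0)) :
    Tendsto (fun n => p.laplaceOf (u n) j r) atTop (𝓝 1) := by
  have hη : 0 < p.η := by linarith [p.two_lt_η]
  have ht : ∀ n, 0 ≤ u n * r j ^ p.η := fun n => mul_nonneg (hu0 n) (Real.rpow_nonneg (hr j).le _)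
  have htl : Tendsto (fun n => u n * r j ^ p.η) atTop (𝓝 0) := by simpa using hu.mul_const _
  have key : ∀ {f : ℕ → ℝ}, Tendsto f atTop (𝓝 0) →
      Tendsto (fun n => ENNReal.ofReal (Real.exp (-(f n)))) atTop (𝓝 1) := by
    intro f hf
    have := ENNReal.tendsto_ofReal ((Real.continuous_exp.tendsto _).comp hf.neg)
    simpa using this
  have h1 : Tendsto (fun n => p.beyondLaplace (r (lastIdx K)) (u n * r j ^ p.η)) atTop (𝓝 1) := by
    simp_rw [fun n => p.beyondLaplace_eq (hr (lastIdx K)) (ht n)]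
    apply key
    have hpos : ∀ n, 0 ≤ u n * r j ^ p.η * r (lastIdx K) ^ (-p.η) := fun n =>
      mul_nonneg (ht n) (Real.rpow_nonneg (hr _).le _)
    have hF : Tendsto (fun n => pathF (u n * r j ^ p.η * r (lastIdx K) ^ (-p.η)) p.η) atTop
        (𝓝 0) := by
      refine squeeze_zero (fun n => pathF_nonneg p.two_lt_η (hpos n))
        (fun n => pathF_le p.two_lt_η (hpos n)) ?_
      simpa using ((htl.mul_const (r (lastIdx K) ^ (-p.η))).const_mul 2).div_const (p.η - 2)
    simpa using hF.const_mul (Real.pi * p.pOut * p.lam 0 * r (lastIdx K) ^ 2)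
  have h2 : ∀ m, Tendsto (fun n => p.extLaplace m (u n * r j ^ p.η)) atTop (𝓝 1) := by
    intro m
    simp_rw [fun n => p.extLaplace_eq m (ht n)]
    apply key
    have : Tendsto (fun n => (u n * r j ^ p.η * p.power m) ^ (2 / p.η)) atTop (𝓝 0) := by
      have h := (htl.mul_const (p.power m)).rpow_const (p := 2 / p.η) (Or.inr (by positivity))
      rwa [zero_mul, Real.zero_rpow (by positivity)] at h
    simpa using ((this.const_mul (Real.pi * p.pExt m * p.lam m.succ)).mul_const
      (Real.Gamma (1 + 2 / p.η))).mul_const (Real.Gamma (1 - 2 / p.η))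
  have h3 : Tendsto (fun n => ∏ m, p.extLaplace m (u n * r j ^ p.η)) atTop (𝓝 (∏ _m : Fin M, 1)) := by
    refine ENNReal.tendsto_finsetProd_of_ne_top _ (fun m _ => h2 m) (by simp)
  have := ENNReal.Tendsto.mul h1 (Or.inl one_ne_zero) h3 (by simp)
  simpa [laplaceOf] using this

end NetParams

namespace Network.IsModel

variable {K M : ℕ} {Ω : Type*} [MeasurableSpace Ω] {N : Network M Ω} {p : NetParams K M}
  {μ : Measure Ω} [IsProbabilityMeasure μ]

lemma lintegral_prod_ext (h : N.IsModel p μ) (t : ℝ) :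
    ∫⁻ ω, negExp (∑ m : Fin M, ∑' i, markFun (p.pExt m) p.η (t * p.power m) (N.pos m.succ i ω)) ∂μ =
      ∏ m, p.extLaplace m t := by
  have hm : ∀ m : Fin M, Measurable fun x : ℕ → Plane =>
      negExp (∑' i, markFun (p.pExt m) p.η (t * p.power m) (x i)) := fun m =>
    measurable_negExp.comp (Measurable.tsum fun i => (measurable_markFun _ _).comp
      (f := fun x : ℕ → Plane => (t * p.power m, x i)) (by fun_prop))
  simp_rw [negExp_sum]
  have hi := (h.pos_indep.precomp (Fin.succ_injective M)).comp _ hm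
  refine (hi.lintegral_prod_eq Finset.univ fun m => (hm m).comp
    (measurable_pi_lambda _ fun i => h.pos_meas m.succ i)).trans ?_
  refine Finset.prod_congr rfl fun m _ => ?_
  exact (h.ext_ppp m).lintegral_negExp_tsum (p.intensity_ball_ne_top _)
    ((measurable_markFun _ _).comp (f := fun x : Plane => (t * p.power m, x)) (by fun_prop))

end Network.IsModel

namespace Network

variable {K M : ℕ} [NeZero K] {Ω : Type*} [MeasurableSpace Ω]

/-- The conditional Laplace functional of the interferers of tier `0`, given the distances of the
in-cluster transmitters, is that of a homogeneous Poisson point process beyond the farthest one. -/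
def TierLaplace (N : Network M Ω) (p : NetParams K M) (μ : Measure Ω) : Prop :=
  ∀ (θ : ℝ), 0 ≤ θ → ∀ (j : Fin K) (ψ : (Fin K → ℝ) → ℝ≥0∞), Measurable ψ →
    ∫⁻ ω, ψ (N.clusterDist K ω) * negExp (∑' i, markFun p.pOut p.η
        (θ * N.clusterDist K ω j ^ p.η) (N.pos 0 (K + i) ω)) ∂μ =
      ∫⁻ ω, ψ (N.clusterDist K ω) * p.beyondLaplace (N.clusterDist K ω (lastIdx K))
        (θ * N.clusterDist K ω j ^ p.η) ∂μ

namespace IsModel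

variable {N : Network M Ω} {p : NetParams K M} {μ : Measure Ω} [IsProbabilityMeasure μ]

/-- Independence is used in layers: the marks of the interferers are integrated out at fixed
positions, then the extrinsic tiers at fixed tier `0`, and what remains is an expectation over tier
`0` alone. -/
lemma lintegral_mul_negExp_interference (h : N.IsModel p μ) (hT : N.TierLaplace p μ) {θ : ℝ}
    (hθ : 0 ≤ θ) (j : Fin K) {ψ : (Fin K → ℝ) → ℝ≥0∞} (hψ : Measurable ψ)
    (hpos : ∀ᵐ ω ∂μ, ∀ i, 0 < N.clusterDist K ω i) :
    ∫⁻ ω, ψ (N.clusterDist K ω) *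
        negExp (ENNReal.ofReal (θ * N.clusterDist K ω j ^ p.η) * N.interference p ω) ∂μ =
      ∫⁻ ω, ψ (N.clusterDist K ω) * p.laplaceOf θ j (N.clusterDist K ω) ∂μ := by
  have hψ0 : Measurable fun x : ℕ → Plane => ψ fun i : Fin K => ‖x i‖ :=
    hψ.comp (by fun_prop)
  have hmark0 : Measurable fun x : ℕ → Plane =>
      ∑' i, markFun p.pOut p.η (θ * ‖x j‖ ^ p.η) (x (K + i)) :=
    Measurable.tsum fun i => (measurable_markFun _ _).comp
      (f := fun x : ℕ → Plane => (θ * ‖x j‖ ^ p.η, x (K + i))) (by fun_prop)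
  have hmark : Measurable fun q : ℝ × (Fin M → ℕ → Plane) =>
      ∑ m : Fin M, ∑' i, markFun (p.pExt m) p.η (q.1 * p.power m) (q.2 m i) :=
    Finset.measurable_sum _ fun m _ => Measurable.tsum fun i => (measurable_markFun _ _).comp
      (f := fun q : ℝ × (Fin M → ℕ → Plane) => (q.1 * p.power m, q.2 m i)) (by fun_prop)
  calc _ = ∫⁻ ω, (fun (x : Fin (M + 1) → ℕ → Plane) v => ψ (fun i : Fin K => ‖x 0 i‖) *
        negExp (ENNReal.ofReal (θ * ‖x 0 j‖ ^ p.η) * p.interferenceOf x v))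
        (fun m i => N.pos m i ω) (N.interfererMark K ω) ∂μ := by
        simp_rw [interference_eq]; rfl
    _ = ∫⁻ ω, ∫⁻ ω', ψ (N.clusterDist K ω) *
        negExp (ENNReal.ofReal (θ * N.clusterDist K ω j ^ p.η) *
          p.interferenceOf (fun m i => N.pos m i ω) (N.interfererMark K ω')) ∂μ ∂μ := by
        have hΦ : Measurable (Function.uncurry fun (x : Fin (M + 1) → ℕ → Plane)
            (v : Fin (M + 1) × ℕ → ℝ × Bool) => ψ (fun i : Fin K => ‖x 0 i‖) *
              negExp (ENNReal.ofReal (θ * ‖x 0 j‖ ^ p.η) * p.interferenceOf x v)) := by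
          refine Measurable.mul (hψ0.comp (f := fun q : (Fin (M + 1) → ℕ → Plane) ×
            (Fin (M + 1) × ℕ → ℝ × Bool) => q.1 0) (by fun_prop)) (measurable_negExp.comp ?_)
          exact Measurable.mul (by fun_prop) p.measurable_interferenceOf
        exact h.indepFun_pos_interfererMark.lintegral_comp h.measurable_pos
          h.measurable_interfererMark hΦ
    _ = ∫⁻ ω, (fun (x : ℕ → Plane) (y : Fin M → ℕ → Plane) => ψ (fun i : Fin K => ‖x i‖) *
          (negExp (∑' i, markFun p.pOut p.η (θ * ‖x j‖ ^ p.η) (x (K + i))) *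
          negExp (∑ m, ∑' i, markFun (p.pExt m) p.η (θ * ‖x j‖ ^ p.η * p.power m) (y m i))))
          (fun i => N.pos 0 i ω) (fun m i => N.pos m.succ i ω) ∂μ := by
        refine lintegral_congr_ae (hpos.mono fun ω hω => ?_)
        simp only
        rw [lintegral_const_mul, h.lintegral_negExp_interferenceOf
          (mul_nonneg hθ (Real.rpow_nonneg (hω j).le _)), negExp_add]
        · rfl
        · have hv : Measurable fun ω' => p.interferenceOf (fun m i => N.pos m i ω)
              (N.interfererMark K ω') := p.measurable_interferenceOf.comp
            (f := fun ω' => (fun m i => N.pos m i ω, N.interfererMark K ω'))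
            (measurable_const.prodMk h.measurable_interfererMark)
          exact measurable_negExp.comp (hv.const_mul _)
    _ = ∫⁻ ω, ψ (N.clusterDist K ω) * (∏ m, p.extLaplace m (θ * N.clusterDist K ω j ^ p.η)) *
          negExp (∑' i, markFun p.pOut p.η (θ * N.clusterDist K ω j ^ p.η)
            (N.pos 0 (K + i) ω)) ∂μ := by
        have hind : IndepFun (fun ω i => N.pos 0 i ω) (fun ω (m : Fin M) i => N.pos m.succ i ω) μ :=
          (h.pos_indep.indepFun_of_disjoint_range
            (fun m => measurable_pi_lambda _ fun i => h.pos_meas m i) (u := fun _ : Unit => 0)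
            (v := Fin.succ) (fun _ m => (Fin.succ_ne_zero m).symm)).comp
            (φ := fun f : Unit → ℕ → Plane => f ()) (ψ := id) (by fun_prop) measurable_id
        have hΦ : Measurable (Function.uncurry fun (x : ℕ → Plane) (y : Fin M → ℕ → Plane) =>
            ψ (fun i : Fin K => ‖x i‖) *
            (negExp (∑' i, markFun p.pOut p.η (θ * ‖x j‖ ^ p.η) (x (K + i))) *
            negExp (∑ m, ∑' i, markFun (p.pExt m) p.η
              (θ * ‖x j‖ ^ p.η * p.power m) (y m i)))) := by
          have h1 : Measurable fun q : (ℕ → Plane) × (Fin M → ℕ → Plane) =>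
              ψ fun i : Fin K => ‖q.1 i‖ := hψ0.comp measurable_fst
          have h2 : Measurable fun q : (ℕ → Plane) × (Fin M → ℕ → Plane) =>
              ∑' i, markFun p.pOut p.η (θ * ‖q.1 j‖ ^ p.η) (q.1 (K + i)) :=
            hmark0.comp measurable_fst
          have h3 : Measurable fun q : (ℕ → Plane) × (Fin M → ℕ → Plane) =>
              (θ * ‖q.1 j‖ ^ p.η, q.2) := by fun_prop
          have h4 : Measurable fun q : (ℕ → Plane) × (Fin M → ℕ → Plane) => ∑ m, ∑' i,
              markFun (p.pExt m) p.η (θ * ‖q.1 j‖ ^ p.η * p.power m) (q.2 m i) := by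
            have := hmark.comp h3
            simp only [Function.comp_def] at this
            exact this
          have h5 : Measurable fun q : (ℕ → Plane) × (Fin M → ℕ → Plane) => negExp (∑ m, ∑' i,
              markFun (p.pExt m) p.η (θ * ‖q.1 j‖ ^ p.η * p.power m) (q.2 m i)) :=
            measurable_negExp.comp h4
          have h6 : Measurable fun q : (ℕ → Plane) × (Fin M → ℕ → Plane) =>
              negExp (∑' i, markFun p.pOut p.η (θ * ‖q.1 j‖ ^ p.η) (q.1 (K + i))) :=
            measurable_negExp.comp h2
          have h7 := h1.mul (h6.mul h5)
          exact h7
        have hx : Measurable fun ω i => N.pos 0 i ω :=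
          measurable_pi_lambda _ fun i => h.pos_meas _ i
        have hy : Measurable fun ω (m : Fin M) i => N.pos m.succ i ω :=
          measurable_pi_lambda _ fun m => measurable_pi_lambda _ fun i => h.pos_meas _ i
        refine (hind.lintegral_comp hx hy hΦ).trans ?_
        refine lintegral_congr fun ω => ?_
        have hmm : Measurable fun ω' => negExp (∑ m : Fin M, ∑' i, markFun (p.pExt m) p.η
            (θ * ‖N.pos 0 j ω‖ ^ p.η * p.power m) (N.pos m.succ i ω')) := by
          have hq : Measurable fun ω' => (θ * ‖N.pos 0 j ω‖ ^ p.η,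
            fun (m : Fin M) i => N.pos m.succ i ω') := measurable_const.prodMk hy
          have := hmark.comp hq
          exact measurable_negExp.comp this
        simp only [← mul_assoc]
        rw [lintegral_const_mul _ hmm, h.lintegral_prod_ext, mul_right_comm]
        rfl
    _ = _ := by
        -- The extrinsic factor depends only on the cluster distances, so it may be part of the
        -- weight in `TierLaplace`.
        rw [hT θ hθ j (fun r => ψ r * ∏ m, p.extLaplace m (θ * r j ^ p.η)) (hψ.mul
          (Finset.measurable_fun_prod _ fun m _ => (p.measurable_extLaplace m).comp
            (by fun_prop)))]
        refine lintegral_congr fun ω => ?_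
        rw [NetParams.laplaceOf]; ring

end IsModel
end Network

/-! ### The tail of the SINR given the interference -/

/-- If `A` is independent of `(B, C)`, and `B` is independent of `C`, then `B` is independent of
`(A, C)`, in the form of iterated integrals. -/
lemma ProbabilityTheory.IndepFun.lintegral_comp_of_indepFun {Ω α β γ : Type*} [MeasurableSpace Ω]
    {μ : Measure Ω} [IsProbabilityMeasure μ] [MeasurableSpace α] [MeasurableSpace β]
    [MeasurableSpace γ] {A : Ω → α} {B : Ω → β} {C : Ω → γ}
    (h : IndepFun A (fun ω => (B ω, C ω)) μ) (hBC : IndepFun B C μ) (hA : Measurable A)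
    (hB : Measurable B) (hC : Measurable C) {Φ : α → β → γ → ℝ≥0∞}
    (hΦ : Measurable fun q : α × β × γ => Φ q.1 q.2.1 q.2.2) :
    ∫⁻ ω, Φ (A ω) (B ω) (C ω) ∂μ = ∫⁻ ω, ∫⁻ ω', Φ (A ω) (B ω') (C ω) ∂μ ∂μ := by
  have hm : Measurable (Function.uncurry fun a c => ∫⁻ ω', Φ a (B ω') c ∂μ) := by
    refine Measurable.lintegral_prod_right' (f := fun q : (α × γ) × Ω =>
      Φ q.1.1 (B q.2) q.1.2) ?_
    exact hΦ.comp (f := fun q : (α × γ) × Ω => (q.1.1, B q.2, q.1.2)) (by fun_prop)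
  have hΦ' : Measurable (Function.uncurry fun a (q : β × γ) => Φ a q.1 q.2) := hΦ
  rw [h.lintegral_comp hA (hB.prodMk hC) hΦ']
  have hAC : IndepFun A C μ := h.comp measurable_id measurable_snd
  rw [hAC.lintegral_comp hA hC hm]
  refine lintegral_congr fun ω => ?_
  have hm' : Measurable (Function.uncurry fun c b => Φ (A ω) b c) :=
    hΦ.comp (f := fun q : γ × β => (A ω, q.2, q.1)) (by fun_prop)
  exact hBC.symm.lintegral_comp hC hB hm'

namespace Network.IsModel

variable {K M : ℕ} {Ω : Type*} [MeasurableSpace Ω] {N : Network M Ω} {p : NetParams K M}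
  {μ : Measure Ω}

lemma measurable_interference (h : N.IsModel p μ) : Measurable (N.interference p) := by
  have : N.interference p = fun ω =>
      p.interferenceOf (fun m i => N.pos m i ω) (N.interfererMark K ω) :=
    funext fun ω => N.interference_eq p ω
  rw [this]
  exact p.measurable_interferenceOf.comp (h.measurable_pos.prodMk h.measurable_interfererMark)

lemma measurable_signal (h : N.IsModel p μ) : Measurable (N.signal p) := by
  have : N.signal p = fun ω => p.signalOf (N.clusterDist K ω) (N.clusterMark K ω) :=
    funext fun ω => N.signal_eq p ω
  rw [this]
  exact p.measurable_signalOf.comp (h.measurable_clusterDist.prodMk h.measurable_clusterMark)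

lemma measurableSet_lt_sinr (h : N.IsModel p μ) (x : ℝ≥0∞) :
    MeasurableSet {ω | x < N.sinr p ω} :=
  measurableSet_lt measurable_const
    (h.measurable_signal.div (h.measurable_interference.add_const _))

variable [IsProbabilityMeasure μ]

/-- The cluster marks can be integrated out first. -/
lemma lintegral_mul_indicator_lt_sinr (h : N.IsModel p μ) (x : ℝ≥0∞) {ψ : (Fin K → ℝ) → ℝ≥0∞}
    (hψ : Measurable ψ) :
    ∫⁻ ω, ψ (N.clusterDist K ω) * {ω | x < N.sinr p ω}.indicator 1 ω ∂μ =
      ∫⁻ ω, ψ (N.clusterDist K ω) * μ {ω' | x < p.signalOf (N.clusterDist K ω)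
        (N.clusterMark K ω') / (N.interference p ω + ENNReal.ofReal p.noise)} ∂μ := by
  set Φ : (Fin (M + 1) → ℕ → Plane) → (Fin K → ℝ × Bool) → (Fin (M + 1) × ℕ → ℝ × Bool) → ℝ≥0∞ :=
    fun y w v => ψ (fun i : Fin K => ‖y 0 i‖) * {s : ℝ≥0∞ | x < s}.indicator 1
      (p.signalOf (fun i : Fin K => ‖y 0 i‖) w /
        (p.interferenceOf y v + ENNReal.ofReal p.noise)) with hΦdef
  have hΦ : Measurable fun q : (Fin (M + 1) → ℕ → Plane) × (Fin K → ℝ × Bool) ×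
      (Fin (M + 1) × ℕ → ℝ × Bool) => Φ q.1 q.2.1 q.2.2 := by
    have hr : Measurable fun q : (Fin (M + 1) → ℕ → Plane) × (Fin K → ℝ × Bool) ×
      (Fin (M + 1) × ℕ → ℝ × Bool) => fun i : Fin K => ‖q.1 0 i‖ := by fun_prop
    have hS : Measurable fun q : (Fin (M + 1) → ℕ → Plane) × (Fin K → ℝ × Bool) ×
        (Fin (M + 1) × ℕ → ℝ × Bool) => p.signalOf (fun i : Fin K => ‖q.1 0 i‖) q.2.1 := by
      have := p.measurable_signalOf.comp (hr.prodMk (measurable_fst.comp measurable_snd))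
      exact this
    have hI : Measurable fun q : (Fin (M + 1) → ℕ → Plane) × (Fin K → ℝ × Bool) ×
        (Fin (M + 1) × ℕ → ℝ × Bool) => p.interferenceOf q.1 q.2.2 := by
      have := p.measurable_interferenceOf.comp (f := fun q : (Fin (M + 1) → ℕ → Plane) ×
        (Fin K → ℝ × Bool) × (Fin (M + 1) × ℕ → ℝ × Bool) => (q.1, q.2.2)) (by fun_prop)
      exact this
    have hind : Measurable ({s : ℝ≥0∞ | x < s}.indicator (1 : ℝ≥0∞ → ℝ≥0∞)) :=
      measurable_one.indicator measurableSet_Ioi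
    exact (hψ.comp hr).mul (hind.comp (hS.div (hI.add_const _)))
  calc _ = ∫⁻ ω, Φ (fun m i => N.pos m i ω) (N.clusterMark K ω) (N.interfererMark K ω) ∂μ := by
        refine lintegral_congr fun ω => ?_
        change _ = ψ (N.clusterDist K ω) * {s : ℝ≥0∞ | x < s}.indicator 1
          (p.signalOf (N.clusterDist K ω) (N.clusterMark K ω) / (p.interferenceOf
            (fun m i => N.pos m i ω) (N.interfererMark K ω) + ENNReal.ofReal p.noise))
        rw [← signal_eq, ← interference_eq]
        rfl
    _ = _ := by
        rw [h.indepFun_pos_marks.lintegral_comp_of_indepFun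
          h.indepFun_clusterMark_interfererMark h.measurable_pos h.measurable_clusterMark
          h.measurable_interfererMark hΦ]
        refine lintegral_congr fun ω => ?_
        have hs : MeasurableSet {ω' | x < p.signalOf (N.clusterDist K ω)
            (N.clusterMark K ω') / (N.interference p ω + ENNReal.ofReal p.noise)} := by
          have hS : Measurable fun ω' => p.signalOf (N.clusterDist K ω) (N.clusterMark K ω') :=
            p.measurable_signalOf.comp (measurable_const.prodMk h.measurable_clusterMark)
          exact measurableSet_lt measurable_const (hS.div_const _)
        rw [← lintegral_indicator_one hs, ← lintegral_const_mul _ (measurable_one.indicator hs)]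
        refine lintegral_congr fun ω' => ?_
        simp only [hΦdef]
        rw [interference_eq]
        rfl

/-- The complementary distribution function of the useful power, with the negative coefficients
moved to the other side. -/
lemma measure_lt_signalOf_add (h : N.IsModel p μ) {r : Fin K → ℝ} (hr : ∀ i, 0 < r i)
    (hinj : Function.Injective r) {θ : ℝ} (hθ : 0 ≤ θ) {Z : ℝ≥0∞} (hZ : Z ≠ ∞) :
    μ {ω | ENNReal.ofReal θ < p.signalOf r (N.clusterMark K ω) / Z} +
      ∑ j, ENNReal.ofReal (-tailCoeff (fun i => r i ^ p.η) p.pIn Finset.univ j) *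
        negExp (ENNReal.ofReal (θ * r j ^ p.η) * Z) =
    ∑ j, ENNReal.ofReal (tailCoeff (fun i => r i ^ p.η) p.pIn Finset.univ j) *
        negExp (ENNReal.ofReal (θ * r j ^ p.η) * Z) := by
  set a := tailCoeff (fun i => r i ^ p.η) p.pIn Finset.univ with ha
  have hη : 0 < p.η := by linarith [p.two_lt_η]
  have hx : ∀ i, 0 < r i ^ p.η := fun i => Real.rpow_pos_of_pos (hr i) _
  have hxinj : Function.Injective fun i => r i ^ p.η := fun i j hij =>
    hinj ((Real.rpow_left_inj (hr i).le (hr j).le hη.ne').1 hij)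
  have hcinj : Function.Injective fun i : Fin K => ((0 : Fin (M + 1)), (i : ℕ)) := fun i j hij => by
    simpa [Fin.ext_iff] using hij
  have key := measureReal_lt_sum_eq_sum_tailCoeff (μ := μ)
    (H := fun i : Fin K => N.fade 0 i) (A := fun i : Fin K => N.act 0 i) (p := p.pIn)
    (h.iIndepFun_mark.precomp hcinj) (fun i => h.indepFun_fade_act (0, (i : ℕ)))
    (fun i => h.fade_meas 0 i) (fun i => h.act_meas 0 i) (fun i => h.fade_law 0 i)
    (fun i => by rw [h.act_law 0 i]; simp [NetParams.txProb]) hx hxinj Finset.univ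
    (θ * Z.toReal) (mul_nonneg hθ ENNReal.toReal_nonneg)
  have hset : μ {ω | ENNReal.ofReal θ < p.signalOf r (N.clusterMark K ω) / Z} =
      ENNReal.ofReal (∑ j, a j * Real.exp (-(r j ^ p.η) * (θ * Z.toReal))) := by
    rw [ha, ← key, ofReal_measureReal]
    refine measure_congr ?_
    have hpos : ∀ᵐ ω ∂μ, ∀ i : Fin K, 0 < N.fade 0 i ω :=
      ae_all_iff.2 fun i => ae_pos_of_map_eq_expMeasure (h.fade_meas 0 i) (h.fade_law 0 i)
    filter_upwards [hpos] with ω hω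
    have hsig : p.signalOf r (N.clusterMark K ω) =
        ENNReal.ofReal (∑ i : Fin K, if N.act 0 i ω then N.fade 0 i ω / r i ^ p.η else 0) := by
      rw [ENNReal.ofReal_sum_of_nonneg (fun i _ => by
        split_ifs
        · exact (div_pos (hω i) (hx i)).le
        · exact le_rfl)]
      refine Finset.sum_congr rfl fun i _ => ?_
      simp only [clusterMark, mark]
      rw [ENNReal.ofReal_rpow_of_pos (hr i), ← ENNReal.ofReal_mul
        (Real.rpow_nonneg (hr i).le _), Real.rpow_neg (hr i).le, inv_mul_eq_div,
        apply_ite ENNReal.ofReal, ENNReal.ofReal_zero]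
      rfl
    refine propext ?_
    change ENNReal.ofReal θ < p.signalOf r (N.clusterMark K ω) / Z ↔ _ < _
    -- This remains valid for `Z = 0`, with `a / 0 = ∞` for `a > 0` and `0 / 0 = 0`: the condition
    -- then says that the useful power is positive.
    rw [ENNReal.lt_div_iff_mul_lt (Or.inr ENNReal.ofReal_ne_top) (Or.inl hZ), hsig,
      ← ENNReal.ofReal_toReal hZ, ← ENNReal.ofReal_mul hθ,
      ENNReal.ofReal_lt_ofReal_iff_of_nonneg (mul_nonneg hθ ENNReal.toReal_nonneg),
      ENNReal.toReal_ofReal ENNReal.toReal_nonneg]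
  have hE : ∀ j, negExp (ENNReal.ofReal (θ * r j ^ p.η) * Z) =
      ENNReal.ofReal (Real.exp (-(r j ^ p.η) * (θ * Z.toReal))) := by
    intro j
    have h0 : 0 ≤ θ * r j ^ p.η := mul_nonneg hθ (hx j).le
    rw [← ENNReal.ofReal_toReal hZ, ← ENNReal.ofReal_mul h0,
      negExp_ofReal (mul_nonneg h0 ENNReal.toReal_nonneg),
      ENNReal.toReal_ofReal ENNReal.toReal_nonneg]
    congr 2; ring
  have hnonneg : 0 ≤ ∑ j, a j * Real.exp (-(r j ^ p.η) * (θ * Z.toReal)) := by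
    rw [ha, ← key]; exact measureReal_nonneg
  rw [hset]
  simp_rw [hE]
  -- `ENNReal.ofReal` keeps the positive part, so the two sums involve `max (a j) 0` and `max (-a j)
  -- 0`, whose difference is `a j`.
  have hconv : ∀ b : Fin K → ℝ, ∑ j, ENNReal.ofReal (b j) *
      ENNReal.ofReal (Real.exp (-(r j ^ p.η) * (θ * Z.toReal))) =
      ENNReal.ofReal (∑ j, max (b j) 0 * Real.exp (-(r j ^ p.η) * (θ * Z.toReal))) := by
    intro b
    rw [ENNReal.ofReal_sum_of_nonneg fun j _ => mul_nonneg (le_max_right _ _) (Real.exp_pos _).le]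
    refine Finset.sum_congr rfl fun j _ => ?_
    rw [ENNReal.ofReal_mul (le_max_right _ _)]
    congr 1
    rcases le_total (b j) 0 with hb | hb
    · rw [max_eq_right hb, ENNReal.ofReal_of_nonpos hb, ENNReal.ofReal_zero]
    · rw [max_eq_left hb]
  rw [hconv fun j => -a j, hconv a, ← ENNReal.ofReal_add hnonneg (Finset.sum_nonneg fun j _ =>
    mul_nonneg (le_max_right _ _) (Real.exp_pos _).le), ← Finset.sum_add_distrib]
  congr 1
  refine Finset.sum_congr rfl fun j _ => ?_
  rw [← add_mul]
  congr 1
  rcases le_total (a j) 0 with hb | hb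
  · rw [max_eq_right hb, max_eq_left (by linarith)]; ring
  · rw [max_eq_left hb, max_eq_right (by linarith)]; ring

end Network.IsModel

/-! ### The conditional distribution of the SINR -/

namespace NetParams

variable {K M : ℕ} (p : NetParams K M)

/-- The coefficients of the partial fraction expansion of the distribution of the useful power, as
functions of the distances. -/
def survivalCoeff (j : Fin K) (r : Fin K → ℝ) : ℝ :=
  tailCoeff (fun i => r i ^ p.η) p.pIn Finset.univ j

lemma measurable_survivalCoeff (j : Fin K) : Measurable (p.survivalCoeff j) := by
  unfold survivalCoeff tailCoeff
  refine Measurable.const_mul (Finset.measurable_fun_prod _ fun l _ => ?_) _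
  fun_prop

/-- The conditional Laplace transform of interference plus noise at `θ r_j ^ η`, given the
distances `r` of the in-cluster transmitters. -/
def noisyLaplace [NeZero K] (θ : ℝ) (j : Fin K) (r : Fin K → ℝ) : ℝ≥0∞ :=
  p.laplaceOf θ j r * negExp (ENNReal.ofReal (θ * r j ^ p.η) * ENNReal.ofReal p.noise)

lemma measurable_noisyLaplace [NeZero K] (θ : ℝ) (j : Fin K) :
    Measurable (p.noisyLaplace θ j) :=
  (p.measurable_laplaceOf θ j).mul (measurable_negExp.comp (by fun_prop))

end NetParams

namespace Network.IsModel

variable {K M : ℕ} [NeZero K] {Ω : Type*} [MeasurableSpace Ω] {N : Network M Ω} {p : NetParams K M}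
  {μ : Measure Ω} [IsProbabilityMeasure μ]

/-- For `u > 0`, `exp (-u I)` is at most the indicator of `I < ∞`. As `u → 0` its expectation tends
to one, by the explicit Laplace transform. -/
lemma ae_interference_ne_top (h : N.IsModel p μ) (hT : N.TierLaplace p μ)
    (hpos : ∀ᵐ ω ∂μ, ∀ i, 0 < N.clusterDist K ω i) : ∀ᵐ ω ∂μ, N.interference p ω ≠ ∞ := by
  set j := lastIdx K
  have hmeas : MeasurableSet {ω | N.interference p ω ≠ ∞} :=
    h.measurable_interference (measurableSet_singleton ∞).compl
  set u : ℕ → ℝ := fun n => 1 / ((n : ℝ) + 1) with hu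
  have hu0 : ∀ n, 0 < u n := fun n => by positivity
  have hul : Tendsto u atTop (𝓝 0) := tendsto_one_div_add_atTop_nhds_zero_nat
  have hle : ∀ n, ∫⁻ ω, p.laplaceOf (u n) j (N.clusterDist K ω) ∂μ ≤
      μ {ω | N.interference p ω ≠ ∞} := by
    intro n
    have e := h.lintegral_mul_negExp_interference hT (hu0 n).le j (ψ := 1) measurable_one hpos
    simp only [Pi.one_apply, one_mul] at e
    rw [← e, ← lintegral_indicator_one hmeas]
    refine lintegral_mono_ae (hpos.mono fun ω hω => ?_)
    by_cases hI : N.interference p ω = ∞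
    · have : ENNReal.ofReal (u n * N.clusterDist K ω j ^ p.η) ≠ 0 := by
        rw [Ne, ENNReal.ofReal_eq_zero, not_le]
        exact mul_pos (hu0 n) (Real.rpow_pos_of_pos (hω j) _)
      rw [hI, ENNReal.mul_top this, negExp_top]
      exact zero_le
    · rw [Set.indicator_of_mem (show ω ∈ {ω | N.interference p ω ≠ ∞} from hI)]
      exact negExp_le_one _
  have hlim : Tendsto (fun n => ∫⁻ ω, p.laplaceOf (u n) j (N.clusterDist K ω) ∂μ) atTop
      (𝓝 (∫⁻ _ω, 1 ∂μ)) := by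
    refine tendsto_lintegral_of_dominated_convergence (fun _ => 1)
      (fun n => (p.measurable_laplaceOf (u n) j).comp h.measurable_clusterDist) (fun n => ?_)
      (by simp) ?_
    · refine Eventually.of_forall fun ω => mul_le_one' (negExp_le_one _) ?_
      exact Finset.prod_le_one' fun m _ => negExp_le_one _
    · exact hpos.mono fun ω hω => p.tendsto_laplaceOf_zero j hω (fun n => (hu0 n).le) hul
  have h1 : 1 ≤ μ {ω | N.interference p ω ≠ ∞} := by
    have := le_of_tendsto' hlim hle
    simpa using this
  exact (mem_ae_iff_prob_eq_one hmeas).2 (le_antisymm prob_le_one h1)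

lemma lintegral_mul_negExp_noisy (h : N.IsModel p μ) (hT : N.TierLaplace p μ)
    (hpos : ∀ᵐ ω ∂μ, ∀ i, 0 < N.clusterDist K ω i) {θ : ℝ} (hθ : 0 ≤ θ) (j : Fin K)
    {ψ : (Fin K → ℝ) → ℝ≥0∞} (hψ : Measurable ψ) :
    ∫⁻ ω, ψ (N.clusterDist K ω) * negExp (ENNReal.ofReal (θ * N.clusterDist K ω j ^ p.η) *
        (N.interference p ω + ENNReal.ofReal p.noise)) ∂μ =
      ∫⁻ ω, ψ (N.clusterDist K ω) * p.noisyLaplace θ j (N.clusterDist K ω) ∂μ := by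
  have e := h.lintegral_mul_negExp_interference hT hθ j (ψ := fun r => ψ r *
    negExp (ENNReal.ofReal (θ * r j ^ p.η) * ENNReal.ofReal p.noise))
    (hψ.mul (measurable_negExp.comp (by fun_prop))) hpos
  calc _ = _ := lintegral_congr fun ω => by rw [mul_add, negExp_add]; ring
    _ = _ := e
    _ = _ := lintegral_congr fun ω => by rw [NetParams.noisyLaplace]; ring

/-- The integrated form of the conditional distribution of the SINR, with the negative coefficients
moved to the other side. -/
lemma lintegral_indicator_lt_sinr_add (h : N.IsModel p μ) (hT : N.TierLaplace p μ)
    (hpos : ∀ᵐ ω ∂μ, ∀ i, 0 < N.clusterDist K ω i)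
    (hmono : ∀ᵐ ω ∂μ, StrictMono (N.clusterDist K ω)) {θ : ℝ} (hθ : 0 ≤ θ)
    {ψ : (Fin K → ℝ) → ℝ≥0∞} (hψ : Measurable ψ) :
    ∫⁻ ω, ψ (N.clusterDist K ω) * {ω | ENNReal.ofReal θ < N.sinr p ω}.indicator 1 ω ∂μ +
      ∫⁻ ω, ψ (N.clusterDist K ω) * ∑ j, ENNReal.ofReal (-p.survivalCoeff j (N.clusterDist K ω)) *
          p.noisyLaplace θ j (N.clusterDist K ω) ∂μ =
      ∫⁻ ω, ψ (N.clusterDist K ω) * ∑ j, ENNReal.ofReal (p.survivalCoeff j (N.clusterDist K ω)) *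
          p.noisyLaplace θ j (N.clusterDist K ω) ∂μ := by
  have hI := h.ae_interference_ne_top hT hpos
  have hR := h.measurable_clusterDist
  have hψR : Measurable fun ω => ψ (N.clusterDist K ω) := hψ.comp hR
  set E : Fin K → Ω → ℝ≥0∞ := fun j ω => negExp (ENNReal.ofReal (θ * N.clusterDist K ω j ^ p.η) *
    (N.interference p ω + ENNReal.ofReal p.noise)) with hEdef
  have hEm : ∀ j, Measurable (E j) := fun j => by
    refine measurable_negExp.comp (Measurable.mul ?_ (h.measurable_interference.add_const _))
    exact Measurable.ennreal_ofReal (f := fun ω => θ * N.clusterDist K ω j ^ p.η)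
      ((((measurable_pi_apply j).comp hR).pow_const _).const_mul _)
  -- Any nonnegative weight depending only on the distances may be absorbed into `ψ`, so
  -- `noisyLaplace` can be replaced under the integral by the exponential it averages. Afterwards
  -- the claim holds pointwise.
  have hsum : ∀ b : Fin K → (Fin K → ℝ) → ℝ≥0∞, (∀ j, Measurable (b j)) →
      ∫⁻ ω, ψ (N.clusterDist K ω) * ∑ j, b j (N.clusterDist K ω) *
          p.noisyLaplace θ j (N.clusterDist K ω) ∂μ =
        ∫⁻ ω, ψ (N.clusterDist K ω) * ∑ j, b j (N.clusterDist K ω) * E j ω ∂μ := by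
    intro b hb
    have hbR : ∀ j, Measurable fun ω => b j (N.clusterDist K ω) := fun j => (hb j).comp hR
    have hLR : ∀ j, Measurable fun ω => p.noisyLaplace θ j (N.clusterDist K ω) := fun j =>
      (p.measurable_noisyLaplace θ j).comp hR
    simp_rw [Finset.mul_sum, ← mul_assoc]
    rw [lintegral_finsetSum _ (by fun_prop), lintegral_finsetSum _ (by fun_prop)]
    exact Finset.sum_congr rfl fun j _ =>
      (h.lintegral_mul_negExp_noisy hT hpos hθ j (ψ := fun r => ψ r * b j r)
        (hψ.mul (hb j))).symm
  have hbm : ∀ j, Measurable fun ω => ENNReal.ofReal (-p.survivalCoeff j (N.clusterDist K ω)) :=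
    fun j => ((p.measurable_survivalCoeff j).neg.ennreal_ofReal).comp hR
  rw [h.lintegral_mul_indicator_lt_sinr _ hψ,
    hsum (fun j r => ENNReal.ofReal (-p.survivalCoeff j r))
      (fun j => (p.measurable_survivalCoeff j).neg.ennreal_ofReal),
    hsum (fun j r => ENNReal.ofReal (p.survivalCoeff j r))
      (fun j => (p.measurable_survivalCoeff j).ennreal_ofReal),
    ← lintegral_add_right _ (by fun_prop)]
  refine lintegral_congr_ae ?_
  filter_upwards [hpos, hmono, hI] with ω h1 h2 h3
  rw [← mul_add]
  congr 1
  exact h.measure_lt_signalOf_add h1 h2.injective hθ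
    (ENNReal.add_ne_top.2 ⟨h3, ENNReal.ofReal_ne_top⟩)

/-- The integrated identities with `ψ` the indicators of Borel sets determine the conditional
probability; the negative coefficients are only moved back once everything is finite. -/
theorem condExp_indicator_lt_sinr (h : N.IsModel p μ) (hT : N.TierLaplace p μ)
    (hpos : ∀ᵐ ω ∂μ, ∀ i, 0 < N.clusterDist K ω i)
    (hmono : ∀ᵐ ω ∂μ, StrictMono (N.clusterDist K ω)) {θ : ℝ} (hθ : 0 ≤ θ) :
    μ⟦{ω | ENNReal.ofReal θ < N.sinr p ω} |
      MeasurableSpace.comap (N.clusterDist K) inferInstance⟧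
        =ᵐ[μ] fun ω => p.ccdf (N.clusterDist K ω) θ := by
  have hR := h.measurable_clusterDist
  set S := {ω | ENNReal.ofReal θ < N.sinr p ω} with hS
  have hSm : MeasurableSet S := h.measurableSet_lt_sinr _
  have hint : Integrable (S.indicator fun _ => (1 : ℝ)) μ :=
    (integrable_const _).indicator hSm
  have hc0 : 0 ≤ᵐ[μ] μ⟦S | MeasurableSpace.comap (N.clusterDist K) inferInstance⟧ :=
    condExp_nonneg (Eventually.of_forall fun ω => Set.indicator_nonneg (fun _ _ => zero_le_one) ω)
  have hset : ∀ B : Set (Fin K → ℝ), MeasurableSet B →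
      ∫⁻ ω in N.clusterDist K ⁻¹' B, ENNReal.ofReal
        ((μ⟦S | MeasurableSpace.comap (N.clusterDist K) inferInstance⟧) ω) ∂μ =
      ∫⁻ ω in N.clusterDist K ⁻¹' B, S.indicator 1 ω ∂μ := by
    intro B hB
    rw [← ofReal_integral_eq_lintegral_ofReal integrable_condExp.integrableOn
      (ae_restrict_of_ae hc0), setIntegral_condExp hR.comap_le hint ⟨B, hB, rfl⟩,
      ofReal_integral_eq_lintegral_ofReal hint.integrableOn (Eventually.of_forall fun ω =>
        Set.indicator_nonneg (fun _ _ => zero_le_one) ω)]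
    refine lintegral_congr fun ω => ?_
    by_cases hω : ω ∈ S <;> simp [hω]
  -- The conditional probability factors through the distances, so the comparison takes place under
  -- their law, where equal integrals over all Borel sets give equality almost everywhere.
  obtain ⟨c, hcm, hc⟩ := (stronglyMeasurable_condExp (m := MeasurableSpace.comap
    (N.clusterDist K) inferInstance) (μ := μ)
    (f := S.indicator fun _ => (1 : ℝ))).measurable.exists_eq_measurable_comp
  simp only [hc, Function.comp_apply] at hset ⊢
  rw [hc] at hc0
  set P : (Fin K → ℝ) → ℝ≥0∞ := fun r =>
    ∑ j, ENNReal.ofReal (p.survivalCoeff j r) * p.noisyLaplace θ j r with hP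
  set Q : (Fin K → ℝ) → ℝ≥0∞ := fun r =>
    ∑ j, ENNReal.ofReal (-p.survivalCoeff j r) * p.noisyLaplace θ j r with hQ
  have hPm : Measurable P := Finset.measurable_fun_sum _ fun j _ =>
    (p.measurable_survivalCoeff j).ennreal_ofReal.mul (p.measurable_noisyLaplace θ j)
  have hQm : Measurable Q := Finset.measurable_fun_sum _ fun j _ =>
    (p.measurable_survivalCoeff j).neg.ennreal_ofReal.mul (p.measurable_noisyLaplace θ j)
  have : IsProbabilityMeasure (μ.map (N.clusterDist K)) :=
    Measure.isProbabilityMeasure_map hR.aemeasurable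
  have key : (fun r => ENNReal.ofReal (c r) + Q r) =ᵐ[μ.map (N.clusterDist K)] P := by
    refine ae_eq_of_forall_setLIntegral_eq_of_sigmaFinite (hcm.ennreal_ofReal.add hQm) hPm
      fun B hB _ => ?_
    have e := h.lintegral_indicator_lt_sinr_add hT hpos hmono hθ (ψ := B.indicator 1)
      (measurable_one.indicator hB)
    have hmul : ∀ f : Ω → ℝ≥0∞, ∫⁻ ω, B.indicator 1 (N.clusterDist K ω) * f ω ∂μ =
        ∫⁻ ω in N.clusterDist K ⁻¹' B, f ω ∂μ := by
      intro f
      rw [← lintegral_indicator (hR hB)]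
      refine lintegral_congr fun ω => ?_
      by_cases hω : N.clusterDist K ω ∈ B <;> simp [Set.indicator, hω]
    simp only [hmul] at e
    have hfm : Measurable fun r => ENNReal.ofReal (c r) + Q r := hcm.ennreal_ofReal.add hQm
    rw [setLIntegral_map hB hfm hR, setLIntegral_map hB hPm hR,
      lintegral_add_right _ (show Measurable fun ω => Q (N.clusterDist K ω) from hQm.comp hR), ← e, ← hset B hB]
  filter_upwards [ae_of_ae_map hR.aemeasurable key, hc0, hpos, hmono] with ω h1 h2 h3 h4
  have hco : ∀ j, p.survivalCoeff j (N.clusterDist K ω) = p.G * p.coeff (N.clusterDist K ω) j :=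
    fun j => (p.G_mul_coeff h3 h4.injective j).symm
  have hC : ∀ j, p.noisyLaplace θ j (N.clusterDist K ω) =
      ENNReal.ofReal (p.Cterm (N.clusterDist K ω) θ j) := fun j =>
    p.laplaceOf_mul_negExp_noise hθ j h3
  have hC0 : ∀ j, 0 ≤ p.Cterm (N.clusterDist K ω) θ j := fun j => by
    unfold NetParams.Cterm NetParams.Dterm; positivity
  have h5 := congrArg ENNReal.toReal h1
  simp only [hP, hQ, hC] at h5
  have hfin : ∀ b : Fin K → ℝ, ∑ j, ENNReal.ofReal (b j) *
      ENNReal.ofReal (p.Cterm (N.clusterDist K ω) θ j) ≠ ∞ := fun b =>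
    ENNReal.sum_ne_top.2 fun j _ => ENNReal.mul_ne_top ENNReal.ofReal_ne_top ENNReal.ofReal_ne_top
  have hsum : ∀ b : Fin K → ℝ, (∑ j, ENNReal.ofReal (b j) *
      ENNReal.ofReal (p.Cterm (N.clusterDist K ω) θ j)).toReal =
      ∑ j, max (b j) 0 * p.Cterm (N.clusterDist K ω) θ j := by
    intro b
    rw [ENNReal.toReal_sum fun j _ => ENNReal.mul_ne_top ENNReal.ofReal_ne_top
      ENNReal.ofReal_ne_top]
    refine Finset.sum_congr rfl fun j _ => ?_
    rw [ENNReal.toReal_mul, ENNReal.toReal_ofReal', ENNReal.toReal_ofReal (hC0 j)]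
  rw [ENNReal.toReal_add ENNReal.ofReal_ne_top (hfin _), hsum, hsum,
    ENNReal.toReal_ofReal (show 0 ≤ c (N.clusterDist K ω) from h2)] at h5
  change c (N.clusterDist K ω) = _
  rw [NetParams.ccdf, Finset.mul_sum, ← add_right_cancel_iff, h5, ← Finset.sum_add_distrib]
  refine Finset.sum_congr rfl fun j _ => ?_
  rw [← mul_assoc, ← hco, ← add_mul]
  congr 1
  rcases le_total (p.survivalCoeff j (N.clusterDist K ω)) 0 with hb | hb
  · rw [max_eq_right hb, max_eq_left (by linarith)]; ring
  · rw [max_eq_left hb, max_eq_right (by linarith)]; ring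

end Network.IsModel

/-! ### Given and random cluster geometry -/

namespace Network

variable {K M : ℕ} {Ω : Type*} [MeasurableSpace Ω] {N : Network M Ω} {p : NetParams K M}
  {μ : Measure Ω}

lemma GivenCluster.clusterDist_eq {d : Fin K → ℝ} {r : ℝ} (hc : N.GivenCluster p μ d r) :
    ∀ᵐ ω ∂μ, N.clusterDist K ω = d := by
  filter_upwards [ae_all_iff.2 hc.dist] with ω hω
  exact funext hω

variable [IsProbabilityMeasure μ]

/-- The distances are almost surely constant, so the weight comes out of the integral; restricting
the intensity to the outside of the disc is the same as letting the functional vanish inside. -/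
lemma GivenCluster.tierLaplace [NeZero K] {d : Fin K → ℝ} (hc : N.GivenCluster p μ d (d (lastIdx K))) :
    N.TierLaplace p μ := by
  intro θ hθ j ψ hψ
  have hd := hc.clusterDist_eq
  have hset : MeasurableSet {x : Plane | d (lastIdx K) < ‖x‖} :=
    measurableSet_lt measurable_const measurable_norm
  have e := hc.ppp.lintegral_negExp_tsum (fun n => ((Measure.restrict_apply_le _ _).trans_lt
    (p.intensity_ball_ne_top 0 n).lt_top).ne) (g := markFun p.pOut p.η (θ * d j ^ p.η))
    ((measurable_markFun _ _).comp (f := fun x : Plane => (θ * d j ^ p.η, x)) (by fun_prop))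
  have e2 : negExp (∫⁻ x, (1 - negExp (markFun p.pOut p.η (θ * d j ^ p.η) x))
      ∂((p.intensity 0).restrict {x | d (lastIdx K) < ‖x‖})) =
      p.beyondLaplace (d (lastIdx K)) (θ * d j ^ p.η) := by
    rw [NetParams.beyondLaplace, ← lintegral_indicator hset]
    congr 1
    refine lintegral_congr fun x => ?_
    by_cases hx : d (lastIdx K) < ‖x‖ <;> simp [hx, negExp_zero]
  have hm : Measurable fun ω => negExp (∑' i, markFun p.pOut p.η (θ * d j ^ p.η)
      (N.pos 0 (K + i) ω)) :=
    measurable_negExp.comp (Measurable.tsum fun i => ((measurable_markFun _ _).comp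
      (f := fun x : Plane => (θ * d j ^ p.η, x)) (by fun_prop)).comp (hc.ppp.measurable i))
  calc _ = ∫⁻ ω, ψ d * negExp (∑' i, markFun p.pOut p.η (θ * d j ^ p.η)
        (N.pos 0 (K + i) ω)) ∂μ := lintegral_congr_ae (hd.mono fun ω hω => by simp only [hω])
    _ = ∫⁻ _ω, ψ d * p.beyondLaplace (d (lastIdx K)) (θ * d j ^ p.η) ∂μ := by
        rw [lintegral_const_mul _ hm, e, e2, lintegral_const, measure_univ, mul_one]
    _ = _ := lintegral_congr_ae (hd.mono fun ω hω => by simp only [hω])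

namespace RandomCluster

/-- An enumeration by increasing distance is strict because ties almost surely do not occur. -/
lemma ae_strictMono (hc : N.RandomCluster p μ) : ∀ᵐ ω ∂μ, StrictMono fun i => ‖N.pos 0 i ω‖ := by
  have hinj := hc.ppp.ae_injective_norm (c := ENNReal.ofReal (p.lam 0) * ENNReal.ofReal Real.pi)
    (ENNReal.mul_ne_top ENNReal.ofReal_ne_top ENNReal.ofReal_ne_top) (fun n k => by
      rw [NetParams.intensity, Measure.smul_apply, smul_eq_mul, mul_assoc]
      gcongr
      exact volume_sqLevel_fiber_le n k)
  filter_upwards [hc.ordered, hinj] with ω h1 h2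
  exact h1.strictMono_of_injective h2

lemma ae_pos (hc : N.RandomCluster p μ) : ∀ᵐ ω ∂μ, ∀ i, 0 < ‖N.pos 0 i ω‖ := by
  have h0 : p.intensity 0 {0} = 0 := by
    rw [NetParams.intensity, Measure.smul_apply]; simp
  filter_upwards [hc.ppp.ae_ne_zero h0] with ω h1 i
  exact norm_pos_iff.2 (h1 i)

/-- An instance of `lintegral_mul_negExp_beyond`, whose parameter is the squared distance; hence the
exponent `η / 2`. -/
lemma tierLaplace [NeZero K] (hc : N.RandomCluster p μ) : N.TierLaplace p μ := by
  intro θ hθ j ψ hψ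
  have hη : 0 < p.η := by linarith [p.two_lt_η]
  have hsq : ∀ a : ℝ, 0 ≤ a → (a ^ 2) ^ (p.η / 2) = a ^ p.η := fun a ha => by
    rw [← Real.rpow_natCast, ← Real.rpow_mul ha]; congr 1; push_cast; ring
  have hu : Continuous fun u : ℝ => θ * u ^ (p.η / 2) :=
    continuous_const.mul (Real.continuous_rpow_const (by positivity))
  have e := hc.ppp.lintegral_mul_negExp_beyond (p.intensity_ball_ne_top 0) hc.ordered
    (g := fun u x => markFun p.pOut p.η (θ * u ^ (p.η / 2)) x)
    ((measurable_markFun p.pOut p.η).comp (f := fun q : ℝ × Plane => (θ * q.1 ^ (p.η / 2), q.2))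
      (by fun_prop))
    (fun x _ u hu v _ huv => markFun_mono _ _ _ (by
      have : 0 ≤ u := hu
      gcongr))
    (fun x hx => ((continuous_markFun _ _ hx).comp hu).continuousOn) j
    (ψ := fun q => ψ fun i => √(q i)) (hψ.comp (by fun_prop))
  simp only [Real.sqrt_sq (norm_nonneg _), hsq _ (norm_nonneg _)] at e
  refine Eq.trans (lintegral_congr_ae ?_) e
  filter_upwards [hc.ae_strictMono] with ω hω
  congr 2
  -- By strict ordering, lying beyond the last cluster node means having index at least `K`; the sum
  -- is then reindexed by the shift `K + i`.
  have hK : ∀ i, ‖N.pos 0 (lastIdx K) ω‖ < ‖N.pos 0 i ω‖ ↔ K ≤ i := fun i => by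
    have := NeZero.pos K
    rw [hω.lt_iff_lt]
    simp only [lastIdx]
    omega
  simp only [hK]
  rw [← (add_right_injective K).tsum_eq (f := fun i => if K ≤ i then
    markFun p.pOut p.η (θ * ‖N.pos 0 j ω‖ ^ p.η) (N.pos 0 i ω) else 0)]
  · simp [clusterDist]
  · intro i hi
    have : K ≤ i := by by_contra h; simp [h] at hi
    exact ⟨i - K, by simp only; omega⟩

end RandomCluster

end Network

end

/-- Exact CCDF of the SINR: (1) for a given cluster geometry `0 < d₁ < ⋯ < d_K`; (2) when the
transmitters form a Poisson point process and the cluster consists of the `K` closest ones,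
conditionally on the in-cluster distances (which are then almost surely positive and distinct). -/
theorem proposition1 {K M : ℕ} [NeZero K] (p : NetParams K M)
    {Ω : Type*} [MeasurableSpace Ω] (μ : Measure Ω) [IsProbabilityMeasure μ]
    (N : Network M Ω) (hN : N.IsModel p μ) (θ : ℝ) (hθ : 0 ≤ θ) :
    (∀ d : Fin K → ℝ, (∀ i, 0 < d i) → StrictMono d →
      N.GivenCluster p μ d (d (lastIdx K)) →
        μ.real {ω | ENNReal.ofReal θ < N.sinr p ω} = p.ccdf d θ) ∧
    (N.RandomCluster p μ →
      (∀ᵐ ω ∂μ, (∀ i : Fin K, 0 < ‖N.pos 0 i ω‖) ∧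
        StrictMono fun i : Fin K => ‖N.pos 0 i ω‖) ∧
      μ⟦{ω | ENNReal.ofReal θ < N.sinr p ω} |
          MeasurableSpace.comap (fun ω (i : Fin K) => ‖N.pos 0 i ω‖) inferInstance⟧
        =ᵐ[μ] fun ω => p.ccdf (fun i => ‖N.pos 0 i ω‖) θ) := by
  refine ⟨fun d hd hmono hc => ?_, fun hc => ?_⟩
  · have hdist := hc.clusterDist_eq
    -- Here the conditional probability is almost surely the constant `p.ccdf d θ`, so its mean is
    -- the unconditional probability.
    have hce := hN.condExp_indicator_lt_sinr hc.tierLaplace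
      (hdist.mono fun ω hω => by rw [hω]; exact hd) (hdist.mono fun ω hω => by rwa [hω]) hθ
    have hS := hN.measurableSet_lt_sinr (ENNReal.ofReal θ)
    rw [← integral_indicator_one hS]
    calc _ = ∫ ω, (μ⟦{ω | ENNReal.ofReal θ < N.sinr p ω} |
          MeasurableSpace.comap (N.clusterDist K) inferInstance⟧) ω ∂μ :=
          (integral_condExp hN.measurable_clusterDist.comap_le).symm
      _ = ∫ _ω, p.ccdf d θ ∂μ := integral_congr_ae (by
          filter_upwards [hce, hdist] with ω h1 h2
          rw [h1, h2])
      _ = _ := by simp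
  · have hpos : ∀ᵐ ω ∂μ, ∀ i, 0 < N.clusterDist K ω i := hc.ae_pos.mono fun ω hω i => hω i
    have hmono : ∀ᵐ ω ∂μ, StrictMono (N.clusterDist K ω) :=
      hc.ae_strictMono.mono fun ω hω i j hij => hω hij
    exact ⟨hpos.and hmono, hN.condExp_indicator_lt_sinr hc.tierLaplace hpos hmono hθ⟩
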